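/- A *faced graph* is a triple $G=(V,E,F)$ in which $(V,E)$ is a finite simple graph and $F$ is a set of 3-cycles of $(V,E)$, called facial. It is a *surface graph for the real projective plane $\mathbb P$ with one hole* if there is a closed walk $h$ of some length $s\ge 3$ in the connected graph $(V,E)$ (vertices and edges may be repeated in $h$) such that attaching a triangle along each 3-cycle in $F$ and one $s$-gonal disc (the hole) along $h$ produces the real projective plane. For a graph $H$ put $f(H)=3|V(H)|-|E(H)|$; a graph is *$(3,6)$-tight* if it satisfies $f=6$ and all its subgraphs $H$ with at least three vertices satisfy $f(H)\ge 6$. Let $\mathfrak P_1$ be the class of all surface graphs for $\mathbb P$ with one hole whose graph $(V,E)$ is $(3,6)$-tight (the boundary walk of the hole then necessarily has length $6$). An edge is an *$FF$ edge* if it lies on two facial 3-cycles, and an $FF$ edge is *contractible* if it lies on no nonfacial 3-cycle of the graph. For a contractible edge $e=vw$ the contraction $G/e$ is the faced graph obtained by merging $w$ into $v$, deleting $e$, identifying the resulting parallel edges, deleting the two facial 3-cycles through $e$ and carrying along the other facial 3-cycles. A faced graph $G\in\mathfrak P_1$ is *irreducible* if $G/e\notin\mathfrak P_1$ for every contractible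 edge $e$ of $G$. **Proposition.** Let $G\in\mathfrak P_1$ be irreducible. Then $G$ is uncontractible; that is, every $FF$ edge of $G$ lies on a nonfacial 3-cycle. -/

import Mathlib

/-- A simple graph `(V, E)` with a set `F` of distinguished 3-cycles, the facial 3-cycles.
A 3-cycle is recorded by its set of three vertices. -/
structure FacedGraph (V : Type*) where
  /-- the underlying simple graph `(V, E)` -/
  graph : SimpleGraph V
  /-- the set `F` of facial 3-cycles -/
  faces : Finset (Finset V)
  isNClique_of_mem : ∀ t ∈ faces, graph.IsNClique 3 t

namespace FacedGraph

/-! ### (3,6)-tightness -/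

/-- The freedom number `f(H) = 3|V(H)| - |E(H)|` of a subgraph (of a finite graph). -/
noncomputable def freedom {V : Type*} {Γ : SimpleGraph V} (H : Γ.Subgraph) : ℤ :=
  3 * (H.verts.ncard : ℤ) - (H.edgeSet.ncard : ℤ)

/-- `f(H) ≥ 6` for every subgraph `H` with at least three vertices. -/
def IsSparse36 {V : Type*} (Γ : SimpleGraph V) : Prop :=
  ∀ H : Γ.Subgraph, 3 ≤ H.verts.ncard → 6 ≤ freedom H

/-- (3,6)-sparse, and the whole graph satisfies the Maxwell count `f(Γ) = 6`. -/
def IsTight36 {V : Type*} (Γ : SimpleGraph V) : Prop :=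
  IsSparse36 Γ ∧ freedom (⊤ : Γ.Subgraph) = 6

/-! ### Surface graphs for the projective plane, with one hole -/

/-- The number of facial 3-cycles that contain both `u` and `v`. -/
def faceCount {V : Type*} [DecidableEq V] (G : FacedGraph V) (u v : V) : ℕ :=
  (G.faces.filter (fun t => u ∈ t ∧ v ∈ t)).card

/-- The number of times that the closed walk `h 0, h 1, …, h (s-1), h 0` runs along the edge
`uv`, in either direction. -/
noncomputable def holeCount {V : Type*} {s : ℕ} (h : ZMod s → V) (u v : V) : ℕ :=
  {i : ZMod s | s(h i, h (i + 1)) = s(u, v)}.ncard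

/-- The link of the vertex `v` in the complex obtained from `G` by attaching a triangle along each
facial 3-cycle and an `s`-gon along the closed walk `h`. Its vertices are the neighbours of `v`;
two of them are joined if they are the two sides at `v` of a corner of a triangle or of the
`s`-gon. -/
def link {V : Type*} [DecidableEq V] (G : FacedGraph V) {s : ℕ} (h : ZMod s → V) (v : V) :
    SimpleGraph (G.graph.neighborSet v) :=
  SimpleGraph.fromRel fun a b =>
    ({v, a.1, b.1} : Finset V) ∈ G.faces ∨
      ∃ i : ZMod s, h i = a.1 ∧ h (i + 1) = v ∧ h (i + 2) = b.1

/-- Attaching a triangle along each facial 3-cycle of `G` and one further disc, the hole, along the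
closed walk `h` of length `s ≥ 3` gives the real projective plane. That is, the result is a
connected closed surface (each edge is on exactly two sides of polygons, and the polygon corners
at each vertex form a single cyclic sequence) of Euler characteristic `1`; the projective plane is
the only such surface. The walk `h` may repeat vertices and edges. -/
structure IsProjectiveWithHole {V : Type*} [Fintype V] [DecidableEq V] (G : FacedGraph V)
    {s : ℕ} (h : ZMod s → V) : Prop where
  three_le : 3 ≤ s
  connected : G.graph.Connected
  hole_adj : ∀ i, G.graph.Adj (h i) (h (i + 1))
  two_sides : ∀ u v, G.graph.Adj u v → G.faceCount u v + holeCount h u v = 2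
  link_connected : ∀ v, (G.link h v).Connected
  euler : (Fintype.card V : ℤ) - (G.graph.edgeSet.ncard : ℤ) + ((G.faces.card : ℤ) + 1) = 1

/-- The class of (3,6)-tight surface graphs `(V, E, F)` for the real projective plane that have
exactly one hole. -/
def MemP1 {V : Type*} [Fintype V] [DecidableEq V] (G : FacedGraph V) : Prop :=
  (∃ (s : ℕ) (h : ZMod s → V), G.IsProjectiveWithHole h) ∧ IsTight36 G.graph

/-! ### FF edges and their contraction -/

/-- `uv` is an edge that is contained in two facial 3-cycles. -/
def IsFF {V : Type*} [DecidableEq V] (G : FacedGraph V) (u v : V) : Prop :=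
  G.graph.Adj u v ∧ G.faceCount u v = 2

/-- The edge `uv` lies on a 3-cycle of the graph that is not facial. -/
def OnNonfacial3Cycle {V : Type*} [DecidableEq V] (G : FacedGraph V) (u v : V) : Prop :=
  G.graph.Adj u v ∧
    ∃ x, G.graph.Adj u x ∧ G.graph.Adj v x ∧ ({u, v, x} : Finset V) ∉ G.faces

/-- `uv` is a contractible edge: an FF edge that lies on no nonfacial 3-cycle. -/
def IsContractible {V : Type*} [DecidableEq V] (G : FacedGraph V) (u v : V) : Prop :=
  G.IsFF u v ∧ ¬ G.OnNonfacial3Cycle u v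

/-- The map of vertices that merges `w` into `v`. -/
def mergeMap {V : Type*} [DecidableEq V] {v w : V} (hvw : v ≠ w) (x : V) : {x : V // x ≠ w} :=
  if hx : x = w then ⟨v, hvw⟩ else ⟨x, hx⟩

theorem mergeMap_eq_iff {V : Type*} [DecidableEq V] {v w : V} (hvw : v ≠ w) {x y : V}
    (h : mergeMap hvw x = mergeMap hvw y) : x = y ∨ (x = v ∧ y = w) ∨ (x = w ∧ y = v) := by
  unfold mergeMap at h
  split_ifs at h with hx hy hy
  · exact Or.inl (hx.trans hy.symm)
  · exact Or.inr (Or.inr ⟨hx, (congrArg Subtype.val h).symm⟩)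
  · exact Or.inr (Or.inl ⟨congrArg Subtype.val h, hy⟩)
  · exact Or.inl (congrArg Subtype.val h)

/-- The edge contraction of `vw`: the vertex `w` is deleted, every edge `xw` with `x ≠ v` is
replaced by `xv` (multiple edges being identified), the facial 3-cycles through the edge `vw` are
deleted, and the others are carried along. -/
def contract {V : Type*} [DecidableEq V] (G : FacedGraph V) {v w : V} (hvw : v ≠ w) :
    FacedGraph {x : V // x ≠ w} where
  graph := SimpleGraph.fromRel fun a b =>
    ∃ x y, mergeMap hvw x = a ∧ mergeMap hvw y = b ∧ G.graph.Adj x y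
  faces := (G.faces.filter (fun t => ¬ (v ∈ t ∧ w ∈ t))).image (fun t => t.image (mergeMap hvw))
  isNClique_of_mem := by
    intro t ht
    obtain ⟨t₀, ht₀, rfl⟩ := Finset.mem_image.1 ht
    obtain ⟨htF, hnot⟩ := Finset.mem_filter.1 ht₀
    have hc := G.isNClique_of_mem t₀ htF
    have inj : Set.InjOn (mergeMap hvw) (t₀ : Set V) := by
      intro x hx y hy hxy
      rcases mergeMap_eq_iff hvw hxy with h | ⟨h1, h2⟩ | ⟨h1, h2⟩
      · exact h
      · subst h1; subst h2; exact absurd ⟨hx, hy⟩ hnot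
      · subst h1; subst h2; exact absurd ⟨hy, hx⟩ hnot
    refine ⟨?_, by rw [Finset.card_image_of_injOn inj, hc.card_eq]⟩
    intro a ha b hb hab
    obtain ⟨x, hx, rfl⟩ := Finset.mem_image.1 (Finset.mem_coe.1 ha)
    obtain ⟨y, hy, rfl⟩ := Finset.mem_image.1 (Finset.mem_coe.1 hb)
    have hxy : x ≠ y := fun h => hab (by rw [h])
    exact (SimpleGraph.fromRel_adj _ _ _).2 ⟨hab, Or.inl ⟨x, y, rfl, rfl, hc.isClique hx hy hxy⟩⟩

/-- No contraction of a contractible FF edge leads to a one-hole (3,6)-tight surface graph for the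
projective plane. -/
def IsIrreducible {V : Type*} [Fintype V] [DecidableEq V] (G : FacedGraph V) : Prop :=
  ∀ (v w : V) (hvw : v ≠ w), G.IsContractible v w → ¬ (G.contract hvw).MemP1

/-- Every FF edge lies on a nonfacial 3-cycle. -/
def IsUncontractible {V : Type*} [DecidableEq V] (G : FacedGraph V) : Prop :=
  ∀ u v : V, G.IsFF u v → G.OnNonfacial3Cycle u v

end FacedGraph

/-!
An irreducible graph in the class has no facial 3-cycles at all, hence no `FF` edges. This rests on
a certificate for (3,6)-tightness that survives contractions: a colouring `κ` of the vertices modulo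
three such that no facial 3-cycle has three different colours and the colour increases by one along
each of the six sides of the hole (`FacedGraph.IsCertificate`).

*A tight graph has a certificate* (`IsProjectiveWithHole.exists_isCertificate`). The projective
plane is not orientable, so twice the cell of the hole is a coboundary of an integral 1-cochain `w`
that is closed on the triangles. Sparsity gives an isoperimetric inequality: a 2-chain `N` has
boundary of length at least `6 |N c₀|`, where `c₀` is the hole. By duality a cycle `z` satisfies
`3 |⟨z, w⟩| ≤ |z|`, so there are no negative cycles for the edge lengths `1 ± 3 w`, and the distance
function `p` from a base vertex satisfies `|dp + 3 w| ≤ 1` (`IsProjective.exists_form`). The form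
`dp + 3 w` has the total `6` around the hole, so it equals one on each of its sides, and total `0`
around each triangle, so it vanishes on some side of it. Then `κ = p mod 3` is a certificate.

*A certificate implies tightness* (`IsProjectiveWithHole.isTight36_of_isCertificate`). The lift of
`dκ` to `{-1, 0, 1}` has flux six through the boundary of the hole. For a subgraph, Euler's relation
reduces the count of edges to a count of the orientable regions of its complement. Each region has
at least three sides, and the region with the hole, if it is orientable, at least six, because of
the flux (`IsProjective.isSparse_of_form`).

*Contraction* (`IsProjectiveWithHole.contract`). Contracting a contractible edge gives again the
projective plane with a hole of the same length, and the certificate descends if the ends of the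
edge have the same colour. So in an irreducible graph no contractible edge has ends of the same
colour.

*Conclusion* (`IsIrreducible.faces_eq_empty`). If there is a face, it has an edge with ends of the
same colour. Such an edge is an `FF` edge, and it is not contractible, so it lies on a nonfacial
3-cycle `T`. The form vanishes on an edge of `T`, so the flux through `T` is too small for `T` not to
separate the hole from the rest (`IsProjective.exists_sides_of_card_eq_three`). Take `T` with the
least number of cells on the far side. By minimality, on this side the edges with ends of the same
colour are edges of `T`. This leaves only a vertex of degree three joined to `T`, all of whose
vertices have the same colour; giving the inner vertex this colour as well makes its edges
contractible with ends of the same colour, a contradiction.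
-/

set_option linter.unusedSectionVars false

/-! ### The sign of a permutation and the number of its orbits -/

/-- If the fibres of the surjection `f` are exactly the orbits of `σ`, the sign of `σ` is determined
by the parity of the number of points plus the number of orbits. -/
theorem sign_eq_neg_one_pow_card_add_card_orbits {α β : Type*} [Fintype α] [DecidableEq α]
    [Fintype β] [DecidableEq β] (σ : Equiv.Perm α) (f : α → β) (hf : Function.Surjective f)
    (hσ : ∀ a, f (σ a) = f a)
    (htrans : ∀ Q : α → Prop, (∀ a, Q a ↔ Q (σ a)) → ∀ a b, f a = f b → Q a → Q b) :
    (Equiv.Perm.sign σ : ℤ) = (-1) ^ (Fintype.card α + Fintype.card β) := by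
  classical
  have hsame : ∀ a b, f a = f b ↔ σ.SameCycle a b := by
    intro a b
    constructor
    · intro h
      exact htrans (fun c => σ.SameCycle a c)
        (fun c => (Equiv.Perm.sameCycle_apply_right).symm) a b h (Equiv.Perm.SameCycle.refl σ a)
    · intro h
      obtain ⟨n, -, hn⟩ := h.exists_pow_eq'
      rw [← hn]
      clear hn
      induction n with
      | zero => simp
      | succ n ih => rw [pow_succ', Equiv.Perm.mul_apply, hσ, ← ih]
  let q : α → Equiv.Perm α ⊕ α := fun a => if σ a = a then Sum.inr a else Sum.inl (σ.cycleOf a)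
  have hq : ∀ a b, q a = q b ↔ f a = f b := by
    intro a b
    rw [hsame]
    by_cases ha : σ a = a <;> by_cases hb : σ b = b <;> simp only [q, ha, hb, if_true, if_false]
    · simp only [Sum.inr.injEq]
      constructor
      · rintro rfl; exact Equiv.Perm.SameCycle.refl _ _
      · exact fun h => h.eq_of_left ha
    · simp only [reduceCtorEq, false_iff]
      intro h
      exact hb (by rw [← h.eq_of_left ha]; exact ha)
    · simp only [reduceCtorEq, false_iff]
      intro h
      exact ha (by rw [h.eq_of_right hb]; exact hb)
    · simp only [Sum.inl.injEq]
      constructor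
      · intro h
        by_contra hns
        have h1 : σ.cycleOf b b = b := by
          rw [← h]; exact Equiv.Perm.cycleOf_apply_of_not_sameCycle hns
        rw [Equiv.Perm.cycleOf_apply_self] at h1
        exact hb h1
      · exact fun h => h.cycleOf_eq
  have hcard1 : (Finset.univ.image q).card = Fintype.card β := by
    have himg : Finset.univ.image q = Finset.univ.image (fun b => q (Function.surjInv hf b)) := by
      ext x
      simp only [Finset.mem_image, Finset.mem_univ, true_and]
      constructor
      · rintro ⟨a, rfl⟩
        exact ⟨f a, (hq _ _).2 (Function.surjInv_eq hf _)⟩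
      · rintro ⟨b, rfl⟩
        exact ⟨_, rfl⟩
    rw [himg, Finset.card_image_of_injective, Finset.card_univ]
    intro b b' h
    have := (hq _ _).1 h
    rwa [Function.surjInv_eq hf, Function.surjInv_eq hf] at this
  have hcard2 : (Finset.univ.image q).card = σ.cycleFactorsFinset.card + σ.supportᶜ.card := by
    rw [← Finset.card_disjSum]
    congr 1
    ext x
    rcases x with c | a
    · simp only [Finset.mem_image, Finset.mem_univ, true_and, Finset.inl_mem_disjSum]
      constructor
      · rintro ⟨a, ha⟩
        by_cases h : σ a = a
        · simp [q, h] at ha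
        · simp only [q, h, if_false, Sum.inl.injEq] at ha
          rw [← ha, Equiv.Perm.cycleOf_mem_cycleFactorsFinset_iff]
          exact Equiv.Perm.mem_support.2 h
      · intro hc
        obtain ⟨a, ha⟩ := (Equiv.Perm.mem_cycleFactorsFinset_iff.1 hc).1.nonempty_support
        have h := Equiv.Perm.mem_support.1 (Equiv.Perm.mem_cycleFactorsFinset_support_le hc ha)
        refine ⟨a, ?_⟩
        simp only [q, h, if_false]
        rw [Equiv.Perm.cycle_is_cycleOf ha hc]
    · simp only [Finset.mem_image, Finset.mem_univ, true_and, Finset.inr_mem_disjSum,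
        Finset.mem_compl, Equiv.Perm.mem_support, not_not]
      constructor
      · rintro ⟨b, hb⟩
        by_cases h : σ b = b
        · simp only [q, h, if_true, Sum.inr.injEq] at hb
          exact hb ▸ h
        · simp [q, h] at hb
      · intro h
        exact ⟨a, by simp [q, h]⟩
  have hsupp : σ.support.card + σ.supportᶜ.card = Fintype.card α := Finset.card_add_card_compl _
  have hct : Multiset.card σ.cycleType = σ.cycleFactorsFinset.card := by
    rw [Equiv.Perm.cycleType_def, Multiset.card_map]; rfl
  rw [Equiv.Perm.sign_of_cycleType, Equiv.Perm.sum_cycleType, hct]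
  push_cast
  have h2 : Fintype.card α + Fintype.card β
      = σ.support.card + σ.cycleFactorsFinset.card + 2 * σ.supportᶜ.card := by omega
  rw [h2, pow_add _ _ (2 * _), pow_mul]
  simp

/-! ### Polygonal complexes -/

/-- A two-dimensional complex glued from polygons, described by its vertices `V`, edges `E`,
cells `C` and the sides `S` of the cells. Each edge has a reference direction from `tail` to
`head`; each side runs along an edge, in the reference direction if `sgn` is `1` and against it if
`sgn` is `-1`; `next` goes once around the boundary of a cell. -/
structure PolyComplex (V E C S : Type*) where
  tail : E → V
  head : E → V
  edge : S → E
  sgn : S → ℤ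
  cell : S → C
  next : Equiv.Perm S

namespace PolyComplex

variable {V E C S : Type*}

/-- The vertex in which a side starts. -/
def src (X : PolyComplex V E C S) (s : S) : V :=
  if X.sgn s = 1 then X.tail (X.edge s) else X.head (X.edge s)

/-- The vertex in which a side ends. -/
def tgt (X : PolyComplex V E C S) (s : S) : V :=
  if X.sgn s = 1 then X.head (X.edge s) else X.tail (X.edge s)

/-- The complex is a closed connected surface of Euler characteristic `1` without loops. The
connectedness conditions (of the graph, of the links of the vertices and of the boundaries of the
cells) are stated through predicates that are constant on adjacent elements. -/
structure IsProjective [Fintype V] [Fintype E] [Fintype C] [Fintype S] [DecidableEq E]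
    (X : PolyComplex V E C S) : Prop where
  sgn_eq : ∀ s, X.sgn s = 1 ∨ X.sgn s = -1
  ne : ∀ e, X.tail e ≠ X.head e
  cell_next : ∀ s, X.cell (X.next s) = X.cell s
  src_next : ∀ s, X.src (X.next s) = X.tgt s
  two_sides : ∀ e, (Finset.univ.filter fun s => X.edge s = e).card = 2
  conn : ∀ Q : V → Prop, (∀ e, Q (X.tail e) ↔ Q (X.head e)) → ∀ u v, Q u → Q v
  link : ∀ (v : V) (Q : E → Prop),
    (∀ s, X.tgt s = v → (Q (X.edge s) ↔ Q (X.edge (X.next s)))) →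
    ∀ e e', (X.tail e = v ∨ X.head e = v) → (X.tail e' = v ∨ X.head e' = v) → Q e → Q e'
  cell_trans : ∀ Q : S → Prop, (∀ s, Q s ↔ Q (X.next s)) →
    ∀ s s', X.cell s = X.cell s' → Q s → Q s'
  cell_surj : Function.Surjective X.cell
  nonempty : Nonempty C
  euler : Fintype.card V + Fintype.card C = Fintype.card E + 1

section Chains

variable [Fintype V] [Fintype E] [Fintype C] [Fintype S] [DecidableEq V] [DecidableEq E]
  [DecidableEq C] {A : Type*} [CommRing A]

/-- The boundary of a 2-chain. -/
def bd (X : PolyComplex V E C S) (N : C → A) (e : E) : A :=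
  ∑ s with X.edge s = e, (X.sgn s : A) * N (X.cell s)

/-- The coboundary of a 1-cochain. -/
def cobd (X : PolyComplex V E C S) (w : E → A) (c : C) : A :=
  ∑ s with X.cell s = c, (X.sgn s : A) * w (X.edge s)

/-- The coboundary of a 0-cochain. -/
def grad (X : PolyComplex V E C S) (g : V → A) (e : E) : A := g (X.head e) - g (X.tail e)

/-- The boundary of a 1-chain. -/
def bdOne (X : PolyComplex V E C S) (z : E → A) (v : V) : A :=
  ∑ e, z e * ((if X.head e = v then 1 else 0) - (if X.tail e = v then 1 else 0))

theorem sum_bd_mul (X : PolyComplex V E C S) (N : C → A) (w : E → A) :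
    ∑ e, X.bd N e * w e = ∑ c, N c * X.cobd w c := by
  have h1 : ∑ e, X.bd N e * w e = ∑ s, (X.sgn s : A) * N (X.cell s) * w (X.edge s) := by
    rw [← Finset.sum_fiberwise (s := Finset.univ) (g := X.edge)]
    refine Finset.sum_congr rfl fun e _ => ?_
    rw [bd, Finset.sum_mul]
    refine Finset.sum_congr rfl fun s hs => ?_
    rw [(Finset.mem_filter.1 hs).2]
  have h2 : ∑ c, N c * X.cobd w c = ∑ s, (X.sgn s : A) * N (X.cell s) * w (X.edge s) := by
    rw [← Finset.sum_fiberwise (s := Finset.univ) (g := X.cell)]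
    refine Finset.sum_congr rfl fun c _ => ?_
    rw [cobd, Finset.mul_sum]
    refine Finset.sum_congr rfl fun s hs => ?_
    rw [(Finset.mem_filter.1 hs).2]
    ring
  rw [h1, h2]

theorem sum_grad_mul (X : PolyComplex V E C S) (g : V → A) (z : E → A) :
    ∑ e, X.grad g e * z e = ∑ v, g v * X.bdOne z v := by
  simp only [bdOne, Finset.mul_sum]
  rw [Finset.sum_comm]
  refine Finset.sum_congr rfl fun e _ => ?_
  have : ∀ v, g v * (z e * ((if X.head e = v then 1 else 0) - (if X.tail e = v then 1 else 0)))
      = (if X.head e = v then g v * z e else 0) - (if X.tail e = v then g v * z e else 0) := by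
    intro v; split_ifs <;> ring
  simp only [this, Finset.sum_sub_distrib, Finset.sum_ite_eq, Finset.mem_univ, if_true, grad]
  ring

theorem sgn_mul_grad (X : PolyComplex V E C S) {s : S} (hs : X.sgn s = 1 ∨ X.sgn s = -1)
    (g : V → A) : (X.sgn s : A) * X.grad g (X.edge s) = g (X.tgt s) - g (X.src s) := by
  rcases hs with h | h <;> simp [src, tgt, grad, h]

namespace IsProjective

variable {X : PolyComplex V E C S} (hX : X.IsProjective)

include hX

theorem cobd_grad (g : V → A) (c : C) : X.cobd (X.grad g) c = 0 := by
  rw [cobd, Finset.sum_congr rfl fun s _ => X.sgn_mul_grad (hX.sgn_eq s) g,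
    Finset.sum_sub_distrib, sub_eq_zero]
  refine Finset.sum_bij' (fun s _ => X.next s) (fun s _ => X.next.symm s) ?_ ?_ ?_ ?_ ?_
  · intro s hs
    simpa [hX.cell_next] using hs
  · intro s hs
    have := hX.cell_next (X.next.symm s)
    rw [Equiv.apply_symm_apply] at this
    simpa [← this] using hs
  · intro s _; simp
  · intro s _; simp
  · intro s _
    rw [hX.src_next]

/-! ### Sides, dual connectedness and non-orientability -/

theorem exists_twin (s : S) :
    ∃ t, t ≠ s ∧ X.edge t = X.edge s ∧ ∀ u, X.edge u = X.edge s → u = s ∨ u = t := by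
  classical
  obtain ⟨a, b, hab, h⟩ := Finset.card_eq_two.1 (hX.two_sides (X.edge s))
  have hmem : ∀ u, X.edge u = X.edge s ↔ u = a ∨ u = b := by
    intro u
    have := Finset.ext_iff.1 h u
    simpa using this
  rcases (hmem s).1 rfl with rfl | rfl
  · exact ⟨b, hab.symm, (hmem b).2 (Or.inr rfl), fun u hu => (hmem u).1 hu⟩
  · exact ⟨a, hab, (hmem a).2 (Or.inl rfl), fun u hu => ((hmem u).1 hu).symm⟩

theorem exists_side (e : E) : ∃ s, X.edge s = e := by
  have h : 0 < (Finset.univ.filter fun s => X.edge s = e).card := by rw [hX.two_sides]; norm_num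
  obtain ⟨s, hs⟩ := Finset.card_pos.1 h
  exact ⟨s, (Finset.mem_filter.1 hs).2⟩

theorem bd_eq {s t : S} (hne : t ≠ s) (ht : X.edge t = X.edge s)
    (h : ∀ u, X.edge u = X.edge s → u = s ∨ u = t) (N : C → A) :
    X.bd N (X.edge s) = X.sgn s * N (X.cell s) + X.sgn t * N (X.cell t) := by
  classical
  have : (Finset.univ.filter fun u => X.edge u = X.edge s) = {s, t} := by
    ext u
    simp only [Finset.mem_filter, Finset.mem_univ, true_and, Finset.mem_insert,
      Finset.mem_singleton]
    exact ⟨h u, by rintro (rfl | rfl) <;> simp [ht]⟩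
  rw [bd, this, Finset.sum_pair hne.symm]

theorem card_sides : Fintype.card S = 2 * Fintype.card E := by
  classical
  rw [← Finset.card_univ, Finset.card_eq_sum_card_fiberwise (f := X.edge) (t := Finset.univ)
    (fun _ _ => Finset.mem_coe.2 (Finset.mem_univ _))]
  rw [Finset.sum_congr rfl fun e _ => hX.two_sides e]
  simp [mul_comm]

theorem exists_edge (v : V) : ∃ e, X.tail e = v ∨ X.head e = v := by
  by_contra! hcon
  have hall : ∀ u, v = u := by
    refine fun u => hX.conn (fun u => v = u) (fun e => ?_) v u rfl
    exact ⟨fun h => absurd h.symm (hcon e).1, fun h => absurd h.symm (hcon e).2⟩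
  obtain ⟨c⟩ := hX.nonempty
  obtain ⟨s, -⟩ := hX.cell_surj c
  exact hX.ne (X.edge s) ((hall _).symm.trans (hall _))

/-- A property of cells that passes between cells with a common edge holds for all cells or
for none. -/
theorem dual_conn (Q : C → Prop)
    (hQ : ∀ s t, X.edge s = X.edge t → (Q (X.cell s) ↔ Q (X.cell t))) : ∀ c c', Q c → Q c' := by
  let R : E → Prop := fun e => ∀ s, X.edge s = e → Q (X.cell s)
  have hR : ∀ s, R (X.edge s) ↔ Q (X.cell s) :=
    fun s => ⟨fun h => h s rfl, fun h t ht => (hQ s t ht.symm).1 h⟩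
  have hlink : ∀ v e e', (X.tail e = v ∨ X.head e = v) → (X.tail e' = v ∨ X.head e' = v) →
      R e → R e' := by
    intro v
    refine hX.link v R fun s _ => ?_
    rw [hR, hR, hX.cell_next]
  have hconn : ∀ u v, (∀ e, (X.tail e = u ∨ X.head e = u) → R e) →
      ∀ e, (X.tail e = v ∨ X.head e = v) → R e := by
    refine hX.conn (fun u => ∀ e, (X.tail e = u ∨ X.head e = u) → R e) fun e => ?_
    exact ⟨fun h e' he' => hlink _ e e' (Or.inr rfl) he' (h e (Or.inl rfl)),
      fun h e' he' => hlink _ e e' (Or.inl rfl) he' (h e (Or.inr rfl))⟩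
  intro c c' hc
  obtain ⟨s, rfl⟩ := hX.cell_surj c
  obtain ⟨s', rfl⟩ := hX.cell_surj c'
  rw [← hR] at hc ⊢
  exact hconn (X.tail (X.edge s)) (X.tail (X.edge s'))
    (fun e he => hlink _ _ e (Or.inl rfl) he hc) _ (Or.inl rfl)

/-- The surface is not orientable. Otherwise turning along the oriented cells, exchanging the two
sides of an edge, and the product of these two permutations of the sides have as orbits the
cells, the edges and the vertices, so that comparing signs makes the Euler characteristic even. -/
theorem not_orientable (f : C → ℤ) (hf : ∀ c, f c = 1 ∨ f c = -1) (hbd : ∀ e, X.bd f e = 0) :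
    False := by
  classical
  choose τ hτne hτedge hτ using hX.exists_twin
  have hττ : ∀ s, τ (τ s) = s := by
    intro s
    rcases hτ s (τ (τ s)) (by rw [hτedge, hτedge]) with h | h
    · exact h
    · exact absurd h (hτne (τ s))
  let o : S → ℤ := fun s => X.sgn s * f (X.cell s)
  have ho : ∀ s, o s = 1 ∨ o s = -1 := by
    intro s
    rcases hX.sgn_eq s with h | h <;> rcases hf (X.cell s) with h' | h' <;> simp [o, h, h']
  have hoτ : ∀ s, o (τ s) = - o s := by
    intro s
    have h := hbd (X.edge s)
    rw [hX.bd_eq (hτne s) (hτedge s) (hτ s)] at h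
    simp only [Int.cast_id] at h
    simp only [o]
    linarith
  let a : S → V := fun s => if o s = 1 then X.tail (X.edge s) else X.head (X.edge s)
  have ha1 : ∀ s, f (X.cell s) = 1 → a s = X.src s ∧ a (τ s) = X.tgt s := by
    intro s hs
    have h1 : o s = X.sgn s := by simp [o, hs]
    have h2 := hoτ s
    rcases hX.sgn_eq s with h | h <;> simp [a, src, tgt, h1, h2, hτedge, h]
  have ha2 : ∀ s, f (X.cell s) = -1 → a s = X.tgt s ∧ a (τ s) = X.src s := by
    intro s hs
    have h1 : o s = - X.sgn s := by simp [o, hs]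
    have h2 := hoτ s
    rcases hX.sgn_eq s with h | h <;> simp [a, src, tgt, h1, h2, hτedge, h]
  have hcs : ∀ s, X.cell (X.next.symm s) = X.cell s := by
    intro s
    rw [← hX.cell_next, Equiv.apply_symm_apply]
  let φ : Equiv.Perm S :=
    { toFun := fun s => if f (X.cell s) = 1 then X.next s else X.next.symm s
      invFun := fun s => if f (X.cell s) = 1 then X.next.symm s else X.next s
      left_inv := by
        intro s
        by_cases h : f (X.cell s) = 1 <;> simp [h, hX.cell_next, hcs]
      right_inv := by
        intro s
        by_cases h : f (X.cell s) = 1 <;> simp [h, hX.cell_next, hcs] }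
  have hφ1 : ∀ s, f (X.cell s) = 1 → φ s = X.next s := fun s h => if_pos h
  have hφ2 : ∀ s, f (X.cell s) = -1 → φ s = X.next.symm s := fun s h => if_neg (by rw [h]; decide)
  let t : Equiv.Perm S := ⟨τ, τ, hττ, hττ⟩
  have haφ : ∀ s, a (φ s) = a (τ s) := by
    intro s
    rcases hf (X.cell s) with h | h
    · rw [hφ1 s h, (ha1 s h).2, (ha1 _ (by rw [hX.cell_next, h])).1, hX.src_next]
    · rw [hφ2 s h, (ha2 s h).2, (ha2 _ (by rw [hcs, h])).1, ← hX.src_next,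
        Equiv.apply_symm_apply]
  have s1 := sign_eq_neg_one_pow_card_add_card_orbits φ X.cell hX.cell_surj
    (by
      intro s
      rcases hf (X.cell s) with h | h
      · rw [hφ1 s h, hX.cell_next]
      · rw [hφ2 s h, hcs])
    (by
      intro Q hQ
      refine hX.cell_trans Q fun s => ?_
      rcases hf (X.cell s) with h | h
      · rw [hQ s, hφ1 s h]
      · rw [hQ (X.next s), hφ2 _ (by rw [hX.cell_next, h]), Equiv.symm_apply_apply])
  have s2 := sign_eq_neg_one_pow_card_add_card_orbits t X.edge hX.exists_side hτedge
    (by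
      intro Q hQ s s' hss hs
      rcases hτ s s' hss.symm with rfl | rfl
      · exact hs
      · exact (hQ s).1 hs)
  -- every end of an edge is the starting point of exactly one of its two oriented sides
  have hside : ∀ e v, (X.tail e = v ∨ X.head e = v) → ∃ s, X.edge s = e ∧ a s = v := by
    intro e v hv
    obtain ⟨s, rfl⟩ := hX.exists_side e
    have h2 := hoτ s
    rcases ho s with h | h <;> rcases hv with hv | hv
    · exact ⟨s, rfl, by simp [a, h, hv]⟩
    · exact ⟨τ s, hτedge s, by simp [a, h2, h, hτedge, hv]⟩
    · exact ⟨τ s, hτedge s, by simp [a, h2, h, hτedge, hv]⟩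
    · exact ⟨s, rfl, by simp [a, h, hv]⟩
  have huniq : ∀ s s', X.edge s = X.edge s' → a s = a s' → s = s' := by
    intro s s' he hs
    rcases hτ s s' he.symm with h | rfl
    · exact h.symm
    · exfalso
      have h2 := hoτ s
      have hne := hX.ne (X.edge s)
      rcases ho s with h | h <;> simp [a, h2, h, hτedge] at hs
      · exact hne hs
      · exact hne hs.symm
  have haend : ∀ s, X.tail (X.edge s) = a s ∨ X.head (X.edge s) = a s := by
    intro s
    rcases ho s with h | h <;> simp [a, h]
  have s3 := sign_eq_neg_one_pow_card_add_card_orbits (φ * t) a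
    (by
      intro v
      obtain ⟨e, he⟩ := hX.exists_edge v
      obtain ⟨s, -, hs⟩ := hside e v he
      exact ⟨s, hs⟩)
    (by
      intro s
      change a (φ (τ s)) = a s
      rw [haφ, hττ])
    (by
      intro Q hQ
      have hQ' : ∀ s, Q (τ s) ↔ Q (φ s) := by
        intro s
        have := hQ (τ s)
        change Q (τ s) ↔ Q (φ (τ (τ s))) at this
        rwa [hττ] at this
      intro s s' hss hs
      have key := hX.link (a s) (fun e => ∀ u, X.edge u = e → a u = a s → Q u)
        (by
          intro u hu
          have hstep : ∀ p q, a p = a s → a q = a s → (Q p ↔ Q q) →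
              ((∀ x, X.edge x = X.edge p → a x = a s → Q x) ↔
                (∀ x, X.edge x = X.edge q → a x = a s → Q x)) := by
            intro p q hp hq hpq
            constructor
            · intro h x hx hxa
              rw [huniq x q hx (hxa.trans hq.symm)]
              exact hpq.1 (h p rfl hp)
            · intro h x hx hxa
              rw [huniq x p hx (hxa.trans hp.symm)]
              exact hpq.2 (h q rfl hq)
          rcases hf (X.cell u) with h | h
          · have h3 := hstep (τ u) (X.next u) (by rw [(ha1 u h).2, hu])
              (by rw [(ha1 _ (by rw [hX.cell_next, h])).1, hX.src_next, hu])
              (by rw [hQ' u, hφ1 u h])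
            rwa [hτedge] at h3
          · have hn : f (X.cell (X.next u)) = -1 := by rw [hX.cell_next, h]
            have h3 := hstep u (τ (X.next u)) (by rw [(ha2 u h).1, hu])
              (by rw [(ha2 _ hn).2, hX.src_next, hu])
              (by rw [hQ', hφ2 _ hn, Equiv.symm_apply_apply])
            rwa [hτedge] at h3)
        (X.edge s) (X.edge s') (haend s) (by rw [hss]; exact haend s')
        (by
          intro u hu hua
          rw [huniq u s hu hua]
          exact hs)
      exact key s' rfl hss.symm)
  have hmul : (Equiv.Perm.sign (φ * t) : ℤ) = Equiv.Perm.sign φ * Equiv.Perm.sign t := by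
    rw [Equiv.Perm.sign_mul]; push_cast; rfl
  rw [s1, s2, s3, ← pow_add] at hmul
  have hS := hX.card_sides
  have heul := hX.euler
  have hpar : ∀ m n : ℕ, (-1 : ℤ) ^ m = (-1) ^ n → Even (m + n) := by
    intro m n h
    have : (-1 : ℤ) ^ (m + n) = 1 := by
      rw [pow_add, h, ← pow_add, ← two_mul, pow_mul]; simp
    exact (neg_one_pow_eq_one_iff_even (by decide)).1 this
  obtain ⟨k, hk⟩ := hpar _ _ hmul
  omega

end IsProjective

/-! ### The first and second cohomology -/

theorem cobd_add (X : PolyComplex V E C S) (w w' : E → A) :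
    X.cobd (w + w') = X.cobd w + X.cobd w' := by
  ext c
  simp [cobd, mul_add, Finset.sum_add_distrib]

theorem cobd_smul (X : PolyComplex V E C S) (a : A) (w : E → A) :
    X.cobd (a • w) = a • X.cobd w := by
  ext c
  simp only [cobd, Pi.smul_apply, smul_eq_mul, Finset.mul_sum]
  exact Finset.sum_congr rfl fun s _ => by ring

theorem bd_add (X : PolyComplex V E C S) (N N' : C → A) :
    X.bd (N + N') = X.bd N + X.bd N' := by
  ext c
  simp [bd, mul_add, Finset.sum_add_distrib]

theorem bd_smul (X : PolyComplex V E C S) (a : A) (N : C → A) :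
    X.bd (a • N) = a • X.bd N := by
  ext c
  simp only [bd, Pi.smul_apply, smul_eq_mul, Finset.mul_sum]
  exact Finset.sum_congr rfl fun s _ => by ring

theorem cobd_intCast (X : PolyComplex V E C S) (w : E → ℤ) (c : C) :
    X.cobd (fun e => (w e : A)) c = ((X.cobd w c : ℤ) : A) := by
  simp [cobd]

theorem bd_intCast (X : PolyComplex V E C S) (N : C → ℤ) (e : E) :
    X.bd (fun c => (N c : A)) e = ((X.bd N e : ℤ) : A) := by
  simp [bd]

/-- The coboundary of 1-cochains as a linear map. -/
def cobdHom (X : PolyComplex V E C S) : (E → A) →ₗ[A] (C → A) where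
  toFun := X.cobd
  map_add' := X.cobd_add
  map_smul' := X.cobd_smul

/-- The boundary of 2-chains as a linear map. -/
def bdHom (X : PolyComplex V E C S) : (C → A) →ₗ[A] (E → A) where
  toFun := X.bd
  map_add' := X.bd_add
  map_smul' := X.bd_smul

/-- The coboundary of 0-cochains as a linear map. -/
def gradHom (X : PolyComplex V E C S) : (V → A) →ₗ[A] (E → A) where
  toFun := X.grad
  map_add' g g' := by ext e; simp [grad]; ring
  map_smul' a g := by ext e; simp [grad]; ring

namespace IsProjective
variable {X : PolyComplex V E C S} (hX : X.IsProjective)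
include hX

theorem cobd_single {s t : S} (hne : t ≠ s) (ht : X.edge t = X.edge s)
    (h : ∀ u, X.edge u = X.edge s → u = s ∨ u = t) :
    X.cobd (Pi.single (X.edge s) (1 : A)) =
      (X.sgn s : A) • Pi.single (X.cell s) (1 : A) + (X.sgn t : A) • Pi.single (X.cell t) 1 := by
  ext c
  have h1 := X.sum_bd_mul (Pi.single c (1 : A)) (Pi.single (X.edge s) (1 : A))
  simp only [Pi.single_apply, mul_ite, mul_one, mul_zero, ite_mul, one_mul, zero_mul,
    Finset.sum_ite_eq', Finset.mem_univ, if_true] at h1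
  have h2 := hX.bd_eq hne ht h (fun x => if x = c then (1 : A) else 0)
  have e1 : (fun e => if e = X.edge s then (1 : A) else 0) = Pi.single (X.edge s) 1 := by
    ext e; simp [Pi.single_apply]
  have e2 : (Pi.single c (1 : A) : C → A) = fun x => if x = c then (1 : A) else 0 := by
    ext e; simp [Pi.single_apply]
  rw [e2, h2] at h1
  rw [← h1]
  simp [Pi.single_apply, eq_comm]

/-- In the second integral cohomology group the classes of all cells agree up to sign; as the
surface is not orientable, this class is killed by `2`. -/
theorem exists_cobd_eq_two (c₀ : C) :
    ∃ w : E → ℤ, ∀ c, X.cobd w c = if c = c₀ then 2 else 0 := by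
  classical
  let I : Submodule ℤ (C → ℤ) := LinearMap.range X.cobdHom
  let x : C → (C → ℤ) := fun c => Pi.single c 1
  have hI : ∀ w, X.cobd w ∈ I := fun w => ⟨w, rfl⟩
  suffices h : (2 : ℤ) • x c₀ ∈ I by
    obtain ⟨w, hw⟩ := h
    refine ⟨w, fun c => ?_⟩
    have := congrFun hw c
    change X.cobd w c = _ at this
    rw [this]
    simp [x, Pi.single_apply]
  by_contra h2
  have hall : ∀ c, (x c - (1 : ℤ) • x c₀ ∈ I) ∨ (x c - (-1 : ℤ) • x c₀ ∈ I) := by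
    intro c
    refine hX.dual_conn (fun c => (x c - (1 : ℤ) • x c₀ ∈ I) ∨ (x c - (-1 : ℤ) • x c₀ ∈ I))
      ?_ c₀ c (Or.inl (by simp))
    have key : ∀ s t, X.edge s = X.edge t →
        ((x (X.cell s) - (1 : ℤ) • x c₀ ∈ I) ∨ (x (X.cell s) - (-1 : ℤ) • x c₀ ∈ I)) →
        ((x (X.cell t) - (1 : ℤ) • x c₀ ∈ I) ∨ (x (X.cell t) - (-1 : ℤ) • x c₀ ∈ I)) := by
      intro s t hst h
      obtain ⟨u, hu1, hu2, hu3⟩ := hX.exists_twin s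
      rcases hu3 t hst.symm with rfl | rfl
      · exact h
      · have hm := hI (Pi.single (X.edge s) 1)
        rw [hX.cobd_single hu1 hu2 hu3] at hm
        simp only [Int.cast_id] at hm
        change X.sgn s • x (X.cell s) + X.sgn t • x (X.cell t) ∈ I at hm
        rcases hX.sgn_eq s with h1 | h1 <;> rcases hX.sgn_eq t with h1' | h1' <;>
          rw [h1, h1'] at hm <;> rcases h with h | h
        · right; convert I.sub_mem hm h using 1; module
        · left; convert I.sub_mem hm h using 1; module
        · left; convert I.sub_mem h hm using 1; module
        · right; convert I.sub_mem h hm using 1; module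
        · left; convert I.add_mem hm h using 1; module
        · right; convert I.add_mem hm h using 1; module
        · right; convert I.neg_mem (I.add_mem hm h) using 1; module
        · left; convert I.neg_mem (I.add_mem hm h) using 1; module
    exact fun s t hst => ⟨key s t hst, key t s hst.symm⟩
  let f : C → ℤ := fun c => if x c - (1 : ℤ) • x c₀ ∈ I then 1 else -1
  have hf : ∀ c, f c = 1 ∨ f c = -1 := by
    intro c; by_cases h : x c - (1 : ℤ) • x c₀ ∈ I <;> simp only [f, h, if_true, if_false] <;> simp
  have hfI : ∀ c, x c - f c • x c₀ ∈ I := by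
    intro c
    by_cases h : x c - (1 : ℤ) • x c₀ ∈ I
    · simp only [f, h, if_true]
    · simp only [f, h, if_false]
      exact (hall c).resolve_left h
  refine hX.not_orientable f hf fun e => ?_
  obtain ⟨s, rfl⟩ := hX.exists_side e
  obtain ⟨u, hu1, hu2, hu3⟩ := hX.exists_twin s
  rw [hX.bd_eq hu1 hu2 hu3]
  have hm := hI (Pi.single (X.edge s) 1)
  rw [hX.cobd_single hu1 hu2 hu3] at hm
  simp only [Int.cast_id] at hm ⊢
  have h3 := I.sub_mem hm (I.add_mem (I.smul_mem (X.sgn s) (hfI (X.cell s)))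
    (I.smul_mem (X.sgn u) (hfI (X.cell u))))
  have h4 : (X.sgn s * f (X.cell s) + X.sgn u * f (X.cell u)) • x c₀ ∈ I := by
    convert h3 using 1
    simp only [x]
    module
  rcases hX.sgn_eq s with h | h <;> rcases hX.sgn_eq u with h' | h' <;>
    rcases hf (X.cell s) with g | g <;> rcases hf (X.cell u) with g' | g' <;>
    rw [h, h', g, g'] at h4 ⊢ <;> norm_num at h4 ⊢
  all_goals exact h2 h4

theorem cobdHom_surjective : Function.Surjective (X.cobdHom : (E → ℚ) →ₗ[ℚ] (C → ℚ)) := by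
  rw [← LinearMap.range_eq_top, eq_top_iff]
  intro y _
  rw [pi_eq_sum_univ y]
  refine Submodule.sum_mem _ fun c _ => Submodule.smul_mem _ _ ?_
  obtain ⟨w, hw⟩ := hX.exists_cobd_eq_two c
  refine ⟨(1 / 2 : ℚ) • fun e => (w e : ℚ), ?_⟩
  rw [map_smul]
  ext c'
  change (1 / 2 : ℚ) • X.cobd (fun e => (w e : ℚ)) c' = _
  rw [cobd_intCast, hw]
  rcases eq_or_ne c' c with rfl | h
  · simp
  · simp [h, h.symm]

theorem gradHom_ker_le :
    LinearMap.ker (X.gradHom : (V → ℚ) →ₗ[ℚ] (E → ℚ)) ≤ Submodule.span ℚ {fun _ => 1} := by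
  intro g hg
  obtain ⟨c⟩ := hX.nonempty
  obtain ⟨s, -⟩ := hX.cell_surj c
  rw [Submodule.mem_span_singleton]
  refine ⟨g (X.src s), ?_⟩
  ext v
  have := hX.conn (fun u => g u = g (X.src s)) (fun e => by
    have h : g (X.head e) - g (X.tail e) = 0 := congrFun hg e
    rw [sub_eq_zero.1 h]) (X.src s) v rfl
  simp [this]

/-- The first rational cohomology vanishes, by a count of dimensions. -/
theorem exists_grad_eq (w : E → ℚ) (hw : ∀ c, X.cobd w c = 0) : ∃ g : V → ℚ, X.grad g = w := by
  have hle : LinearMap.range (X.gradHom : (V → ℚ) →ₗ[ℚ] (E → ℚ)) ≤ LinearMap.ker X.cobdHom := by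
    rintro _ ⟨g, rfl⟩
    ext c
    exact hX.cobd_grad g c
  have h1 := LinearMap.finrank_range_add_finrank_ker (X.gradHom : (V → ℚ) →ₗ[ℚ] (E → ℚ))
  have h2 := LinearMap.finrank_range_add_finrank_ker (X.cobdHom : (E → ℚ) →ₗ[ℚ] (C → ℚ))
  rw [LinearMap.range_eq_top.2 hX.cobdHom_surjective, finrank_top] at h2
  have h3 := (Submodule.finrank_mono hX.gradHom_ker_le).trans (finrank_span_le_card _)
  rw [Set.toFinset_singleton, Finset.card_singleton] at h3
  simp only [Module.finrank_fintype_fun_eq_card] at h1 h2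
  have heul := hX.euler
  have heq := Submodule.eq_of_le_of_finrank_le hle (by omega)
  have : w ∈ LinearMap.ker (X.cobdHom : (E → ℚ) →ₗ[ℚ] (C → ℚ)) := by
    ext c; exact hw c
  rw [← heq] at this
  obtain ⟨g, hg⟩ := this
  exact ⟨g, hg⟩

/-- The first rational homology vanishes, by duality. -/
theorem exists_bd_eq (z : E → ℚ) (hz : ∀ v, X.bdOne z v = 0) : ∃ N : C → ℚ, X.bd N = z := by
  by_contra hcon
  have hz' : z ∉ LinearMap.range (X.bdHom : (C → ℚ) →ₗ[ℚ] (E → ℚ)) := by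
    rintro ⟨N, hN⟩
    exact hcon ⟨N, hN⟩
  obtain ⟨φ, hφz, hφ⟩ := Submodule.exists_le_ker_of_notMem hz'
  let w : E → ℚ := fun e => φ (fun j => if e = j then 1 else 0)
  have hφw : ∀ y, φ y = ∑ e, y e * w e := fun y => LinearMap.pi_apply_eq_sum_univ φ y
  have hw : ∀ c, X.cobd w c = 0 := by
    intro c
    have h1 : φ (X.bd (fun c' => if c' = c then 1 else 0)) = 0 :=
      hφ ⟨fun c' => if c' = c then 1 else 0, rfl⟩
    rw [hφw, sum_bd_mul] at h1
    simpa using h1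
  obtain ⟨g, hg⟩ := hX.exists_grad_eq w hw
  apply hφz
  rw [hφw, ← hg]
  have := X.sum_grad_mul g z
  simp only [hz, mul_zero, Finset.sum_const_zero] at this
  rw [← this]
  exact Finset.sum_congr rfl fun e _ => mul_comm _ _

end IsProjective

/-! ### The length of boundaries in a sparse complex -/

/-- Apart from the cell `c₀`, the hole, which has six sides, all cells are triangles, and there are
no multiple edges. -/
structure IsHoled (X : PolyComplex V E C S) (c₀ : C) : Prop where
  card_face : ∀ c, c ≠ c₀ → (Finset.univ.filter fun s => X.cell s = c).card = 3
  card_hole : (Finset.univ.filter fun s => X.cell s = c₀).card = 6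
  corner : ∀ s, X.cell s ≠ c₀ → X.edge (X.next s) ≠ X.edge s
  simple : ∀ e e', (X.tail e = X.tail e' ∧ X.head e = X.head e') ∨
    (X.tail e = X.head e' ∧ X.head e = X.tail e') → e = e'

/-- The bound `f ≥ 6`, for a set of vertices and a set of edges between them. -/
def IsSparse (X : PolyComplex V E C S) : Prop :=
  ∀ (A : Finset V) (B : Finset E), (∀ e ∈ B, X.tail e ∈ A ∧ X.head e ∈ A) →
    3 ≤ A.card → B.card + 6 ≤ 3 * A.card

/-- Extension of a function by zero, as a linear map. -/
def extendZero {ι : Type*} [DecidableEq ι] (B : Finset ι) : (B → ℚ) →ₗ[ℚ] (ι → ℚ) where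
  toFun x e := if h : e ∈ B then x ⟨e, h⟩ else 0
  map_add' x y := by ext e; by_cases h : e ∈ B <;> simp [h]
  map_smul' a x := by ext e; by_cases h : e ∈ B <;> simp [h]

theorem extendZero_injective {ι : Type*} [DecidableEq ι] (B : Finset ι) :
    Function.Injective (extendZero B) := by
  intro x y h
  ext ⟨e, he⟩
  have := congrFun h e
  simpa [extendZero, he] using this

theorem extendZero_of_notMem {ι : Type*} [DecidableEq ι] (B : Finset ι) (x : B → ℚ) {e : ι}
    (he : e ∉ B) : extendZero B x e = 0 := by
  simp [extendZero, he]

theorem extendZero_of_mem {ι : Type*} [DecidableEq ι] (B : Finset ι) (x : B → ℚ) {e : ι}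
    (he : e ∈ B) : extendZero B x e = x ⟨e, he⟩ := by
  simp [extendZero, he]

/-- The graph whose edges are those outside of the set `B`. -/
def graphOff (X : PolyComplex V E C S) (B : Finset E) : SimpleGraph V :=
  SimpleGraph.fromRel fun u v => ∃ e, e ∉ B ∧ X.tail e = u ∧ X.head e = v

/-- The functions orthogonal to a chain `f`, supported on its support, form a space of dimension
one less than the size of the support. -/
theorem finrank_orthogonal_le {ι : Type*} [Fintype ι] [DecidableEq ι] (f : ι → ℚ) (i₀ : ι)
    (h₀ : f i₀ ≠ 0) (U : Submodule ℚ (ι → ℚ)) (hU : ∀ x ∈ U, ∀ i, f i = 0 → x i = 0)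
    (hU' : ∀ x ∈ U, ∑ i, f i * x i = 0) :
    Module.finrank ℚ U + 1 ≤ (Finset.univ.filter fun i => f i ≠ 0).card := by
  let P : Finset ι := (Finset.univ.filter fun i => f i ≠ 0).erase i₀
  have hP : P.card + 1 = (Finset.univ.filter fun i => f i ≠ 0).card :=
    Finset.card_erase_add_one (by simp [h₀])
  rw [← hP]
  refine Nat.add_le_add_right ?_ 1
  let r : U →ₗ[ℚ] (P → ℚ) := (LinearMap.funLeft ℚ ℚ (Subtype.val : P → ι)).comp U.subtype
  have hr : Function.Injective r := by
    rw [← LinearMap.ker_eq_bot, LinearMap.ker_eq_bot']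
    intro ⟨x, hx⟩ h
    have hz : ∀ i, i ≠ i₀ → x i = 0 := by
      intro i hi
      by_cases hfi : f i = 0
      · exact hU x hx i hfi
      · exact congrFun h ⟨i, by simp [P, hi, hfi]⟩
    have hs := hU' x hx
    rw [Finset.sum_eq_single i₀ (fun i _ hi => by rw [hz i hi, mul_zero]) (by simp)] at hs
    have h0 := (mul_eq_zero.1 hs).resolve_left h₀
    ext i
    rcases eq_or_ne i i₀ with rfl | hi
    · exact h0
    · exact hz i hi
  have := LinearMap.finrank_le_finrank_of_injective hr
  simpa using this

namespace IsProjective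
variable {X : PolyComplex V E C S} (hX : X.IsProjective)
include hX

/-- Let `f` be an integral chain, and `B` a set of edges between cells of its support that carry no
boundary. The cochains on `B` have coboundaries orthogonal to `f`, and those with vanishing
coboundary are gradients of functions constant on the components of the graph without `B`; this
bounds the number of edges in `B`. -/
theorem card_edges_off_le (f : C → ℤ) (c₀ : C) (h₀ : f c₀ ≠ 0) (B : Finset E)
    (hB : ∀ e ∈ B, X.bd f e = 0) (hB' : ∀ s, X.edge s ∈ B → f (X.cell s) ≠ 0) :
    B.card + 2 ≤ (Finset.univ.filter fun c => f c ≠ 0).card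
      + Nat.card (X.graphOff B).ConnectedComponent := by
  classical
  let K := X.graphOff B
  let ψ : (B → ℚ) →ₗ[ℚ] (C → ℚ) := X.cobdHom.comp (extendZero B)
  have h1 := LinearMap.finrank_range_add_finrank_ker ψ
  -- the coboundaries of cochains on `B` are orthogonal to `f`
  have h2 := finrank_orthogonal_le (fun c => (f c : ℚ)) c₀ (by exact_mod_cast h₀)
    (LinearMap.range ψ)
    (by
      rintro _ ⟨x, rfl⟩ c hc
      change X.cobd (extendZero B x) c = 0
      rw [cobd]
      refine Finset.sum_eq_zero fun s hs => ?_
      rw [extendZero_of_notMem, mul_zero]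
      intro hmem
      apply hB' s hmem
      rw [(Finset.mem_filter.1 hs).2]
      exact_mod_cast hc)
    (by
      rintro _ ⟨x, rfl⟩
      change ∑ c, (f c : ℚ) * X.cobd (extendZero B x) c = 0
      rw [← sum_bd_mul]
      refine Finset.sum_eq_zero fun e _ => ?_
      rw [bd_intCast]
      by_cases he : e ∈ B
      · rw [hB e he]; simp
      · rw [extendZero_of_notMem B x he, mul_zero])
  let pull : (K.ConnectedComponent → ℚ) →ₗ[ℚ] (E → ℚ) :=
    X.gradHom.comp (LinearMap.funLeft ℚ ℚ K.connectedComponentMk)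
  have h3 := LinearMap.finrank_range_add_finrank_ker pull
  have hker : 1 ≤ Module.finrank ℚ (LinearMap.ker pull) := by
    obtain ⟨c⟩ := hX.nonempty
    obtain ⟨s, -⟩ := hX.cell_surj c
    rw [Nat.one_le_iff_ne_zero, Ne, Submodule.finrank_eq_zero]
    intro hbot
    have hone : (fun _ => 1 : K.ConnectedComponent → ℚ) ∈ LinearMap.ker pull := by
      ext e
      change (1 : ℚ) - 1 = 0
      simp
    rw [hbot, Submodule.mem_bot] at hone
    exact one_ne_zero (congrFun hone (K.connectedComponentMk (X.src s)))
  -- closed cochains on `B` are gradients of functions that are constant off `B`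
  have h4 : Module.finrank ℚ (LinearMap.ker ψ) ≤ Module.finrank ℚ (LinearMap.range pull) := by
    have hmap : Submodule.map (extendZero B) (LinearMap.ker ψ) ≤ LinearMap.range pull := by
      rintro _ ⟨x, hx, rfl⟩
      obtain ⟨g, hg⟩ := hX.exists_grad_eq (extendZero B x) (fun c => congrFun hx c)
      have hadj : ∀ u v, K.Adj u v → g u = g v := by
        intro u v huv
        rcases ((SimpleGraph.fromRel_adj _ _ _).1 huv).2 with ⟨e, he, rfl, rfl⟩ | ⟨e, he, rfl, rfl⟩
        · have := congrFun hg e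
          rw [extendZero_of_notMem B x he] at this
          exact (sub_eq_zero.1 this).symm
        · have := congrFun hg e
          rw [extendZero_of_notMem B x he] at this
          exact sub_eq_zero.1 this
      have hreach : ∀ u v, K.Reachable u v → g u = g v := by
        rintro u v ⟨p⟩
        induction p with
        | nil => rfl
        | cons h _ ih => exact (hadj _ _ h).trans ih
      refine ⟨fun k => g k.out, ?_⟩
      rw [← hg]
      ext e
      have hout : ∀ v, g (K.connectedComponentMk v).out = g v := by
        intro v
        exact hreach _ _ (SimpleGraph.ConnectedComponent.exact (Quot.out_eq _))
      change g (K.connectedComponentMk (X.head e)).out - g (K.connectedComponentMk (X.tail e)).out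
        = _
      rw [hout, hout]
      rfl
    have := Submodule.finrank_mono hmap
    rwa [← (Submodule.equivMapOfInjective _ (extendZero_injective B) _).finrank_eq] at this
  simp only [Module.finrank_fintype_fun_eq_card, Fintype.card_coe] at h1 h3
  have h5 : (Finset.univ.filter fun c => (f c : ℚ) ≠ 0) = Finset.univ.filter fun c => f c ≠ 0 := by
    ext c; simp
  rw [h5] at h2
  rw [Nat.card_eq_fintype_card]
  change _ ≤ _ + Fintype.card K.ConnectedComponent
  omega

theorem bdOne_bd (N : C → A) (v : V) : X.bdOne (X.bd N) v = 0 := by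
  have h := X.sum_grad_mul (fun u => if u = v then (1 : A) else 0) (X.bd N)
  simp only [ite_mul, one_mul, zero_mul, Finset.sum_ite_eq', Finset.mem_univ, if_true] at h
  rw [← h]
  rw [Finset.sum_congr rfl fun e _ => mul_comm _ _, sum_bd_mul]
  exact Finset.sum_eq_zero fun c _ => by rw [hX.cobd_grad, mul_zero]

theorem end_src (s : S) : X.tail (X.edge s) = X.src s ∨ X.head (X.edge s) = X.src s := by
  rcases hX.sgn_eq s with h | h <;> simp [src, h]

theorem end_tgt (s : S) : X.tail (X.edge s) = X.tgt s ∨ X.head (X.edge s) = X.tgt s := by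
  rcases hX.sgn_eq s with h | h <;> simp [tgt, h]

theorem src_or_tgt (s : S) (v : V) (h : X.tail (X.edge s) = v ∨ X.head (X.edge s) = v) :
    X.src s = v ∨ X.tgt s = v := by
  rcases hX.sgn_eq s with h' | h' <;> rcases h with h | h <;> simp [src, tgt, h, h']

/-- At each vertex, the support of a boundary has no end: a second edge of the support leaves. -/
theorem exists_ne_of_bd_ne_zero [IsDomain A] (N : C → A) {e : E} {v : V} (he : X.bd N e ≠ 0)
    (hv : X.tail e = v ∨ X.head e = v) :
    ∃ e', e' ≠ e ∧ X.bd N e' ≠ 0 ∧ (X.tail e' = v ∨ X.head e' = v) := by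
  by_contra! hcon
  have h := hX.bdOne_bd N v
  rw [bdOne, Finset.sum_eq_single e] at h
  · rcases mul_eq_zero.1 h with h | h
    · exact he h
    · have hne := hX.ne e
      rcases hv with hv | hv
      · have : X.head e ≠ v := fun h' => hne (hv.trans h'.symm)
        simp [hv, this] at h
      · have : X.tail e ≠ v := fun h' => hne (h'.trans hv.symm)
        simp [hv, this] at h
  · intro e' _ hne
    by_cases h0 : X.bd N e' = 0
    · rw [h0, zero_mul]
    · have := hcon e' hne h0
      simp [this]
  · simp

theorem graphOff_adj {B : Finset E} {e : E} (he : e ∉ B) :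
    (X.graphOff B).Adj (X.tail e) (X.head e) :=
  (SimpleGraph.fromRel_adj _ _ _).2 ⟨hX.ne e, Or.inl ⟨e, he, rfl, rfl⟩⟩

/-- Each edge at `v` is a side of two corners at `v`. -/
theorem sum_corners_eq_zero (v : V) (q : E → ZMod 2) :
    ∑ s with X.tgt s = v, (q (X.edge s) + q (X.edge (X.next s))) = 0 := by
  have h1 : ∑ s with X.tgt s = v, q (X.edge (X.next s)) = ∑ s with X.src s = v, q (X.edge s) := by
    refine Finset.sum_bij' (fun s _ => X.next s) (fun s _ => X.next.symm s) ?_ ?_ ?_ ?_ ?_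
    · intro s hs
      simpa [hX.src_next] using hs
    · intro s hs
      have := hX.src_next (X.next.symm s)
      rw [Equiv.apply_symm_apply] at this
      simpa [← this] using hs
    · intro s _; simp
    · intro s _; simp
    · intro s _; rfl
  rw [Finset.sum_add_distrib, h1, Finset.sum_filter, Finset.sum_filter, ← Finset.sum_add_distrib,
    ← Finset.sum_fiberwise (s := Finset.univ) (g := X.edge)]
  refine Finset.sum_eq_zero fun e _ => ?_
  have h2 : ∀ s ∈ Finset.univ.filter (fun s => X.edge s = e),
      ((if X.tgt s = v then q (X.edge s) else 0) + (if X.src s = v then q (X.edge s) else 0))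
        = (if X.head e = v then q e else 0) + (if X.tail e = v then q e else 0) := by
    intro s hs
    have hs' := (Finset.mem_filter.1 hs).2
    rcases hX.sgn_eq s with h | h
    · simp [src, tgt, h, hs']
    · simp [src, tgt, h, hs', add_comm]
  rw [Finset.sum_congr rfl h2, Finset.sum_const, hX.two_sides]
  have : ∀ a : ZMod 2, 2 • a = 0 := by decide
  exact this _

variable {c₀ : C} (hH : X.IsHoled c₀)
include hH

/-- A component of a graph without vertices of degree one has at least three vertices. -/
theorem three_le_card_component {B : Finset E}
    (hdeg : ∀ e v, e ∉ B → (X.tail e = v ∨ X.head e = v) →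
      ∃ e', e' ∉ B ∧ e' ≠ e ∧ (X.tail e' = v ∨ X.head e' = v)) {e : E} (he : e ∉ B)
    (K : Finset V) (hK : ∀ u v, (X.graphOff B).Adj u v → u ∈ K → v ∈ K) (hmem : X.tail e ∈ K) :
    3 ≤ K.card := by
  obtain ⟨e', he', hne, hv⟩ := hdeg e (X.tail e) he (Or.inl rfl)
  have h1 := hX.graphOff_adj he
  have h2 := hX.graphOff_adj he'
  have hu : X.head e ∈ K := hK _ _ h1 hmem
  have hthree : ∃ w ∈ K, w ≠ X.tail e ∧ w ≠ X.head e := by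
    rcases hv with hv | hv
    · refine ⟨X.head e', hK _ _ h2 (hv ▸ hmem), ?_, ?_⟩
      · rw [← hv]; exact (hX.ne e').symm
      · exact fun h => hne (hH.simple _ _ (Or.inl ⟨hv, h⟩))
    · refine ⟨X.tail e', hK _ _ h2.symm (hv ▸ hmem), ?_, ?_⟩
      · rw [← hv]; exact hX.ne e'
      · exact fun h => hne (hH.simple _ _ (Or.inr ⟨h, hv⟩))
  obtain ⟨w, hw, hw1, hw2⟩ := hthree
  have hsub : ({X.tail e, X.head e, w} : Finset V) ⊆ K := by
    intro x hx
    simp only [Finset.mem_insert, Finset.mem_singleton] at hx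
    rcases hx with rfl | rfl | rfl <;> assumption
  calc 3 = ({X.tail e, X.head e, w} : Finset V).card := by
        rw [Finset.card_eq_three.2 ⟨_, _, _, hX.ne e, hw1.symm, hw2.symm, rfl⟩]
    _ ≤ K.card := Finset.card_le_card hsub

/-- In a sparse complex, the complement of a set of edges whose complement has no vertices of
degree one, counted by components. The number `q` is that of the isolated vertices, to which the
bound `f ≥ 6` does not apply. -/
theorem card_compl_le (hsp : X.IsSparse) {B : Finset E} (hne : Bᶜ.Nonempty)
    (hdeg : ∀ e v, e ∉ B → (X.tail e = v ∨ X.head e = v) →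
      ∃ e', e' ∉ B ∧ e' ≠ e ∧ (X.tail e' = v ∨ X.head e' = v)) :
    ∃ q, q + 1 ≤ Nat.card (X.graphOff B).ConnectedComponent ∧
      Bᶜ.card + 6 * Nat.card (X.graphOff B).ConnectedComponent ≤ 3 * Fintype.card V + 3 * q := by
  classical
  let Γ := X.graphOff B
  let vs : Γ.ConnectedComponent → Finset V :=
    fun k => Finset.univ.filter fun v => Γ.connectedComponentMk v = k
  let es : Γ.ConnectedComponent → Finset E :=
    fun k => Bᶜ.filter fun e => Γ.connectedComponentMk (X.tail e) = k
  have hadj : ∀ k u v, Γ.Adj u v → u ∈ vs k → v ∈ vs k := by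
    intro k u v huv hu
    simp only [vs, Finset.mem_filter, Finset.mem_univ, true_and] at hu ⊢
    rw [← hu]
    exact (SimpleGraph.ConnectedComponent.sound huv.reachable).symm
  have hlarge : ∀ k e, e ∈ es k → 3 ≤ (vs k).card := by
    intro k e he
    obtain ⟨he1, he2⟩ := Finset.mem_filter.1 he
    exact hX.three_le_card_component hH hdeg (Finset.mem_compl.1 he1) (vs k) (hadj k)
      (by simp [vs, he2])
  have hpos : ∀ k, 1 ≤ (vs k).card := by
    intro k
    refine Finset.card_pos.2 ⟨k.out, ?_⟩
    simp only [vs, Finset.mem_filter, Finset.mem_univ, true_and]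
    exact Quot.out_eq k
  have hcomp : ∀ k, (es k).card + 6 ≤ 3 * (vs k).card + 3 * (if es k = ∅ then 1 else 0) := by
    intro k
    by_cases hk : es k = ∅
    · have := hpos k
      simp only [hk, Finset.card_empty, if_true]; omega
    · obtain ⟨e, he⟩ := Finset.nonempty_iff_ne_empty.2 hk
      have := hsp (vs k) (es k) (fun e' he' => by
        obtain ⟨he1, he2⟩ := Finset.mem_filter.1 he'
        have h1 : X.tail e' ∈ vs k := by simp [vs, he2]
        exact ⟨h1, hadj k _ _ (hX.graphOff_adj (Finset.mem_compl.1 he1)) h1⟩) (hlarge k e he)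
      simp only [hk, if_false]; omega
  have hsumv : ∑ k, (vs k).card = Fintype.card V := by
    rw [← Finset.card_univ (α := V), Finset.card_eq_sum_card_fiberwise
      (f := Γ.connectedComponentMk) (t := Finset.univ)
      (fun _ _ => Finset.mem_coe.2 (Finset.mem_univ _))]
  have hsume : ∑ k, (es k).card = Bᶜ.card := by
    rw [Finset.card_eq_sum_card_fiberwise (s := Bᶜ)
      (f := fun e => Γ.connectedComponentMk (X.tail e)) (t := Finset.univ)
      (fun _ _ => Finset.mem_coe.2 (Finset.mem_univ _))]
  refine ⟨(Finset.univ.filter fun k => es k = ∅).card, ?_, ?_⟩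
  · obtain ⟨e, he⟩ := hne
    rw [Nat.card_eq_fintype_card, ← Finset.card_univ]
    refine Finset.card_lt_card ?_
    rw [Finset.filter_ssubset]
    refine ⟨Γ.connectedComponentMk (X.tail e), Finset.mem_univ _, fun h => ?_⟩
    have : e ∈ es (Γ.connectedComponentMk (X.tail e)) := Finset.mem_filter.2 ⟨he, rfl⟩
    rw [h] at this
    simp at this
  · have h := Finset.sum_le_sum fun k
      (_ : k ∈ (Finset.univ : Finset Γ.ConnectedComponent)) => hcomp k
    rw [Finset.sum_add_distrib, Finset.sum_add_distrib, ← Finset.mul_sum, ← Finset.mul_sum,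
      hsumv, hsume, Finset.sum_boole] at h
    simp only [Finset.sum_const, Finset.card_univ, smul_eq_mul, Nat.cast_id] at h
    rw [Nat.card_eq_fintype_card]
    change _ + 6 * Fintype.card Γ.ConnectedComponent ≤ _
    omega

/-- The sides of the cells in a set, counted by cells. -/
theorem card_sides_filter (R : C → Prop) [DecidablePred R] (h₀ : R c₀) :
    (Finset.univ.filter fun s => R (X.cell s)).card
      = 3 * (Finset.univ.filter R).card + 3 := by
  rw [Finset.card_eq_sum_card_fiberwise (f := X.cell) (t := Finset.univ.filter R)
    (fun s hs => by simpa using hs)]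
  have h : ∀ c ∈ Finset.univ.filter R,
      ((Finset.univ.filter fun s => R (X.cell s)).filter fun s => X.cell s = c).card
        = 3 + if c = c₀ then 3 else 0 := by
    intro c hc
    have hc' := (Finset.mem_filter.1 hc).2
    have : ((Finset.univ.filter fun s => R (X.cell s)).filter fun s => X.cell s = c)
        = Finset.univ.filter fun s => X.cell s = c := by
      ext s
      simp only [Finset.mem_filter, Finset.mem_univ, true_and, and_iff_right_iff_imp]
      rintro rfl
      exact hc'
    rw [this]
    split_ifs with h
    · rw [h, hH.card_hole]
    · rw [hH.card_face c h]
  rw [Finset.sum_congr rfl h, Finset.sum_add_distrib, Finset.sum_ite_eq']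
  simp [h₀, mul_comm]

/-- In a tight complex the boundary of a set of oriented cells that contains the hole has length
at least `6`. -/
theorem six_le_sum_abs_bd_of_sign (hsp : X.IsSparse)
    (htight : Fintype.card E + 6 = 3 * Fintype.card V) (f : C → ℤ)
    (hf : ∀ c, f c = 0 ∨ f c = 1 ∨ f c = -1) (h₀ : f c₀ ≠ 0) : 6 ≤ ∑ e, |X.bd f e| := by
  classical
  -- the edges between two cells of the support whose contributions cancel
  let B : Finset E := Finset.univ.filter fun e =>
    X.bd f e = 0 ∧ ∀ s, X.edge s = e → f (X.cell s) ≠ 0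
  have hBmem : ∀ e, e ∈ B ↔ X.bd f e = 0 ∧ ∀ s, X.edge s = e → f (X.cell s) ≠ 0 := by
    intro e; simp [B]
  -- otherwise `f` would be an orientation
  have hBne : Bᶜ.Nonempty := by
    by_contra hcon
    rw [Finset.not_nonempty_iff_eq_empty, Finset.compl_eq_empty_iff] at hcon
    have hall : ∀ e, e ∈ B := fun e => hcon ▸ Finset.mem_univ e
    refine hX.not_orientable f (fun c => ?_) fun e => ((hBmem e).1 (hall e)).1
    obtain ⟨s, rfl⟩ := hX.cell_surj c
    exact (hf _).resolve_left (((hBmem _).1 (hall (X.edge s))).2 s rfl)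
  have hdeg : ∀ e v, e ∉ B → (X.tail e = v ∨ X.head e = v) →
      ∃ e', e' ∉ B ∧ e' ≠ e ∧ (X.tail e' = v ∨ X.head e' = v) := by
    intro e v he hv
    by_cases h0 : X.bd f e = 0
    · have : ∃ s, X.edge s = e ∧ f (X.cell s) = 0 := by
        by_contra! hcon
        exact he ((hBmem e).2 ⟨h0, hcon⟩)
      obtain ⟨s, rfl, hs⟩ := this
      have hsc : X.cell s ≠ c₀ := fun h => h₀ (h ▸ hs)
      rcases hX.src_or_tgt s v hv with h | h
      · have hc : X.cell (X.next.symm s) = X.cell s := by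
          rw [← hX.cell_next, Equiv.apply_symm_apply]
        refine ⟨X.edge (X.next.symm s), fun hmem => ((hBmem _).1 hmem).2 _ rfl (by rw [hc, hs]),
          ?_, ?_⟩
        · have := hH.corner (X.next.symm s) (by rwa [hc])
          rw [Equiv.apply_symm_apply] at this
          exact this.symm
        · have h2 := hX.end_tgt (X.next.symm s)
          rwa [← hX.src_next, Equiv.apply_symm_apply, h] at h2
      · refine ⟨X.edge (X.next s), fun hmem => ((hBmem _).1 hmem).2 _ rfl
          (by rw [hX.cell_next, hs]), hH.corner s hsc, ?_⟩
        have h2 := hX.end_src (X.next s)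
        rwa [hX.src_next, h] at h2
    · obtain ⟨e', h1, h2, h3⟩ := hX.exists_ne_of_bd_ne_zero f h0 hv
      exact ⟨e', fun hmem => h2 ((hBmem e').1 hmem).1, h1, h3⟩
  obtain ⟨q, hq1, hq2⟩ := hX.card_compl_le hH hsp hBne hdeg
  have hd := hX.card_edges_off_le f c₀ h₀ B (fun e he => ((hBmem e).1 he).1)
    (fun s hs => ((hBmem _).1 hs).2 s rfl)
  have hsides := hX.card_sides_filter hH (fun c => f c ≠ 0) h₀
  -- The sides of the support are those of `B` and those that contribute to the boundary.
  have hedge : ((Finset.univ.filter fun s => f (X.cell s) ≠ 0).card : ℤ)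
      = 2 * B.card + ∑ e, |X.bd f e| := by
    have h1 : (B.card : ℤ) = ∑ e, if e ∈ B then 1 else 0 := by simp
    rw [h1, Finset.mul_sum, ← Finset.sum_add_distrib,
      Finset.card_eq_sum_card_fiberwise (f := X.edge) (t := Finset.univ)
        (fun _ _ => Finset.mem_coe.2 (Finset.mem_univ _))]
    push_cast
    refine Finset.sum_congr rfl fun e _ => ?_
    obtain ⟨s, rfl⟩ := hX.exists_side e
    obtain ⟨t, ht1, ht2, ht3⟩ := hX.exists_twin s
    have hset : ((Finset.univ.filter fun s => f (X.cell s) ≠ 0).filter fun u => X.edge u = X.edge s)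
        = ({s, t} : Finset S).filter fun u => f (X.cell u) ≠ 0 := by
      ext u
      simp only [Finset.mem_filter, Finset.mem_univ, true_and, Finset.mem_insert,
        Finset.mem_singleton]
      constructor
      · exact fun h => ⟨ht3 u h.2, h.1⟩
      · rintro ⟨rfl | rfl, h⟩
        · exact ⟨h, rfl⟩
        · exact ⟨h, ht2⟩
    have hB : X.edge s ∈ B ↔ X.bd f (X.edge s) = 0 ∧ f (X.cell s) ≠ 0 ∧ f (X.cell t) ≠ 0 := by
      rw [hBmem]
      refine and_congr_right fun _ => ⟨fun h => ⟨h s rfl, h t ht2⟩, fun h u hu => ?_⟩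
      rcases ht3 u hu with rfl | rfl
      · exact h.1
      · exact h.2
    rw [hset, Finset.filter_insert, Finset.filter_singleton]
    simp only [hB]
    rw [hX.bd_eq ht1 ht2 ht3]
    rcases hX.sgn_eq s with h | h <;> rcases hX.sgn_eq t with h' | h' <;>
      rcases hf (X.cell s) with g | g | g <;> rcases hf (X.cell t) with g' | g' | g' <;>
      simp [h, h', g, g', ht1.symm]
  have hBc := Finset.card_add_card_compl B
  zify at *
  omega

end IsProjective

/-! ### The closed form of a tight complex -/

theorem abs_add_eq_abs_sign_add (x y : ℤ) :
    |x + y| = |x.sign + y.sign| + |(x - x.sign) + (y - y.sign)| := by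
  have hs : ∀ x : ℤ, (0 < x ∧ x.sign = 1) ∨ (x = 0 ∧ x.sign = 0) ∨ (x < 0 ∧ x.sign = -1) := by
    intro x
    rcases lt_trichotomy x 0 with h | h | h
    · exact Or.inr (Or.inr ⟨h, Int.sign_eq_neg_one_of_neg h⟩)
    · exact Or.inr (Or.inl ⟨h, by simp [h]⟩)
    · exact Or.inl ⟨h, Int.sign_eq_one_of_pos h⟩
  rcases hs x with ⟨h, h'⟩ | ⟨h, h'⟩ | ⟨h, h'⟩ <;> rcases hs y with ⟨g, g'⟩ | ⟨g, g'⟩ | ⟨g, g'⟩ <;>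
    rw [h', g'] <;>
    simp only [Int.abs_eq_natAbs] <;> omega

/-- A rational function has a common denominator. -/
theorem exists_nat_mul_eq_intCast {ι : Type*} [Fintype ι] (N : ι → ℚ) :
    ∃ k : ℕ, 0 < k ∧ ∃ M : ι → ℤ, ∀ i, (M i : ℚ) = k * N i := by
  refine ⟨∏ i, (N i).den, Finset.prod_pos fun i _ => (N i).den_pos, ?_⟩
  have : ∀ i, ∃ m : ℤ, (m : ℚ) = (∏ i, (N i).den : ℕ) * N i := by
    intro i
    obtain ⟨d, hd⟩ := Finset.dvd_prod_of_mem (fun i => (N i).den) (Finset.mem_univ i)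
    refine ⟨d * (N i).num, ?_⟩
    rw [hd]
    push_cast
    rw [mul_comm ((N i).den : ℚ), mul_assoc, Rat.den_mul_eq_num]
  choose M hM using this
  exact ⟨M, hM⟩

namespace IsProjective
variable {X : PolyComplex V E C S} (hX : X.IsProjective)
include hX

/-- Splitting off the signs of a chain does not create cancellations in its boundary. -/
theorem abs_bd_eq (N : C → ℤ) (e : E) :
    |X.bd N e| = |X.bd (fun c => (N c).sign) e| + |X.bd (fun c => N c - (N c).sign) e| := by
  obtain ⟨s, rfl⟩ := hX.exists_side e
  obtain ⟨t, ht1, ht2, ht3⟩ := hX.exists_twin s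
  rw [hX.bd_eq ht1 ht2 ht3, hX.bd_eq ht1 ht2 ht3, hX.bd_eq ht1 ht2 ht3]
  have hsgn : ∀ (s : S) (x : ℤ), X.sgn s * x.sign = (X.sgn s * x).sign := by
    intro s x
    rcases hX.sgn_eq s with h | h <;> simp [h]
  simp only [Int.cast_id, mul_sub, hsgn]
  exact abs_add_eq_abs_sign_add _ _

variable {c₀ : C} (hH : X.IsHoled c₀)
include hH

/-- The isoperimetric inequality for integral chains: such a chain is a sum of sets of oriented
cells whose boundaries do not cancel. -/
theorem six_mul_abs_le_sum_abs_bd (hsp : X.IsSparse)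
    (htight : Fintype.card E + 6 = 3 * Fintype.card V) (N : C → ℤ) :
    6 * |N c₀| ≤ ∑ e, |X.bd N e| := by
  suffices h : ∀ (n : ℕ) (N : C → ℤ), (N c₀).natAbs = n → 6 * |N c₀| ≤ ∑ e, |X.bd N e| from
    h _ N rfl
  intro n
  induction n with
  | zero =>
    intro N hN
    rw [Int.natAbs_eq_zero.1 hN]
    simpa using Finset.sum_nonneg fun e _ => abs_nonneg (X.bd N e)
  | succ n ih =>
    intro N hN
    have h0 : N c₀ ≠ 0 := by intro h; simp [h] at hN
    have h1 := hX.six_le_sum_abs_bd_of_sign hH hsp htight (fun c => (N c).sign)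
      (fun c => by rcases (N c).sign_trichotomy with h | h | h <;> simp [h])
      (by simpa [Int.sign_eq_zero_iff_zero] using h0)
    have hlt : (N c₀ - (N c₀).sign).natAbs = n ∧
        |N c₀| = 1 + |N c₀ - (N c₀).sign| := by
      rcases lt_or_gt_of_ne h0 with h | h
      · rw [Int.sign_eq_neg_one_of_neg h, abs_of_neg h, abs_of_nonpos (by omega)]
        omega
      · rw [Int.sign_eq_one_of_pos h, abs_of_pos h, abs_of_nonneg (by omega)]
        omega
    have h2 := ih (fun c => N c - (N c).sign) hlt.1
    rw [Finset.sum_congr rfl fun e _ => hX.abs_bd_eq N e, Finset.sum_add_distrib]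
    linarith [hlt.2]

/-- A cycle is long compared to its period: over the rationals it bounds a 2-chain, to which the
isoperimetric inequality applies. -/
theorem three_mul_abs_sum_le (hsp : X.IsSparse)
    (htight : Fintype.card E + 6 = 3 * Fintype.card V) (w : E → ℤ)
    (hw : ∀ c, X.cobd w c = if c = c₀ then 2 else 0) (z : E → ℤ) (hz : ∀ v, X.bdOne z v = 0) :
    3 * |∑ e, z e * w e| ≤ ∑ e, |z e| := by
  obtain ⟨N, hN⟩ := hX.exists_bd_eq (fun e => (z e : ℚ)) (fun v => by
    have := congrArg (Int.cast : ℤ → ℚ) (hz v)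
    rw [bdOne] at this ⊢
    push_cast at this
    exact this)
  obtain ⟨k, hk, M, hM⟩ := exists_nat_mul_eq_intCast N
  have hbd : ∀ e, X.bd M e = k * z e := by
    intro e
    have h1 := X.bd_intCast (A := ℚ) M e
    have h2 : (fun c => (M c : ℚ)) = (k : ℚ) • N := by ext c; simp [hM]
    rw [h2, bd_smul, Pi.smul_apply, hN, smul_eq_mul] at h1
    change (k : ℚ) * (z e : ℚ) = _ at h1
    exact_mod_cast h1.symm
  have h1 := X.sum_bd_mul M w
  simp only [hw, hbd, mul_ite, mul_zero, Finset.sum_ite_eq', Finset.mem_univ, if_true] at h1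
  have h2 := hX.six_mul_abs_le_sum_abs_bd hH hsp htight M
  simp only [hbd, abs_mul, Nat.abs_cast] at h2
  rw [← Finset.mul_sum] at h2
  simp only [mul_assoc] at h1
  rw [← Finset.mul_sum] at h1
  have h3 : (k : ℤ) * |∑ e, z e * w e| = 2 * |M c₀| := by
    have := congrArg abs h1
    rw [abs_mul, abs_mul, Nat.abs_cast] at this
    rw [this]; norm_num [mul_comm]
  have hk' : (0 : ℤ) < k := by exact_mod_cast hk
  refine le_of_mul_le_mul_left ?_ hk'
  linarith

/-- A tight complex carries a form with values in `{-1, 0, 1}` that is closed on the triangles and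
has the total `6` around the hole. Modulo `3` it is the gradient of `p`. This `p` is the distance
from a base vertex, where an edge has the length `1 - 3 w` in its reference direction and `1 + 3 w`
against it; that there are no negative cycles is `three_mul_abs_sum_le`. -/
theorem exists_form (hsp : X.IsSparse)
    (htight : Fintype.card E + 6 = 3 * Fintype.card V) :
    ∃ (p : V → ℤ) (w : E → ℤ), (∀ e, |X.grad p e + 3 * w e| ≤ 1) ∧
      ∀ c, X.cobd (fun e => X.grad p e + 3 * w e) c = if c = c₀ then 6 else 0 := by
  obtain ⟨w, hw⟩ := hX.exists_cobd_eq_two c₀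
  obtain ⟨s₀, -⟩ := hX.cell_surj c₀
  let o := X.src s₀
  let ind : V → V → ℤ := fun u v => if u = v then 1 else 0
  -- `Z v` consists of the 1-chains from `o` to `v`, and `wt` is their length
  let Z : V → Set (E → ℤ) := fun v => {z | ∀ u, X.bdOne z u = ind v u - ind o u}
  let wt : (E → ℤ) → ℤ := fun z => ∑ e, |z e| - 3 * ∑ e, z e * w e
  have hadd : ∀ (z z' : E → ℤ) u, X.bdOne (z + z') u = X.bdOne z u + X.bdOne z' u := by
    intro z z' u
    simp [bdOne, add_mul, Finset.sum_add_distrib]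
  have hsingle : ∀ e (a : ℤ) u, X.bdOne (Pi.single e a) u
      = a * (ind (X.head e) u - ind (X.tail e) u) := by
    intro e a u
    rw [bdOne, Finset.sum_eq_single e]
    · simp [ind]
    · intro e' _ h
      simp [h]
    · simp
  have hup : ∀ e z, z ∈ Z (X.tail e) → z + Pi.single e 1 ∈ Z (X.head e) := by
    intro e z hz u
    rw [hadd, hsingle, hz u]; ring
  have hdown : ∀ e z, z ∈ Z (X.head e) → z + Pi.single e (-1) ∈ Z (X.tail e) := by
    intro e z hz u
    rw [hadd, hsingle, hz u]; ring
  have hwt : ∀ e (a : ℤ) z, |a| = 1 → wt (z + Pi.single e a) ≤ wt z + 1 - 3 * a * w e := by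
    intro e a z ha
    have h1 : ∑ e', |(z + Pi.single e a : E → ℤ) e'| ≤ ∑ e', |z e'| + 1 := by
      calc ∑ e', |(z + Pi.single e a : E → ℤ) e'|
          ≤ ∑ e', (|z e'| + |(Pi.single e a : E → ℤ) e'|) :=
            Finset.sum_le_sum fun e' _ => abs_add_le _ _
        _ = ∑ e', |z e'| + 1 := by
            rw [Finset.sum_add_distrib]
            congr 1
            rw [Finset.sum_eq_single e]
            · simpa using ha
            · intro e' _ h; simp [h]
            · simp
    have h2 : ∑ e', (z + Pi.single e a : E → ℤ) e' * w e' = ∑ e', z e' * w e' + a * w e := by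
      simp only [Pi.add_apply, add_mul, Finset.sum_add_distrib]
      congr 1
      rw [Finset.sum_eq_single e]
      · simp
      · intro e' _ h; simp [h]
      · simp
    simp only [wt]
    rw [h2]
    linarith
  have hne : ∀ v, (Z v).Nonempty := by
    intro v
    refine hX.conn (fun v => (Z v).Nonempty) (fun e => ?_) o v ⟨0, fun u => by simp [bdOne]⟩
    exact ⟨fun ⟨z, hz⟩ => ⟨_, hup e z hz⟩, fun ⟨z, hz⟩ => ⟨_, hdown e z hz⟩⟩
  have hbdd : ∀ v, BddBelow (wt '' Z v) := by
    intro v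
    obtain ⟨y, hy⟩ := hne v
    refine ⟨-∑ e, |y e| - 3 * ∑ e, y e * w e, ?_⟩
    rintro _ ⟨z, hz, rfl⟩
    have hcyc := hX.three_mul_abs_sum_le hH hsp htight w hw (z - y) (fun u => by
      have h := hadd (z - y) y u
      rw [sub_add_cancel, hz u, hy u] at h
      linarith)
    have h1 : ∑ e, |(z - y) e| ≤ ∑ e, |z e| + ∑ e, |y e| := by
      rw [← Finset.sum_add_distrib]
      exact Finset.sum_le_sum fun e _ => abs_sub _ _
    have h2 : ∑ e, (z - y) e * w e = ∑ e, z e * w e - ∑ e, y e * w e := by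
      simp [sub_mul, Finset.sum_sub_distrib]
    rw [h2] at hcyc
    have h3 := le_abs_self (∑ e, z e * w e - ∑ e, y e * w e)
    simp only [wt]
    linarith
  let p : V → ℤ := fun v => sInf (wt '' Z v)
  have hp : ∀ v, ∃ z ∈ Z v, wt z = p v := fun v => Int.csInf_mem ((hne v).image wt) (hbdd v)
  have hple : ∀ v z, z ∈ Z v → p v ≤ wt z := fun v z hz => csInf_le (hbdd v) ⟨z, hz, rfl⟩
  refine ⟨p, w, fun e => ?_, fun c => ?_⟩
  · obtain ⟨z, hz, hzp⟩ := hp (X.tail e)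
    obtain ⟨y, hy, hyp⟩ := hp (X.head e)
    have h1 := (hple _ _ (hup e z hz)).trans (hwt e 1 z (by simp))
    have h2 := (hple _ _ (hdown e y hy)).trans (hwt e (-1) y (by simp))
    rw [abs_le, grad]
    constructor <;> linarith
  · have : (fun e => X.grad p e + 3 * w e) = X.grad p + (3 : ℤ) • w := by ext e; simp
    rw [this, cobd_add, cobd_smul, Pi.add_apply, Pi.smul_apply, hX.cobd_grad, hw]
    split_ifs <;> simp

end IsProjective

/-! ### Regions, and sparsity from a closed form -/

/-- Two cells are adjacent if they share an edge outside of `B`. The connected components are the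
regions into which the surface is cut along the edges in `B`. -/
def regionGraph (X : PolyComplex V E C S) (B : Finset E) : SimpleGraph C :=
  SimpleGraph.fromRel fun c c' =>
    ∃ s t, X.edge s = X.edge t ∧ X.edge s ∉ B ∧ X.cell s = c ∧ X.cell t = c'

theorem regionGraph_reachable (X : PolyComplex V E C S) {B : Finset E} {s t : S}
    (h : X.edge s = X.edge t) (hB : X.edge s ∉ B) :
    (X.regionGraph B).Reachable (X.cell s) (X.cell t) := by
  by_cases hc : X.cell s = X.cell t
  · rw [hc]
  · exact SimpleGraph.Adj.reachable
      ((SimpleGraph.fromRel_adj _ _ _).2 ⟨hc, Or.inl ⟨s, t, h, hB, rfl, rfl⟩⟩)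

/-- A function of the cells that agrees across the edges outside of `B` is constant on regions. -/
theorem eq_of_regionGraph_reachable {β : Type*} (X : PolyComplex V E C S) {B : Finset E}
    (f : C → β) (hf : ∀ s t, X.edge s = X.edge t → X.edge s ∉ B → f (X.cell s) = f (X.cell t))
    {c c' : C} (h : (X.regionGraph B).Reachable c c') : f c = f c' := by
  obtain ⟨p⟩ := h
  induction p with
  | nil => rfl
  | cons h _ ih =>
    refine Eq.trans ?_ ih
    rcases ((SimpleGraph.fromRel_adj _ _ _).1 h).2 with
      ⟨s, t, hst, hB, rfl, rfl⟩ | ⟨s, t, hst, hB, rfl, rfl⟩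
    · exact hf s t hst hB
    · exact (hf s t hst hB).symm

/-- The rational 2-chains whose boundary is supported on `B`. -/
def chainsWithBoundaryIn (X : PolyComplex V E C S) (B : Finset E) : Submodule ℚ (C → ℚ) where
  carrier := {N | ∀ e, e ∉ B → X.bd N e = 0}
  zero_mem' := by intro e _; simp [bd]
  add_mem' := by
    intro N N' h h' e he
    rw [bd_add, Pi.add_apply, h e he, h' e he, add_zero]
  smul_mem' := by
    intro a N h e he
    rw [bd_smul, Pi.smul_apply, h e he, smul_zero]

namespace IsProjective
variable {X : PolyComplex V E C S} (hX : X.IsProjective)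
include hX

/-- Euler's relation for the graph with vertices `A` and edges `B`: here the number of orientable
regions appears as the dimension of a space of chains. -/
theorem card_add_one_le (P : Finset V) (hP : P.Nonempty) (B : Finset E)
    (hB : ∀ e ∈ B, X.tail e ∈ P ∧ X.head e ∈ P) :
    B.card + 1 ≤ P.card + Module.finrank ℚ (X.chainsWithBoundaryIn B) := by
  classical
  let ψ : ((Bᶜ : Finset E) → ℚ) →ₗ[ℚ] (C → ℚ) := X.cobdHom.comp (extendZero Bᶜ)
  have h1 := LinearMap.finrank_range_add_finrank_ker ψ
  let θ : ((Pᶜ : Finset V) → ℚ) →ₗ[ℚ] ((Bᶜ : Finset E) → ℚ) :=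
    (LinearMap.funLeft ℚ ℚ Subtype.val).comp (X.gradHom.comp (extendZero Pᶜ))
  have hzero : ∀ (g : (Pᶜ : Finset V) → ℚ) (v : V), v ∈ P → extendZero Pᶜ g v = 0 :=
    fun g v hv => extendZero_of_notMem _ _ (by simpa using hv)
  have hgradB : ∀ (g : (Pᶜ : Finset V) → ℚ) (e : E), e ∈ B → X.grad (extendZero Pᶜ g) e = 0 := by
    intro g e he
    rw [grad, hzero g _ (hB e he).1, hzero g _ (hB e he).2, sub_zero]
  have hθ : Function.Injective θ := by
    rw [← LinearMap.ker_eq_bot, LinearMap.ker_eq_bot']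
    intro g hg
    have hgrad : ∀ e, X.grad (extendZero Pᶜ g) e = 0 := by
      intro e
      by_cases he : e ∈ B
      · exact hgradB g e he
      · exact congrFun hg ⟨e, by simpa using he⟩
    obtain ⟨a, ha⟩ := hP
    apply extendZero_injective
    rw [map_zero]
    ext v
    exact hX.conn (fun v => extendZero Pᶜ g v = 0)
      (fun e => by rw [← sub_eq_zero.1 (hgrad e)]) a v (hzero g a ha)
  have hrange : LinearMap.range θ ≤ LinearMap.ker ψ := by
    rintro _ ⟨g, rfl⟩
    have : extendZero Bᶜ (θ g) = X.grad (extendZero Pᶜ g) := by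
      ext e
      by_cases he : e ∈ B
      · rw [hgradB g e he, extendZero_of_notMem _ _ (by simpa using he)]
      · rw [extendZero_of_mem _ _ (by simpa using he)]
        rfl
    ext c
    change X.cobd (extendZero Bᶜ (θ g)) c = 0
    rw [this, hX.cobd_grad]
  have h2 := Submodule.finrank_mono hrange
  rw [LinearMap.finrank_range_of_inj hθ] at h2
  let π : (C → ℚ) →ₗ[ℚ] Module.Dual ℚ (LinearMap.range ψ) :=
    LinearMap.mk₂ ℚ (fun N x => ∑ c, N c * x.1 c)
      (fun a b x => by simp [add_mul, Finset.sum_add_distrib])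
      (fun a N x => by simp [Finset.mul_sum, mul_assoc])
      (fun N x y => by simp [mul_add, Finset.sum_add_distrib])
      (fun a N x => by simp [Finset.mul_sum, mul_left_comm])
  have h3 := LinearMap.finrank_range_add_finrank_ker π
  have hker : LinearMap.ker π ≤ X.chainsWithBoundaryIn B := by
    intro N hN e he
    have h := LinearMap.congr_fun (LinearMap.mem_ker.1 hN)
      ⟨ψ (Pi.single ⟨e, by simpa using he⟩ 1), ⟨_, rfl⟩⟩
    change ∑ c, N c * X.cobd (extendZero Bᶜ (Pi.single ⟨e, by simpa using he⟩ 1)) c = 0 at h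
    rw [← sum_bd_mul, Finset.sum_eq_single e] at h
    · simpa [extendZero, he] using h
    · intro e' _ hne
      have : extendZero Bᶜ (Pi.single ⟨e, by simpa using he⟩ 1) e' = 0 := by
        simp [extendZero, hne]
      rw [this, mul_zero]
    · simp
  have h4 := Submodule.finrank_mono hker
  have h5 := Submodule.finrank_le (LinearMap.range π)
  rw [Subspace.dual_finrank_eq] at h5
  simp only [Module.finrank_fintype_fun_eq_card, Fintype.card_coe] at h1 h2 h3
  have h6 := Finset.card_add_card_compl P
  have h7 := Finset.card_add_card_compl B
  have h8 := hX.euler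
  omega

/-- Across an edge that carries no boundary, a chain can only change its sign. -/
theorem sq_eq_sq_of_bd_eq_zero (N : C → ℚ) {s t : S} (h : X.edge s = X.edge t)
    (h0 : X.bd N (X.edge s) = 0) : N (X.cell s) ^ 2 = N (X.cell t) ^ 2 := by
  obtain ⟨u, h1, h2, h3⟩ := hX.exists_twin s
  rcases h3 t h.symm with rfl | rfl
  · rfl
  · rw [hX.bd_eq h1 h2 h3] at h0
    rcases hX.sgn_eq s with g | g <;> rcases hX.sgn_eq t with g' | g' <;>
      simp only [g, g', Int.cast_one, Int.cast_neg, one_mul, neg_mul] at h0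
    all_goals rw [sq_eq_sq_iff_eq_or_eq_neg]
    · right; linarith
    · left; linarith
    · left; linarith
    · right; linarith

/-- The flux of a form through the boundary of a chain. -/
theorem sum_abs_le (N : C → ℚ) (w : E → ℤ) {n : ℕ}
    (hw : ∀ c, X.cobd w c = if c = c₀ then (n : ℤ) else 0) :
    n * |N c₀| ≤ ∑ e, |X.bd N e| * |(w e : ℚ)| := by
  have h := X.sum_bd_mul N (fun e => (w e : ℚ))
  have hw' : ∀ c, X.cobd (fun e => (w e : ℚ)) c = if c = c₀ then (n : ℚ) else 0 := by
    intro c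
    rw [cobd_intCast, hw]
    split_ifs <;> simp
  simp only [hw', mul_ite, mul_zero, Finset.sum_ite_eq', Finset.mem_univ, if_true] at h
  calc (n : ℚ) * |N c₀| = |N c₀ * n| := by rw [abs_mul, Nat.abs_cast, mul_comm]
    _ = |∑ e, X.bd N e * w e| := by rw [h]
    _ ≤ ∑ e, |X.bd N e * w e| := Finset.abs_sum_le_sum_abs _ _
    _ = _ := Finset.sum_congr rfl fun e _ => abs_mul _ _

variable {c₀ : C} (hH : X.IsHoled c₀)
include hH

/-- A nonzero boundary is a union of cycles and has at least three edges. -/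
theorem three_le_card_bd_ne_zero [IsDomain A] [DecidableEq A] (N : C → A) {e : E}
    (he : X.bd N e ≠ 0) : 3 ≤ (Finset.univ.filter fun e => X.bd N e ≠ 0).card := by
  obtain ⟨e₁, h1, h1', h1''⟩ := hX.exists_ne_of_bd_ne_zero N he (Or.inl rfl)
  obtain ⟨e₂, h2, h2', h2''⟩ := hX.exists_ne_of_bd_ne_zero N he (Or.inr rfl)
  have hne : e₁ ≠ e₂ := by
    rintro rfl
    have h0 := hX.ne e
    rcases h1'' with h | h <;> rcases h2'' with h' | h'
    · exact h0 (h.symm.trans h')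
    · exact h1 (hH.simple _ _ (Or.inl ⟨h, h'⟩))
    · exact h1 (hH.simple _ _ (Or.inr ⟨h', h⟩))
    · exact h0 (h.symm.trans h')
  rw [← Finset.card_eq_three.2 ⟨e, e₁, e₂, h1.symm, h2.symm, hne, rfl⟩]
  refine Finset.card_le_card fun x hx => ?_
  simp only [Finset.mem_insert, Finset.mem_singleton] at hx
  simp only [Finset.mem_filter, Finset.mem_univ, true_and]
  rcases hx with rfl | rfl | rfl <;> assumption

/-- A nonempty proper set of cells is bounded by at least three edges. -/
theorem three_le_card_cut (Q : C → Prop) [DecidablePred Q] {c c' : C} (hc : Q c) (hc' : ¬ Q c') :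
    ∃ T : Finset E, 3 ≤ T.card ∧
      ∀ e ∈ T, ∃ s t, X.edge s = e ∧ X.edge t = e ∧ Q (X.cell s) ∧ ¬ Q (X.cell t) := by
  let f : C → ZMod 2 := fun c => if Q c then 1 else 0
  have hne : ∃ e, X.bd f e ≠ 0 := by
    by_contra! hcon
    refine hc' (hX.dual_conn Q (fun s t hst => ?_) c c' hc)
    obtain ⟨u, h1, h2, h3⟩ := hX.exists_twin s
    rcases h3 t hst.symm with rfl | rfl
    · rfl
    · have h := hcon (X.edge s)
      rw [hX.bd_eq h1 h2 h3] at h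
      by_cases g : Q (X.cell s) <;> by_cases g' : Q (X.cell t) <;>
        rcases hX.sgn_eq s with k | k <;> rcases hX.sgn_eq t with k' | k' <;>
        simp [f, g, g', k, k'] at h ⊢
  obtain ⟨e, he⟩ := hne
  refine ⟨_, hX.three_le_card_bd_ne_zero hH f he, fun e he => ?_⟩
  have he' := (Finset.mem_filter.1 he).2
  obtain ⟨s, rfl⟩ := hX.exists_side e
  obtain ⟨t, h1, h2, h3⟩ := hX.exists_twin s
  rw [hX.bd_eq h1 h2 h3] at he'
  by_cases g : Q (X.cell s) <;> by_cases g' : Q (X.cell t)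
  · exfalso
    rcases hX.sgn_eq s with k | k <;> rcases hX.sgn_eq t with k' | k' <;>
      simp [f, g, g', k, k'] at he' <;> exact he' (by decide)
  · exact ⟨s, t, rfl, h2, g, g'⟩
  · exact ⟨t, s, h2, rfl, g', g⟩
  · exact absurd (by simp [f, g, g']) he'

/-- The number of orientable regions, that is, the dimension of the space of chains with boundary
in `B`, is bounded through the number of edges in `B`: each region has at least three sides, and if
the region that contains the hole is orientable, then it has at least six, since the flux of the
form `w` through its boundary is six. -/
theorem finrank_chainsWithBoundaryIn_le (w : E → ℤ) (hw1 : ∀ e, |w e| ≤ 1)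
    (hw : ∀ c, X.cobd w c = if c = c₀ then 6 else 0) (B : Finset E)
    (hpos : 0 < Module.finrank ℚ (X.chainsWithBoundaryIn B)) :
    3 * Module.finrank ℚ (X.chainsWithBoundaryIn B) + 3 ≤ 2 * B.card := by
  classical
  let R := X.regionGraph B
  let mk := R.connectedComponentMk
  let W := X.chainsWithBoundaryIn B
  have hmk : ∀ s t, X.edge s = X.edge t → X.edge s ∉ B → mk (X.cell s) = mk (X.cell t) :=
    fun s t h hB => SimpleGraph.ConnectedComponent.sound (X.regionGraph_reachable h hB)
  have hsq : ∀ N ∈ W, ∀ c c', mk c = mk c' → N c ^ 2 = N c' ^ 2 := by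
    intro N hN c c' h
    refine X.eq_of_regionGraph_reachable (fun c => N c ^ 2) (fun s t hst hB => ?_)
      (SimpleGraph.ConnectedComponent.exact h)
    exact hX.sq_eq_sq_of_bd_eq_zero N hst (hN _ hB)
  -- the orientable regions
  let O : Finset R.ConnectedComponent :=
    Finset.univ.filter fun k => ∃ N ∈ W, ∃ c, mk c = k ∧ N c ≠ 0
  have hO : Module.finrank ℚ W ≤ O.card := by
    let r : W →ₗ[ℚ] (O → ℚ) :=
      (LinearMap.funLeft ℚ ℚ fun k : O => k.1.out).comp W.subtype
    have hr : Function.Injective r := by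
      rw [← LinearMap.ker_eq_bot, LinearMap.ker_eq_bot']
      intro ⟨N, hN⟩ h
      ext c
      change N c = 0
      by_contra hc
      have hk : mk c ∈ O := by
        simp only [O, Finset.mem_filter, Finset.mem_univ, true_and]
        exact ⟨N, hN, c, rfl, hc⟩
      have h0 : N (mk c).out = 0 := congrFun h ⟨mk c, hk⟩
      have h1 := hsq N hN c (mk c).out (Quot.out_eq (mk c)).symm
      rw [h0] at h1
      exact hc (by simpa using h1)
    have := LinearMap.finrank_le_finrank_of_injective hr
    simpa using this
  let b : R.ConnectedComponent → ℕ := fun k =>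
    (Finset.univ.filter fun s => X.edge s ∈ B ∧ mk (X.cell s) = k).card
  have hsum : ∑ k, b k = 2 * B.card := by
    have h1 : ∑ k, b k = (Finset.univ.filter fun s => X.edge s ∈ B).card := by
      rw [Finset.card_eq_sum_card_fiberwise (f := fun s => mk (X.cell s)) (t := Finset.univ)
        (fun _ _ => Finset.mem_coe.2 (Finset.mem_univ _))]
      simp only [b, Finset.filter_filter]
    rw [h1, Finset.card_eq_sum_card_fiberwise (f := X.edge) (t := B)
      (fun s hs => by simpa using hs)]
    rw [Finset.sum_congr rfl (g := fun _ => 2), Finset.sum_const, smul_eq_mul, mul_comm]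
    intro e he
    rw [← hX.two_sides e]
    congr 1
    ext s
    simp only [Finset.mem_filter, Finset.mem_univ, true_and, and_iff_right_iff_imp]
    rintro rfl
    exact he
  have hb3 : 2 ≤ Fintype.card R.ConnectedComponent → ∀ k, 3 ≤ b k := by
    intro h2 k
    obtain ⟨k', hk'⟩ := Fintype.exists_ne_of_one_lt_card h2 k
    obtain ⟨T, hT, hTs⟩ := hX.three_le_card_cut hH (fun c => mk c = k) (c := k.out) (c' := k'.out)
      (Quot.out_eq k) (fun h => hk' ((Quot.out_eq k').symm.trans h))
    refine hT.trans ((Finset.card_le_card fun e he => ?_).trans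
      (Finset.card_image_le (f := X.edge)))
    obtain ⟨s, t, rfl, ht, hs1, ht1⟩ := hTs e he
    refine Finset.mem_image_of_mem _ ?_
    simp only [Finset.mem_filter, Finset.mem_univ, true_and]
    refine ⟨?_, hs1⟩
    by_contra hB
    exact ht1 ((hmk s t ht.symm hB).symm.trans hs1)
  have hb6 : mk c₀ ∈ O → 6 ≤ b (mk c₀) := by
    intro h
    obtain ⟨N, hN, c, hc, hNc⟩ := (Finset.mem_filter.1 h).2
    have hN0 : N c₀ ≠ 0 := by
      intro h0
      have := hsq N hN c c₀ hc
      rw [h0] at this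
      exact hNc (by simpa using this)
    let M : C → ℚ := fun c => if mk c = mk c₀ then N c else 0
    have hMabs : ∀ c, |M c| = if mk c = mk c₀ then |N c₀| else 0 := by
      intro c
      by_cases h : mk c = mk c₀
      · simp only [M, h, if_true]
        exact (sq_eq_sq_iff_abs_eq_abs _ _).1 (hsq N hN c c₀ h)
      · simp [M, h]
    have hMoff : ∀ e, e ∉ B → X.bd M e = 0 := by
      intro e he
      obtain ⟨s, rfl⟩ := hX.exists_side e
      obtain ⟨t, h1, h2, h3⟩ := hX.exists_twin s
      have hNe := hN _ he
      rw [hX.bd_eq h1 h2 h3] at hNe ⊢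
      by_cases h : mk (X.cell s) = mk c₀
      · have h' : mk (X.cell t) = mk c₀ := (hmk s t h2.symm he).symm.trans h
        simpa only [M, h, h', if_true] using hNe
      · have h' : ¬ mk (X.cell t) = mk c₀ := fun h' => h ((hmk s t h2.symm he).trans h')
        simp [M, h, h']
    have hflux := hX.sum_abs_le M w (n := 6) (by simpa using hw)
    have hle : ∑ e, |X.bd M e| * |(w e : ℚ)| ≤ b (mk c₀) * |N c₀| := by
      have h1 : ∀ e, |X.bd M e| * |(w e : ℚ)|
          ≤ ∑ s with X.edge s = e, if X.edge s ∈ B then |M (X.cell s)| else 0 := by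
        intro e
        by_cases he : e ∈ B
        · have hw' : |(w e : ℚ)| ≤ 1 := by exact_mod_cast hw1 e
          calc |X.bd M e| * |(w e : ℚ)| ≤ |X.bd M e| * 1 := by gcongr
            _ = |X.bd M e| := mul_one _
            _ ≤ ∑ s with X.edge s = e, |(X.sgn s : ℚ) * M (X.cell s)| :=
              Finset.abs_sum_le_sum_abs _ _
            _ = _ := by
              refine Finset.sum_congr rfl fun s hs => ?_
              rw [(Finset.mem_filter.1 hs).2, if_pos he]
              rcases hX.sgn_eq s with g | g <;> simp [g]
        · rw [hMoff e he, abs_zero, zero_mul]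
          refine Finset.sum_nonneg fun s _ => ?_
          split_ifs
          · exact abs_nonneg _
          · exact le_rfl
      refine (Finset.sum_le_sum fun e _ => h1 e).trans ?_
      rw [Finset.sum_fiberwise]
      simp only [hMabs, ← ite_and]
      rw [← Finset.sum_filter, Finset.sum_const, nsmul_eq_mul]
    have hM0 : |M c₀| = |N c₀| := by rw [hMabs, if_pos rfl]
    rw [hM0] at hflux
    have hpos' : 0 < |N c₀| := abs_pos.2 hN0
    have := le_of_mul_le_mul_right (hflux.trans hle) hpos'
    exact_mod_cast this
  change 3 * Module.finrank ℚ W + 3 ≤ _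
  rw [← hsum]
  by_cases hall : O = Finset.univ
  · rw [hall, Finset.card_univ] at hO
    have h6 := hb6 (hall ▸ Finset.mem_univ _)
    rw [← Finset.add_sum_erase _ _ (Finset.mem_univ (mk c₀))]
    have h3 : 3 * (Fintype.card R.ConnectedComponent - 1) ≤
        ∑ k ∈ Finset.univ.erase (mk c₀), b k := by
      rw [← Finset.card_univ, ← Finset.card_erase_of_mem (Finset.mem_univ (mk c₀)), mul_comm,
        ← smul_eq_mul]
      refine Finset.card_nsmul_le_sum _ _ _ fun k hk => hb3 ?_ k
      exact Fintype.one_lt_card_iff.2 ⟨k, _, Finset.ne_of_mem_erase hk⟩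
    omega
  · have hlt : O.card < Fintype.card R.ConnectedComponent := by
      rw [← Finset.card_univ]
      exact Finset.card_lt_card (Finset.ssubset_univ_iff.2 hall)
    change 0 < Module.finrank ℚ W at hpos
    have h3 : Fintype.card R.ConnectedComponent * 3 ≤ ∑ k, b k := by
      rw [← Finset.card_univ, ← smul_eq_mul]
      exact Finset.card_nsmul_le_sum _ _ _ fun k _ => hb3 (by omega) k
    omega

/-- A form as in `exists_form` certifies sparsity. -/
theorem isSparse_of_form (w : E → ℤ) (hw1 : ∀ e, |w e| ≤ 1)
    (hw : ∀ c, X.cobd w c = if c = c₀ then 6 else 0) : X.IsSparse := by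
  intro P B hB hP
  have h1 := hX.card_add_one_le P (Finset.card_pos.1 (by omega)) B hB
  rcases Nat.eq_zero_or_pos (Module.finrank ℚ (X.chainsWithBoundaryIn B)) with h | h
  · omega
  · have := hX.finrank_chainsWithBoundaryIn_le hH w hw1 hw B h
    omega

/-- A 3-cycle on one of whose edges the form vanishes separates the surface: the flux through it is
too small for its complement to be an orientable region that contains the hole. -/
theorem exists_sides_of_card_eq_three (w : E → ℤ) (hw1 : ∀ e, |w e| ≤ 1)
    (hw : ∀ c, X.cobd w c = if c = c₀ then 6 else 0) (P : Finset V) (hP : P.card = 3)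
    (B : Finset E) (hB : ∀ e ∈ B, X.tail e ∈ P ∧ X.head e ∈ P) (hB3 : B.card = 3) {e₀ : E}
    (he₀ : e₀ ∈ B) (hw₀ : w e₀ = 0) :
    ∀ e ∈ B, ∃ s t, X.edge s = e ∧ X.edge t = e ∧ (X.regionGraph B).Reachable c₀ (X.cell s) ∧
      ¬ (X.regionGraph B).Reachable c₀ (X.cell t) := by
  classical
  -- Without a separation, the complement is a single region. It is orientable by Euler's relation,
  -- so that a flux of `6` would pass through the two edges other than `e₀`, twice through each.
  have hcut : ∃ c, ¬ (X.regionGraph B).Reachable c₀ c := by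
    by_contra! hall
    have h1 := hX.card_add_one_le P (Finset.card_pos.1 (by omega)) B hB
    have hpos : 0 < Module.finrank ℚ (X.chainsWithBoundaryIn B) := by omega
    have hnt := Module.nontrivial_of_finrank_pos hpos
    obtain ⟨⟨N, hN⟩, hne⟩ := exists_ne (0 : X.chainsWithBoundaryIn B)
    have hsq : ∀ c, |N c| = |N c₀| := by
      intro c
      rw [← sq_eq_sq_iff_abs_eq_abs]
      exact (X.eq_of_regionGraph_reachable (fun c => N c ^ 2)
        (fun s t hst hs => hX.sq_eq_sq_of_bd_eq_zero N hst (hN _ hs)) (hall c)).symm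
    have hpos' : 0 < |N c₀| := by
      rw [abs_pos]
      intro h0
      apply hne
      ext c
      have := hsq c
      rw [h0, abs_zero, abs_eq_zero] at this
      exact this
    have hflux := hX.sum_abs_le N w (n := 6) (by simpa using hw)
    have hle : ∀ e, |X.bd N e| * |(w e : ℚ)| ≤ if e ∈ B.erase e₀ then 2 * |N c₀| else 0 := by
      intro e
      by_cases he : e ∈ B
      · by_cases he' : e = e₀
        · subst he'
          simp [hw₀]
        · rw [if_pos (Finset.mem_erase.2 ⟨he', he⟩)]
          have hw' : |(w e : ℚ)| ≤ 1 := by exact_mod_cast hw1 e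
          have hbd : |X.bd N e| ≤ 2 * |N c₀| := by
            obtain ⟨s, rfl⟩ := hX.exists_side e
            obtain ⟨t, h1, h2, h3⟩ := hX.exists_twin s
            rw [hX.bd_eq h1 h2 h3]
            refine (abs_add_le _ _).trans ?_
            have habs : ∀ u, |(X.sgn u : ℚ) * N (X.cell u)| = |N c₀| := by
              intro u
              rcases hX.sgn_eq u with g | g <;> simp [g, hsq]
            rw [habs, habs, two_mul]
          calc |X.bd N e| * |(w e : ℚ)| ≤ 2 * |N c₀| * 1 := by gcongr
            _ = _ := mul_one _
      · rw [hN e he, abs_zero, zero_mul]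
        split_ifs
        · positivity
        · exact le_rfl
    have h2 := hflux.trans (Finset.sum_le_sum fun e _ => hle e)
    rw [← Finset.sum_filter, Finset.sum_const, Finset.filter_mem_eq_inter, Finset.univ_inter,
      Finset.card_erase_of_mem he₀, hB3, nsmul_eq_mul] at h2
    norm_num at h2
    linarith
  obtain ⟨c, hc⟩ := hcut
  obtain ⟨T, hT, hTs⟩ := hX.three_le_card_cut hH (fun c => (X.regionGraph B).Reachable c₀ c)
    (SimpleGraph.Reachable.refl c₀) hc
  have hTB : T ⊆ B := by
    intro e he
    obtain ⟨s, t, rfl, ht, hs1, ht1⟩ := hTs e he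
    by_contra heB
    exact ht1 (hs1.trans (X.regionGraph_reachable ht.symm heB))
  have hEq := Finset.eq_of_subset_of_card_le hTB (by omega)
  exact fun e he => hTs e (by rwa [hEq])

end IsProjective
end Chains
end PolyComplex

namespace FacedGraph
variable {V : Type*} [Fintype V] [DecidableEq V]

/-! ### The complex of a faced graph with a hole -/

/-- An enumeration of the vertices of a facial 3-cycle. -/
noncomputable def faceVertex (G : FacedGraph V) (t : G.faces) (i : Fin 3) : V :=
  ((t.1.equivFinOfCardEq (G.isNClique_of_mem t.1 t.2).card_eq).symm i).1

theorem faceVertex_mem (G : FacedGraph V) (t : G.faces) (i : Fin 3) : G.faceVertex t i ∈ t.1 :=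
  ((t.1.equivFinOfCardEq _).symm i).2

theorem faceVertex_injective (G : FacedGraph V) (t : G.faces) :
    Function.Injective (G.faceVertex t) :=
  Subtype.val_injective.comp (Equiv.injective _)

theorem exists_faceVertex (G : FacedGraph V) (t : G.faces) {v : V} (hv : v ∈ t.1) :
    ∃ i, G.faceVertex t i = v := by
  refine ⟨t.1.equivFinOfCardEq (G.isNClique_of_mem t.1 t.2).card_eq ⟨v, hv⟩, ?_⟩
  simp [faceVertex]

theorem fin_three_ne_succ : ∀ i : Fin 3, i ≠ i + 1 := by decide

theorem faceVertex_adj (G : FacedGraph V) (t : G.faces) (i : Fin 3) :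
    G.graph.Adj (G.faceVertex t i) (G.faceVertex t (i + 1)) :=
  (G.isNClique_of_mem t.1 t.2).isClique (G.faceVertex_mem t i) (G.faceVertex_mem t _)
    (fun h => fin_three_ne_succ i (G.faceVertex_injective t h))

/-- The starting point of a side of a facial triangle or of the hole. -/
noncomputable def sidePoint (G : FacedGraph V) {s : ℕ} (h : ZMod s → V) :
    (G.faces × Fin 3) ⊕ ZMod s → V :=
  Sum.elim (fun x => G.faceVertex x.1 x.2) h

/-- The successor of a side on the boundary of its cell. -/
def sideNext (G : FacedGraph V) (s : ℕ) : Equiv.Perm ((G.faces × Fin 3) ⊕ ZMod s) :=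
  Equiv.sumCongr (Equiv.prodCongr (Equiv.refl _) (Equiv.addRight 1)) (Equiv.addRight 1)

theorem sidePoint_adj (G : FacedGraph V) {s : ℕ} {h : ZMod s → V}
    (hadj : ∀ i, G.graph.Adj (h i) (h (i + 1))) (x : (G.faces × Fin 3) ⊕ ZMod s) :
    G.graph.Adj (G.sidePoint h x) (G.sidePoint h (G.sideNext s x)) := by
  rcases x with ⟨t, i⟩ | i
  · exact G.faceVertex_adj t i
  · exact hadj i

/-- The polygonal complex obtained by attaching triangles along the facial 3-cycles, and a further
cell `none` along the closed walk `h`. -/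
noncomputable def toComplex (G : FacedGraph V) {s : ℕ} {h : ZMod s → V}
    (hadj : ∀ i, G.graph.Adj (h i) (h (i + 1))) :
    PolyComplex V G.graph.edgeSet (Option G.faces) ((G.faces × Fin 3) ⊕ ZMod s) where
  tail e := (Quot.out e.1).1
  head e := (Quot.out e.1).2
  edge x := ⟨s(G.sidePoint h x, G.sidePoint h (G.sideNext s x)), G.sidePoint_adj hadj x⟩
  sgn x := if (Quot.out s(G.sidePoint h x, G.sidePoint h (G.sideNext s x))).1 = G.sidePoint h x
    then 1 else -1
  cell := Sum.elim (fun x => some x.1) (fun _ => none)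
  next := G.sideNext s

section

variable (G : FacedGraph V) {s : ℕ} {h : ZMod s → V}
  (hadj : ∀ i, G.graph.Adj (h i) (h (i + 1)))

theorem toComplex_mk_eq (e : G.graph.edgeSet) :
    s((G.toComplex hadj).tail e, (G.toComplex hadj).head e) = e.1 := Quot.out_eq e.1

theorem toComplex_edge (x : (G.faces × Fin 3) ⊕ ZMod s) :
    ((G.toComplex hadj).edge x).1 = s(G.sidePoint h x, G.sidePoint h (G.sideNext s x)) := rfl

theorem toComplex_end_iff (e : G.graph.edgeSet) (v : V) :
    ((G.toComplex hadj).tail e = v ∨ (G.toComplex hadj).head e = v) ↔ v ∈ e.1 := by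
  rw [← G.toComplex_mk_eq hadj e, Sym2.mem_iff]
  simp [eq_comm]

theorem toComplex_sgn_eq (x : (G.faces × Fin 3) ⊕ ZMod s) :
    (G.toComplex hadj).sgn x = 1 ∨ (G.toComplex hadj).sgn x = -1 := by
  change (if _ then (1 : ℤ) else -1) = 1 ∨ (if _ then (1 : ℤ) else -1) = -1
  split_ifs <;> simp

theorem toComplex_src_tgt (x : (G.faces × Fin 3) ⊕ ZMod s) :
    (G.toComplex hadj).src x = G.sidePoint h x ∧
      (G.toComplex hadj).tgt x = G.sidePoint h (G.sideNext s x) := by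
  have h1 := G.toComplex_mk_eq hadj ((G.toComplex hadj).edge x)
  rw [toComplex_edge] at h1
  have hsgn : (G.toComplex hadj).sgn x = if (G.toComplex hadj).tail ((G.toComplex hadj).edge x)
    = G.sidePoint h x then 1 else -1 := rfl
  rcases Sym2.eq_iff.1 h1 with ⟨h2, h3⟩ | ⟨h2, h3⟩
  · rw [h2, if_pos rfl] at hsgn
    simp [PolyComplex.src, PolyComplex.tgt, hsgn, h2, h3]
  · rw [h2, if_neg (G.sidePoint_adj hadj x).ne'] at hsgn
    simp [PolyComplex.src, PolyComplex.tgt, hsgn, h2, h3]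

theorem toComplex_src (x : (G.faces × Fin 3) ⊕ ZMod s) :
    (G.toComplex hadj).src x = G.sidePoint h x := (G.toComplex_src_tgt hadj x).1

theorem toComplex_tgt (x : (G.faces × Fin 3) ⊕ ZMod s) :
    (G.toComplex hadj).tgt x = G.sidePoint h (G.sideNext s x) := (G.toComplex_src_tgt hadj x).2

theorem fin_three_succ_cases : ∀ i j : Fin 3, i ≠ j → j = i + 1 ∨ i = j + 1 := by decide

theorem fin_three_succ_ne : ∀ i : Fin 3, i + 1 + 1 ≠ i := by decide

theorem fin_three_cases : ∀ i j : Fin 3, j = i ∨ j = i + 1 ∨ j = i + 1 + 1 := by decide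

/-- A pair of vertices spans at most one side of a facial triangle. -/
theorem faceVertex_side_unique (t : G.faces) {i j : Fin 3}
    (hij : s(G.faceVertex t i, G.faceVertex t (i + 1)) =
      s(G.faceVertex t j, G.faceVertex t (j + 1))) : i = j := by
  rcases Sym2.eq_iff.1 hij with ⟨h1, -⟩ | ⟨h1, h2⟩
  · exact G.faceVertex_injective t h1
  · have h3 := G.faceVertex_injective t h1
    have h4 := G.faceVertex_injective t h2
    rw [h3] at h4
    exact absurd h4 (fin_three_succ_ne j)

theorem exists_faceVertex_side (t : G.faces) {u v : V} (huv : u ≠ v) (hu : u ∈ t.1)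
    (hv : v ∈ t.1) : ∃ i, s(G.faceVertex t i, G.faceVertex t (i + 1)) = s(u, v) := by
  obtain ⟨i, rfl⟩ := G.exists_faceVertex t hu
  obtain ⟨j, rfl⟩ := G.exists_faceVertex t hv
  rcases fin_three_succ_cases i j (fun h => huv (by rw [h])) with rfl | rfl
  · exact ⟨i, rfl⟩
  · exact ⟨j, Sym2.eq_swap⟩

theorem card_sides_eq [NeZero s] {u v : V} (huv : G.graph.Adj u v) :
    (Finset.univ.filter fun x => (G.toComplex hadj).edge x = ⟨s(u, v), huv⟩).card
      = G.faceCount u v + holeCount h u v := by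
  classical
  have hsplit : (Finset.univ.filter fun x => (G.toComplex hadj).edge x = ⟨s(u, v), huv⟩)
      = (Finset.univ.filter fun x : G.faces × Fin 3 =>
          s(G.faceVertex x.1 x.2, G.faceVertex x.1 (x.2 + 1)) = s(u, v)).disjSum
        (Finset.univ.filter fun i : ZMod s => s(h i, h (i + 1)) = s(u, v)) := by
    ext x
    rcases x with x | x
    · simp only [Finset.mem_filter, Finset.mem_univ, true_and, Finset.inl_mem_disjSum,
        Subtype.ext_iff, toComplex_edge]
      rfl
    · simp only [Finset.mem_filter, Finset.mem_univ, true_and, Finset.inr_mem_disjSum,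
        Subtype.ext_iff, toComplex_edge]
      rfl
  rw [hsplit, Finset.card_disjSum]
  congr 1
  · rw [faceCount]
    refine Finset.card_bij (fun x _ => x.1.1) ?_ ?_ ?_
    · rintro ⟨t, i⟩ hx
      have hx' := (Finset.mem_filter.1 hx).2
      refine Finset.mem_filter.2 ⟨t.2, ?_⟩
      rcases Sym2.eq_iff.1 hx' with ⟨rfl, rfl⟩ | ⟨rfl, rfl⟩
      · exact ⟨G.faceVertex_mem _ _, G.faceVertex_mem _ _⟩
      · exact ⟨G.faceVertex_mem _ _, G.faceVertex_mem _ _⟩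
    · rintro ⟨t, i⟩ hx ⟨t', i'⟩ hx' heq
      obtain rfl : t = t' := Subtype.ext heq
      exact congrArg (Prod.mk t) (G.faceVertex_side_unique t
        ((Finset.mem_filter.1 hx).2.trans (Finset.mem_filter.1 hx').2.symm))
    · intro t ht
      obtain ⟨ht1, ht2, ht3⟩ := Finset.mem_filter.1 ht
      obtain ⟨i, hi⟩ := G.exists_faceVertex_side ⟨t, ht1⟩ huv.ne ht2 ht3
      exact ⟨(⟨t, ht1⟩, i), Finset.mem_filter.2 ⟨Finset.mem_univ _, hi⟩, rfl⟩
  · rw [holeCount, Set.ncard_eq_toFinset_card']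
    congr 1
    ext i
    simp

theorem zmod_induction [NeZero s] (Q : ZMod s → Prop) (hQ : ∀ i, Q i ↔ Q (i + 1)) (i j : ZMod s)
    (hi : Q i) : Q j := by
  have : ∀ n : ℕ, Q (i + n) := by
    intro n
    induction n with
    | zero => simpa using hi
    | succ n ih => rw [Nat.cast_succ, ← add_assoc]; exact (hQ _).1 ih
  have h := this (j - i).val
  rwa [ZMod.natCast_zmod_val, add_sub_cancel] at h

/-- A property of the neighbours of `v` that passes to the other side of each corner at `v` holds
for all neighbours or for none. -/
theorem iff_of_link_connected {v : V} (hl : (G.link h v).Connected)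
    (Q : V → Prop) (hface : ∀ a b, a ≠ b → ({v, a, b} : Finset V) ∈ G.faces → (Q a ↔ Q b))
    (hhole : ∀ i, h (i + 1) = v → (Q (h i) ↔ Q (h (i + 2)))) :
    ∀ a b, G.graph.Adj v a → G.graph.Adj v b → (Q a ↔ Q b) := by
  have hadj : ∀ a b, (G.link h v).Adj a b → (Q a.1 ↔ Q b.1) := by
    intro a b hab
    obtain ⟨hne, hab⟩ := (SimpleGraph.fromRel_adj _ _ _).1 hab
    have hne' : a.1 ≠ b.1 := fun h => hne (Subtype.ext h)
    rcases hab with (hf | ⟨i, h1, h2, h3⟩) | (hf | ⟨i, h1, h2, h3⟩)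
    · exact hface _ _ hne' hf
    · rw [← h1, ← h3]; exact hhole i h2
    · exact (hface _ _ hne'.symm hf).symm
    · rw [← h1, ← h3]; exact (hhole i h2).symm
  intro a b ha hb
  obtain ⟨p⟩ := hl.preconnected ⟨a, ha⟩ ⟨b, hb⟩
  have : ∀ (x y : G.graph.neighborSet v), (G.link h v).Walk x y → (Q x.1 ↔ Q y.1) := by
    intro x y p
    induction p with
    | nil => rfl
    | cons hxy _ ih => exact (hadj _ _ hxy).trans ih
  exact this _ _ p

end

section

variable {G : FacedGraph V} {s : ℕ} {h : ZMod s → V}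

theorem three_distinct_of_mem {v a b : V} (hf : ({v, a, b} : Finset V) ∈ G.faces) :
    v ≠ a ∧ v ≠ b ∧ a ≠ b := by
  have h3 := (G.isNClique_of_mem _ hf).card_eq
  refine ⟨?_, ?_, ?_⟩ <;> rintro rfl
  · have := Finset.card_le_two (a := v) (b := b)
    simp at h3
    omega
  · have := Finset.card_le_two (a := v) (b := a)
    rw [Finset.insert_comm] at h3
    simp at h3
    have := Finset.card_le_two (a := a) (b := v)
    omega
  · have := Finset.card_le_two (a := v) (b := a)
    simp at h3
    omega

/-- The corner at `v` of a facial triangle `vab`, in the enumeration of its vertices. -/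
theorem exists_corner {v a b : V} (hf : ({v, a, b} : Finset V) ∈ G.faces) :
    ∃ i, G.faceVertex ⟨_, hf⟩ (i + 1) = v ∧
      ((G.faceVertex ⟨_, hf⟩ i = a ∧ G.faceVertex ⟨_, hf⟩ (i + 1 + 1) = b) ∨
        (G.faceVertex ⟨_, hf⟩ i = b ∧ G.faceVertex ⟨_, hf⟩ (i + 1 + 1) = a)) := by
  obtain ⟨hva, hvb, hab⟩ := three_distinct_of_mem hf
  have hfin : ∀ i j k : Fin 3, i ≠ j → i ≠ k → j ≠ k →
      i = (i + 1 + 1) + 1 ∧ ((j = i + 1 + 1 ∧ k = (i + 1 + 1) + 1 + 1) ∨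
        (k = i + 1 + 1 ∧ j = (i + 1 + 1) + 1 + 1)) := by decide
  obtain ⟨i, hi⟩ := G.exists_faceVertex ⟨_, hf⟩ (v := v) (by simp)
  obtain ⟨j, hj⟩ := G.exists_faceVertex ⟨_, hf⟩ (v := a) (by simp)
  obtain ⟨k, hk⟩ := G.exists_faceVertex ⟨_, hf⟩ (v := b) (by simp)
  obtain ⟨h1, h2⟩ := hfin i j k (by rintro rfl; exact hva (hi.symm.trans hj))
    (by rintro rfl; exact hvb (hi.symm.trans hk)) (by rintro rfl; exact hab (hj.symm.trans hk))
  refine ⟨i + 1 + 1, by rw [← h1, hi], ?_⟩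
  rcases h2 with ⟨h3, h4⟩ | ⟨h3, h4⟩
  · exact Or.inl ⟨by rw [← h3, hj], by rw [← h4, hk]⟩
  · exact Or.inr ⟨by rw [← h3, hk], by rw [← h4, hj]⟩

variable [Fintype G.graph.edgeSet]

theorem IsProjectiveWithHole.toComplex_isProjective [NeZero s] (hP : G.IsProjectiveWithHole h) :
    (G.toComplex hP.hole_adj).IsProjective where
  sgn_eq := G.toComplex_sgn_eq _
  ne e he := by
    have h1 := G.toComplex_mk_eq hP.hole_adj e
    have h2 := e.2
    rw [← h1, he] at h2
    exact G.graph.loopless.irrefl _ h2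
  cell_next x := by rcases x with x | x <;> rfl
  src_next x := by rw [toComplex_src, toComplex_tgt]; rfl
  two_sides e := by
    obtain ⟨e, he⟩ := e
    induction e using Sym2.ind with
    | _ u v =>
      have h1 := G.card_sides_eq hP.hole_adj he
      rw [hP.two_sides u v he] at h1
      convert h1
  conn Q hQ u v hu := by
    have hadj : ∀ a b, G.graph.Adj a b → (Q a ↔ Q b) := by
      intro a b hab
      have h1 := hQ ⟨s(a, b), hab⟩
      rcases Sym2.eq_iff.1 (G.toComplex_mk_eq hP.hole_adj ⟨s(a, b), hab⟩) with ⟨h2, h3⟩ | ⟨h2, h3⟩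
      · rwa [h2, h3] at h1
      · rw [h2, h3] at h1; exact h1.symm
    obtain ⟨p⟩ := hP.connected.preconnected u v
    induction p with
    | nil => exact hu
    | cons hab _ ih => exact ih ((hadj _ _ hab).1 hu)
  link v Q hQ e e' he he' hQe := by
    -- the property of the edges at `v`, as one of their other ends
    let Q' : V → Prop := fun a => ∃ ha : G.graph.Adj v a, Q ⟨s(v, a), ha⟩
    have hkey : ∀ x, G.sidePoint h (G.sideNext s x) = v →
        (Q' (G.sidePoint h x) ↔ Q' (G.sidePoint h (G.sideNext s (G.sideNext s x)))) := by
      intro x hx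
      have h1 := hQ x (by rw [toComplex_tgt, hx])
      have h2 : ∀ (e : G.graph.edgeSet) (a : V), e.1 = s(v, a) → (Q e ↔ Q' a) := by
        rintro ⟨e, he⟩ a rfl
        exact ⟨fun hq => ⟨he, hq⟩, fun ⟨_, hq⟩ => hq⟩
      rwa [h2 _ (G.sidePoint h x) (by rw [toComplex_edge, hx, Sym2.eq_swap]),
        h2 _ (G.sidePoint h (G.sideNext s (G.sideNext s x)))
          (by
            rw [toComplex_edge]
            change s(G.sidePoint h (G.sideNext s x), _) = _
            rw [hx]; rfl)] at h1
    have hiff := G.iff_of_link_connected (hP.link_connected v) Q'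
      (by
        intro a b hab hf
        obtain ⟨i, h1, h2⟩ := exists_corner hf
        have h3 := hkey (Sum.inl (⟨_, hf⟩, i)) h1
        change Q' (G.faceVertex ⟨_, hf⟩ i) ↔ Q' (G.faceVertex ⟨_, hf⟩ (i + 1 + 1)) at h3
        rcases h2 with ⟨h4, h5⟩ | ⟨h4, h5⟩
        · rwa [h4, h5] at h3
        · rw [h4, h5] at h3; exact h3.symm)
      (by
        intro i hi
        have h3 := hkey (Sum.inr i) hi
        change Q' (h i) ↔ Q' (h (i + 1 + 1)) at h3
        rwa [add_assoc, one_add_one_eq_two] at h3)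
    rw [toComplex_end_iff] at he he'
    obtain ⟨a, ha⟩ := Sym2.mem_iff_exists.1 he
    obtain ⟨b, hb⟩ := Sym2.mem_iff_exists.1 he'
    obtain ⟨e, hee⟩ := e
    obtain ⟨e', hee'⟩ := e'
    simp only at ha hb
    subst ha; subst hb
    exact ((hiff a b hee hee').1 ⟨hee, hQe⟩).2
  cell_trans Q hQ x y hxy hx := by
    rcases x with ⟨t, i⟩ | i <;> rcases y with ⟨t', j⟩ | j
    · obtain rfl : t = t' := Option.some_injective _ hxy
      have h1 := (hQ (Sum.inl (t, i))).1 hx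
      have h2 := (hQ _).1 h1
      rcases fin_three_cases i j with rfl | rfl | rfl
      · exact hx
      · exact h1
      · exact h2
    · cases hxy
    · cases hxy
    · exact zmod_induction (fun i => Q (Sum.inr i)) (fun i => hQ (Sum.inr i)) i j hx
  cell_surj c := by
    rcases c with _ | t
    · exact ⟨Sum.inr 0, rfl⟩
    · exact ⟨Sum.inl (t, 0), rfl⟩
  nonempty := ⟨none⟩
  euler := by
    have h1 := hP.euler
    rw [Set.ncard_eq_toFinset_card', Set.toFinset_card] at h1
    simp only [Fintype.card_option, Fintype.card_coe]
    omega

theorem freedom_top : freedom (⊤ : G.graph.Subgraph) =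
    3 * (Fintype.card V : ℤ) - Fintype.card G.graph.edgeSet := by
  rw [freedom, SimpleGraph.Subgraph.verts_top, SimpleGraph.Subgraph.edgeSet_top, Set.ncard_univ,
    Nat.card_eq_fintype_card, Set.ncard_eq_toFinset_card', Set.toFinset_card]

/-- By double counting of the sides, the Maxwell count determines the length of the hole. -/
theorem IsProjectiveWithHole.length_eq_iff [NeZero s] (hP : G.IsProjectiveWithHole h) :
    freedom (⊤ : G.graph.Subgraph) = 6 ↔ s = 6 := by
  have h1 := hP.toComplex_isProjective.card_sides
  have h2 := hP.toComplex_isProjective.euler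
  simp only [Fintype.card_sum, Fintype.card_prod, Fintype.card_coe, Fintype.card_fin, ZMod.card,
    Fintype.card_option] at h1 h2
  rw [freedom_top]
  omega

theorem IsProjectiveWithHole.toComplex_isHoled {h : ZMod 6 → V} (hP : G.IsProjectiveWithHole h) :
    (G.toComplex hP.hole_adj).IsHoled none where
  card_face c hc := by
    obtain ⟨t, rfl⟩ := Option.ne_none_iff_exists'.1 hc
    have : (Finset.univ.filter fun x => (G.toComplex hP.hole_adj).cell x = some t)
        = (Finset.univ.image fun i : Fin 3 => Sum.inl (t, i)) := by
      ext x
      rw [Finset.mem_filter_univ]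
      rcases x with ⟨t', i⟩ | i
      · simp [toComplex, eq_comm]
      · simp [toComplex]
    rw [this, Finset.card_image_of_injective _ (fun i j hij => by simpa using hij)]
    rfl
  card_hole := by
    have : (Finset.univ.filter fun x => (G.toComplex hP.hole_adj).cell x = none)
        = (Finset.univ.image fun i : ZMod 6 => Sum.inr i) := by
      ext x
      rw [Finset.mem_filter_univ]
      rcases x with ⟨t', i⟩ | i
      · simp [toComplex]
      · simp [toComplex]
    rw [this, Finset.card_image_of_injective _ Sum.inr_injective]
    rfl
  corner x hx := by
    rcases x with ⟨t, i⟩ | i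
    · intro heq
      exact fin_three_ne_succ i (G.faceVertex_side_unique t (Subtype.ext_iff.1 heq)).symm
    · exact absurd rfl hx
  simple e e' hee := by
    apply Subtype.ext
    rw [← G.toComplex_mk_eq hP.hole_adj e, ← G.toComplex_mk_eq hP.hole_adj e', Sym2.eq_iff]
    exact hee

theorem toComplex_isSparse_iff (hadj : ∀ i, G.graph.Adj (h i) (h (i + 1))) :
    (G.toComplex hadj).IsSparse ↔ IsSparse36 G.graph := by
  classical
  constructor
  · intro hS H hH
    have h1 := hS H.verts.toFinset (Finset.univ.filter fun e => e.1 ∈ H.edgeSet)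
      (by
        intro e he
        have he' := (Finset.mem_filter.1 he).2
        rw [← G.toComplex_mk_eq hadj e] at he'
        rw [Set.mem_toFinset, Set.mem_toFinset]
        exact ⟨H.edge_vert he', H.edge_vert he'.symm⟩)
      (by rwa [← Set.ncard_eq_toFinset_card'])
    have h2 : (Finset.univ.filter fun e : G.graph.edgeSet => e.1 ∈ H.edgeSet).card
        = H.edgeSet.ncard := by
      rw [Set.ncard_eq_toFinset_card']
      refine Finset.card_bij (fun e _ => e.1) ?_ ?_ ?_
      · intro e he; simpa using he
      · intro e _ e' _ hee; exact Subtype.ext hee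
      · intro e he
        have he' := Set.mem_toFinset.1 he
        exact ⟨⟨e, H.edgeSet_subset he'⟩, by simpa using he', rfl⟩
    rw [h2, ← Set.ncard_eq_toFinset_card'] at h1
    rw [freedom]
    omega
  · intro hS A B hB hA
    let H : G.graph.Subgraph :=
      { verts := A
        Adj := fun u v => ∃ e ∈ B, e.1 = s(u, v)
        adj_sub := by
          rintro u v ⟨e, -, he⟩
          have := e.2
          rwa [he] at this
        edge_vert := by
          rintro u v ⟨e, heB, he⟩
          have hu : u ∈ e.1 := by rw [he]; exact Sym2.mem_mk_left u v
          rcases (G.toComplex_end_iff hadj e u).2 hu with rfl | rfl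
          · exact (hB e heB).1
          · exact (hB e heB).2
        symm := ⟨by
          rintro u v ⟨e, heB, he⟩
          exact ⟨e, heB, he.trans Sym2.eq_swap⟩⟩ }
    have hE : H.edgeSet = Subtype.val '' (B : Set G.graph.edgeSet) := by
      ext e
      induction e using Sym2.ind with
      | _ u v =>
        rw [SimpleGraph.Subgraph.mem_edgeSet]
        rfl
    have h1 := hS H (by rw [show H.verts = (A : Set V) from rfl, Set.ncard_coe_finset]; exact hA)
    rw [freedom, hE, Set.ncard_image_of_injective _ Subtype.val_injective, Set.ncard_coe_finset,
      Set.ncard_coe_finset] at h1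
    omega

end

/-! ### Colourings modulo three -/

/-- A colouring of the vertices modulo three such that each facial 3-cycle has two vertices of the
same colour, and the colour increases by one along each side of the hole. -/
structure IsCertificate (G : FacedGraph V) (h : ZMod 6 → V) (κ : V → ZMod 3) : Prop where
  face : ∀ t ∈ G.faces, ∃ u ∈ t, ∃ v ∈ t, u ≠ v ∧ κ u = κ v
  hole : ∀ i, κ (h (i + 1)) = κ (h i) + 1

section

variable {G : FacedGraph V} {h : ZMod 6 → V}

theorem cobd_none [Fintype G.graph.edgeSet] (hadj : ∀ i, G.graph.Adj (h i) (h (i + 1)))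
    (w : G.graph.edgeSet → ℤ) : (G.toComplex hadj).cobd w none =
      ∑ i : ZMod 6, (G.toComplex hadj).sgn (Sum.inr i) *
        w ((G.toComplex hadj).edge (Sum.inr i)) := by
  rw [PolyComplex.cobd]
  refine (Finset.sum_bij (fun i _ => Sum.inr i) ?_ ?_ ?_ ?_).symm
  · intro i _; exact Finset.mem_filter.2 ⟨Finset.mem_univ _, rfl⟩
  · intro i _ j _ hij; exact Sum.inr_injective hij
  · rintro (⟨t, i⟩ | i) hx
    · cases (Finset.mem_filter.1 hx).2
    · exact ⟨i, Finset.mem_univ _, rfl⟩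
  · intro i _; simp

theorem cobd_some [Fintype G.graph.edgeSet] (hadj : ∀ i, G.graph.Adj (h i) (h (i + 1)))
    (w : G.graph.edgeSet → ℤ) (t : G.faces) : (G.toComplex hadj).cobd w (some t) =
      ∑ i : Fin 3, (G.toComplex hadj).sgn (Sum.inl (t, i)) *
        w ((G.toComplex hadj).edge (Sum.inl (t, i))) := by
  rw [PolyComplex.cobd]
  refine (Finset.sum_bij (fun i _ => Sum.inl (t, i)) ?_ ?_ ?_ ?_).symm
  · intro i _; exact Finset.mem_filter.2 ⟨Finset.mem_univ _, rfl⟩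
  · intro i _ j _ hij
    exact (Prod.ext_iff.1 (Sum.inl_injective hij)).2
  · rintro (⟨t', i⟩ | i) hx
    · obtain rfl : t' = t := Option.some_injective _ (Finset.mem_filter.1 hx).2
      exact ⟨i, Finset.mem_univ _, rfl⟩
    · cases (Finset.mem_filter.1 hx).2
  · intro i _; simp

/-- A colouring modulo three gives a form with values `-1`, `0`, `1`. -/
noncomputable def colourForm [Fintype G.graph.edgeSet] (hadj : ∀ i, G.graph.Adj (h i) (h (i + 1)))
    (κ : V → ZMod 3) (e : G.graph.edgeSet) : ℤ := ((G.toComplex hadj).grad κ e).valMinAbs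

theorem sgn_mul_colourForm [Fintype G.graph.edgeSet]
    (hadj : ∀ i, G.graph.Adj (h i) (h (i + 1))) (κ : V → ZMod 3) (x) :
    (G.toComplex hadj).sgn x * colourForm hadj κ ((G.toComplex hadj).edge x)
      = (κ (G.sidePoint h (G.sideNext 6 x)) - κ (G.sidePoint h x)).valMinAbs := by
  have h1 := (G.toComplex hadj).sgn_mul_grad (G.toComplex_sgn_eq hadj x) κ
  have hneg : ∀ a : ZMod 3, -a.valMinAbs = (-a).valMinAbs := by decide
  rw [toComplex_src, toComplex_tgt] at h1
  rw [← h1, colourForm]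
  rcases G.toComplex_sgn_eq hadj x with h2 | h2
  · rw [h2]; simp
  · rw [h2]
    simp [hneg]

theorem IsCertificate.cobd_colourForm [Fintype G.graph.edgeSet] {κ : V → ZMod 3}
    (hκ : G.IsCertificate h κ) (hadj : ∀ i, G.graph.Adj (h i) (h (i + 1))) (c : Option G.faces) :
    (G.toComplex hadj).cobd (colourForm hadj κ) c = if c = none then 6 else 0 := by
  rcases c with _ | t
  · rw [cobd_none, if_pos rfl]
    have : ∀ i : ZMod 6, (G.toComplex hadj).sgn (Sum.inr i) *
        colourForm hadj κ ((G.toComplex hadj).edge (Sum.inr i)) = 1 := by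
      intro i
      rw [sgn_mul_colourForm]
      change (κ (h (i + 1)) - κ (h i)).valMinAbs = 1
      rw [hκ.hole, add_sub_cancel_left]
      decide
    simp [this]
  · rw [cobd_some, if_neg (by simp)]
    obtain ⟨u, hu, v, hv, huv, huv'⟩ := hκ.face t.1 t.2
    simp only [sgn_mul_colourForm, Fin.sum_univ_three]
    change (κ (G.faceVertex t 1) - κ (G.faceVertex t 0)).valMinAbs +
      (κ (G.faceVertex t 2) - κ (G.faceVertex t 1)).valMinAbs +
      (κ (G.faceVertex t 0) - κ (G.faceVertex t 2)).valMinAbs = 0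
    have hdec : ∀ a b c : ZMod 3, (a = b ∨ b = c ∨ a = c) →
      (b - a).valMinAbs + (c - b).valMinAbs + (a - c).valMinAbs = 0 := by decide
    apply hdec
    obtain ⟨i, rfl⟩ := G.exists_faceVertex t hu
    obtain ⟨j, rfl⟩ := G.exists_faceVertex t hv
    have hij : i ≠ j := fun hh => huv (by rw [hh])
    fin_cases i <;> fin_cases j <;> simp_all

theorem abs_colourForm_le [Fintype G.graph.edgeSet] (hadj : ∀ i, G.graph.Adj (h i) (h (i + 1)))
    (κ : V → ZMod 3) (e : G.graph.edgeSet) : |colourForm hadj κ e| ≤ 1 := by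
  have : ∀ a : ZMod 3, |a.valMinAbs| ≤ 1 := by decide
  exact this _

theorem colourForm_eq_zero [Fintype G.graph.edgeSet] (hadj : ∀ i, G.graph.Adj (h i) (h (i + 1)))
    {κ : V → ZMod 3} {u v : V} (huv : G.graph.Adj u v) (hκ : κ u = κ v) :
    colourForm hadj κ ⟨s(u, v), huv⟩ = 0 := by
  rw [colourForm, PolyComplex.grad, ZMod.valMinAbs_eq_zero, sub_eq_zero]
  rcases Sym2.eq_iff.1 (G.toComplex_mk_eq hadj ⟨s(u, v), huv⟩) with ⟨h2, h3⟩ | ⟨h2, h3⟩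
  · rw [h2, h3, hκ]
  · rw [h2, h3, hκ]

theorem IsProjectiveWithHole.isTight36_of_isCertificate (hP : G.IsProjectiveWithHole h)
    {κ : V → ZMod 3} (hκ : G.IsCertificate h κ) : IsTight36 G.graph := by
  classical
  have : Fintype G.graph.edgeSet := Fintype.ofFinite _
  refine ⟨(toComplex_isSparse_iff hP.hole_adj).1 ?_, hP.length_eq_iff.2 rfl⟩
  exact hP.toComplex_isProjective.isSparse_of_form hP.toComplex_isHoled (colourForm hP.hole_adj κ)
    (abs_colourForm_le _ κ) (hκ.cobd_colourForm _)

theorem IsProjectiveWithHole.exists_isCertificate (hP : G.IsProjectiveWithHole h)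
    (ht : IsTight36 G.graph) : ∃ κ, G.IsCertificate h κ := by
  classical
  have : Fintype G.graph.edgeSet := Fintype.ofFinite _
  have htop := ht.2
  rw [freedom_top] at htop
  obtain ⟨p, w, h1, h2⟩ := hP.toComplex_isProjective.exists_form hP.toComplex_isHoled
    ((toComplex_isSparse_iff hP.hole_adj).2 ht.1) (by omega)
  let d : (G.faces × Fin 3) ⊕ ZMod 6 → ℤ := fun x => (G.toComplex hP.hole_adj).sgn x *
    ((G.toComplex hP.hole_adj).grad p ((G.toComplex hP.hole_adj).edge x) +
      3 * w ((G.toComplex hP.hole_adj).edge x))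
  have hd1 : ∀ x, |d x| ≤ 1 := by
    intro x
    have := h1 ((G.toComplex hP.hole_adj).edge x)
    rcases G.toComplex_sgn_eq hP.hole_adj x with h3 | h3
    · simpa [d, h3] using this
    · simp only [d, h3, neg_one_mul, abs_neg]; exact this
  have hd2 : ∀ x, (d x : ZMod 3) = (p (G.sidePoint h (G.sideNext 6 x)) : ZMod 3)
      - (p (G.sidePoint h x) : ZMod 3) := by
    intro x
    have h3 := (G.toComplex hP.hole_adj).sgn_mul_grad (G.toComplex_sgn_eq hP.hole_adj x) p
    rw [toComplex_src, toComplex_tgt] at h3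
    have h4 : d x = (p (G.sidePoint h (G.sideNext 6 x)) - p (G.sidePoint h x)) +
        3 * ((G.toComplex hP.hole_adj).sgn x * w ((G.toComplex hP.hole_adj).edge x)) := by
      rw [← h3]
      simp only [d, Int.cast_id]
      ring
    rw [h4]
    push_cast
    have : (3 : ZMod 3) = 0 := by decide
    rw [this]
    ring
  refine ⟨fun v => (p v : ZMod 3), ?_, ?_⟩
  · intro t ht
    have h3 := h2 (some ⟨t, ht⟩)
    rw [cobd_some, if_neg (by simp), Fin.sum_univ_three] at h3
    change d (Sum.inl (⟨t, ht⟩, 0)) + d (Sum.inl (⟨t, ht⟩, 1)) + d (Sum.inl (⟨t, ht⟩, 2)) = 0 at h3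
    -- three numbers `1` or `-1` do not have the sum zero
    have hz : ∃ i : Fin 3, d (Sum.inl (⟨t, ht⟩, i)) = 0 := by
      have a0 := abs_le.1 (hd1 (Sum.inl (⟨t, ht⟩, 0)))
      have a1 := abs_le.1 (hd1 (Sum.inl (⟨t, ht⟩, 1)))
      have a2 := abs_le.1 (hd1 (Sum.inl (⟨t, ht⟩, 2)))
      by_contra! hne
      have b0 := hne 0
      have b1 := hne 1
      have b2 := hne 2
      omega
    obtain ⟨i, hi⟩ := hz
    have h4 := hd2 (Sum.inl (⟨t, ht⟩, i))
    rw [hi, Int.cast_zero] at h4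
    exact ⟨_, G.faceVertex_mem ⟨t, ht⟩ i, _, G.faceVertex_mem ⟨t, ht⟩ (i + 1),
      (G.faceVertex_adj _ i).ne, (sub_eq_zero.1 h4.symm).symm⟩
  · intro i
    have h3 := h2 none
    rw [cobd_none, if_pos rfl] at h3
    change ∑ i : ZMod 6, d (Sum.inr i) = 6 at h3
    -- six numbers, each at most one, with the sum six
    have hone : d (Sum.inr i) = 1 := by
      by_contra hne
      have hle : ∀ j : ZMod 6, d (Sum.inr j) ≤ 1 := fun j => (abs_le.1 (hd1 _)).2
      have hlt : ∑ j : ZMod 6, d (Sum.inr j) < ∑ _j : ZMod 6, (1 : ℤ) :=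
        Finset.sum_lt_sum (fun j _ => hle j) ⟨i, Finset.mem_univ _, lt_of_le_of_ne (hle i) hne⟩
      rw [h3] at hlt
      simp at hlt
    have h4 := hd2 (Sum.inr i)
    rw [hone, Int.cast_one] at h4
    change (1 : ZMod 3) = (p (h (i + 1)) : ZMod 3) - (p (h i) : ZMod 3) at h4
    change (p (h (i + 1)) : ZMod 3) = (p (h i) : ZMod 3) + 1
    rw [h4]
    ring

end

/-! ### Contraction of an edge -/

theorem card_sides_of_two_sides (G : FacedGraph V) {s : ℕ} [NeZero s] {h : ZMod s → V}
    [Fintype G.graph.edgeSet] (hadj : ∀ i, G.graph.Adj (h i) (h (i + 1)))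
    (h2 : ∀ u v, G.graph.Adj u v → G.faceCount u v + holeCount h u v = 2) :
    3 * G.faces.card + s = 2 * Fintype.card G.graph.edgeSet := by
  have h1 := Finset.card_eq_sum_card_fiberwise (s := (Finset.univ :
    Finset ((G.faces × Fin 3) ⊕ ZMod s))) (t := Finset.univ) (f := (G.toComplex hadj).edge)
    (fun _ _ => Finset.mem_coe.2 (Finset.mem_univ _))
  rw [Finset.sum_congr rfl (g := fun _ => 2)] at h1
  · simp only [Finset.card_univ, Fintype.card_sum, Fintype.card_prod, Fintype.card_coe,
      Fintype.card_fin, ZMod.card, Finset.sum_const, smul_eq_mul] at h1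
    omega
  · rintro ⟨e, he⟩ _
    induction e using Sym2.ind with
    | _ u v =>
      have h3 := G.card_sides_eq hadj he
      rw [h2 u v he] at h3
      convert h3

section mergeMap

variable {v w : V} (hvw : v ≠ w)

theorem mergeMap_left : mergeMap hvw v = ⟨v, hvw⟩ := by simp [mergeMap, hvw]

theorem mergeMap_right : mergeMap hvw w = ⟨v, hvw⟩ := by simp [mergeMap]

theorem mergeMap_of_ne {x : V} (hx : x ≠ w) : mergeMap hvw x = ⟨x, hx⟩ := by simp [mergeMap, hx]

theorem mergeMap_coe (a : {x : V // x ≠ w}) : mergeMap hvw a.1 = a := mergeMap_of_ne hvw a.2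

theorem mergeMap_eq_iff' {x : V} {a : {x : V // x ≠ w}} :
    mergeMap hvw x = a ↔ x = a.1 ∨ (x = w ∧ a.1 = v) := by
  constructor
  · rintro rfl
    by_cases hx : x = w
    · subst hx; right; simp [mergeMap]
    · left; simp [mergeMap, hx]
  · rintro (rfl | ⟨rfl, ha⟩)
    · exact mergeMap_coe hvw a
    · rw [mergeMap_right]; exact Subtype.ext ha.symm

theorem mem_image_mergeMap {t : Finset V} {a : {x : V // x ≠ w}} :
    a ∈ t.image (mergeMap hvw) ↔ a.1 ∈ t ∨ (a.1 = v ∧ w ∈ t) := by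
  rw [Finset.mem_image]
  constructor
  · rintro ⟨x, hx, hxa⟩
    rcases (mergeMap_eq_iff' hvw).1 hxa with rfl | ⟨rfl, ha⟩
    · exact Or.inl hx
    · exact Or.inr ⟨ha, hx⟩
  · rintro (ha | ⟨ha, hw⟩)
    · exact ⟨a.1, ha, mergeMap_coe hvw a⟩
    · exact ⟨w, hw, (mergeMap_eq_iff' hvw).2 (Or.inr ⟨rfl, ha⟩)⟩

end mergeMap

section

variable {G : FacedGraph V} {s : ℕ} {h : ZMod s → V} {v w : V} (hvw : v ≠ w)

theorem contract_adj {a b : {x : V // x ≠ w}} :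
    (G.contract hvw).graph.Adj a b ↔
      a ≠ b ∧ ∃ x y, mergeMap hvw x = a ∧ mergeMap hvw y = b ∧ G.graph.Adj x y := by
  rw [contract, SimpleGraph.fromRel_adj]
  refine and_congr_right fun _ => ⟨?_, Or.inl⟩
  rintro (hh | ⟨x, y, h1, h2, h3⟩)
  · exact hh
  · exact ⟨y, x, h2, h1, h3.symm⟩

theorem mem_contract_faces {t : Finset {x : V // x ≠ w}} : t ∈ (G.contract hvw).faces ↔
    ∃ t₀ ∈ G.faces, ¬ (v ∈ t₀ ∧ w ∈ t₀) ∧ t₀.image (mergeMap hvw) = t := by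
  simp only [contract, Finset.mem_image, Finset.mem_filter, and_assoc]

theorem holeCount_pos_iff [NeZero s] {u v : V} :
    0 < holeCount h u v ↔ ∃ i, s(h i, h (i + 1)) = s(u, v) := by
  rw [holeCount, Set.ncard_pos (Set.toFinite _)]
  rfl

theorem IsFF.holeCount_eq_zero (hP : G.IsProjectiveWithHole h) (hF : G.IsFF v w) :
    holeCount h v w = 0 := by
  have h1 := hP.two_sides v w hF.1
  have h2 := hF.2
  omega

theorem IsFF.sym2_ne [NeZero s] (hP : G.IsProjectiveWithHole h) (hF : G.IsFF v w) (i : ZMod s) :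
    s(h i, h (i + 1)) ≠ s(v, w) := by
  intro hi
  have h1 := holeCount_pos_iff.2 ⟨i, hi⟩
  rw [hF.holeCount_eq_zero hP] at h1
  exact lt_irrefl _ h1

/-- A facial 3-cycle with two given vertices, by its third vertex. -/
theorem exists_third {t : Finset V} (ht : t ∈ G.faces) {u v : V} (huv : u ≠ v) (hu : u ∈ t)
    (hv : v ∈ t) : ∃ x, t = {u, v, x} := by
  have h3 := (G.isNClique_of_mem t ht).card_eq
  have h1 : ((t.erase u).erase v).card = 1 := by
    rw [Finset.card_erase_of_mem (Finset.mem_erase.2 ⟨huv.symm, hv⟩), Finset.card_erase_of_mem hu,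
      h3]
  obtain ⟨x, hx⟩ := Finset.card_eq_one.1 h1
  refine ⟨x, ?_⟩
  rw [← hx, Finset.insert_erase (Finset.mem_erase.2 ⟨huv.symm, hv⟩), Finset.insert_erase hu]

/-- The two facial 3-cycles on an `FF` edge. -/
theorem IsFF.exists_faces (hF : G.IsFF v w) : ∃ x y, x ≠ y ∧ ({v, w, x} : Finset V) ∈ G.faces ∧
    ({v, w, y} : Finset V) ∈ G.faces ∧
    ∀ t ∈ G.faces, v ∈ t → w ∈ t → t = {v, w, x} ∨ t = {v, w, y} := by
  obtain ⟨t, t', htt, hfil⟩ := Finset.card_eq_two.1 hF.2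
  have ht : t ∈ G.faces.filter fun t => v ∈ t ∧ w ∈ t := by rw [hfil]; simp
  have ht' : t' ∈ G.faces.filter fun t => v ∈ t ∧ w ∈ t := by rw [hfil]; simp
  obtain ⟨h1, h2, h3⟩ := Finset.mem_filter.1 ht
  obtain ⟨h1', h2', h3'⟩ := Finset.mem_filter.1 ht'
  obtain ⟨x, rfl⟩ := exists_third h1 hF.1.ne h2 h3
  obtain ⟨y, rfl⟩ := exists_third h1' hF.1.ne h2' h3'
  refine ⟨x, y, fun hxy => htt (by rw [hxy]), h1, h1', fun t ht hv hw => ?_⟩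
  have : t ∈ G.faces.filter fun t => v ∈ t ∧ w ∈ t := Finset.mem_filter.2 ⟨ht, hv, hw⟩
  rw [hfil] at this
  simpa using this

theorem adj_of_mem_faces {t : Finset V} (ht : t ∈ G.faces) {a b : V} (ha : a ∈ t) (hb : b ∈ t)
    (hab : a ≠ b) : G.graph.Adj a b := (G.isNClique_of_mem t ht).isClique ha hb hab

theorem IsContractible.mem_faces (hc : G.IsContractible v w) {a : V} (h1 : G.graph.Adj v a)
    (h2 : G.graph.Adj w a) : ({v, w, a} : Finset V) ∈ G.faces := by
  by_contra hn
  exact hc.2 ⟨hc.1.1, a, h1, h2, hn⟩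

theorem faceCount_comm (G : FacedGraph V) (u v : V) : G.faceCount u v = G.faceCount v u := by
  simp only [faceCount, and_comm]

theorem holeCount_comm (h : ZMod s → V) (u v : V) : holeCount h u v = holeCount h v u := by
  simp only [holeCount, Sym2.eq_swap (a := u)]

/-- The four triangles of a tetrahedron form a closed surface, so they cannot all be facial. -/
theorem IsProjectiveWithHole.not_tetrahedron [NeZero s] (hP : G.IsProjectiveWithHole h)
    (K : Finset V) (hK : 4 ≤ K.card) (hKF : ∀ t ⊆ K, t.card = 3 → t ∈ G.faces) : False := by
  classical
  have : Fintype G.graph.edgeSet := Fintype.ofFinite _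
  have hside : ∀ u v, u ∈ K → v ∈ K → G.graph.Adj u v →
      holeCount h u v = 0 ∧ ∀ t ∈ G.faces, u ∈ t → v ∈ t → t ⊆ K := by
    intro u v hu hv huv
    have h2 := hP.two_sides u v huv
    have hc : 2 ≤ ((K.erase u).erase v).card := by
      rw [Finset.card_erase_of_mem (Finset.mem_erase.2 ⟨huv.ne', hv⟩), Finset.card_erase_of_mem hu]
      omega
    obtain ⟨x, hx, y, hy, hxy⟩ := Finset.one_lt_card.1 hc
    simp only [Finset.mem_erase] at hx hy
    have hsub : ({{u, v, x}, {u, v, y}} : Finset (Finset V)) ⊆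
        G.faces.filter fun t => u ∈ t ∧ v ∈ t := by
      intro t ht
      have hcard : ∀ z, z ≠ v ∧ z ≠ u ∧ z ∈ K → ({u, v, z} : Finset V) ∈ G.faces := by
        rintro z ⟨h1, h2, h3⟩
        refine hKF _ ?_ (Finset.card_eq_three.2 ⟨u, v, z, huv.ne, h2.symm, h1.symm, rfl⟩)
        intro z' hz'
        simp only [Finset.mem_insert, Finset.mem_singleton] at hz'
        rcases hz' with rfl | rfl | rfl <;> assumption
      simp only [Finset.mem_insert, Finset.mem_singleton] at ht
      rcases ht with rfl | rfl
      · exact Finset.mem_filter.2 ⟨hcard x hx, by simp⟩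
      · exact Finset.mem_filter.2 ⟨hcard y hy, by simp⟩
    have htwo : ({{u, v, x}, {u, v, y}} : Finset (Finset V)).card = 2 := by
      refine Finset.card_pair fun heq => ?_
      have : x ∈ ({u, v, y} : Finset V) := by rw [← heq]; simp
      simp only [Finset.mem_insert, Finset.mem_singleton] at this
      tauto
    have hle := Finset.card_le_card hsub
    rw [htwo] at hle
    change 2 ≤ G.faceCount u v at hle
    refine ⟨by omega, fun t ht h1 h2 => ?_⟩
    have heq := Finset.eq_of_subset_of_card_le hsub
      (by rw [htwo]; change G.faceCount u v ≤ 2; omega)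
    have hmem : t ∈ G.faces.filter fun t => u ∈ t ∧ v ∈ t := Finset.mem_filter.2 ⟨ht, h1, h2⟩
    rw [← heq] at hmem
    simp only [Finset.mem_insert, Finset.mem_singleton] at hmem
    rcases hmem with rfl | rfl <;>
    · intro z hz
      simp only [Finset.mem_insert, Finset.mem_singleton] at hz
      rcases hz with rfl | rfl | rfl <;> tauto
  obtain ⟨t, htK, ht3⟩ := Finset.exists_subset_card_eq (show 3 ≤ K.card by omega)
  have htF := hKF t htK ht3
  have hclosed : ∀ x y, (G.toComplex hP.hole_adj).edge x = (G.toComplex hP.hole_adj).edge y →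
      (∃ t : G.faces, (G.toComplex hP.hole_adj).cell x = some t ∧ t.1 ⊆ K) →
      (∃ t : G.faces, (G.toComplex hP.hole_adj).cell y = some t ∧ t.1 ⊆ K) := by
    rintro x y hxy ⟨t, ht, htK⟩
    rcases x with ⟨t₁, i⟩ | i
    · obtain rfl : t₁ = t := Option.some_injective _ ht
      have h1 := hside _ _ (htK (G.faceVertex_mem t₁ i)) (htK (G.faceVertex_mem t₁ (i + 1)))
        (G.faceVertex_adj t₁ i)
      have h2 : s(G.faceVertex t₁ i, G.faceVertex t₁ (i + 1)) =
        s(G.sidePoint h y, G.sidePoint h (G.sideNext s y)) := congrArg Subtype.val hxy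
      rcases y with ⟨t₂, j⟩ | j
      · refine ⟨t₂, rfl, h1.2 t₂.1 t₂.2 ?_ ?_⟩
        · rcases Sym2.eq_iff.1 h2 with ⟨h3, h4⟩ | ⟨h3, h4⟩ <;> rw [h3] <;>
            exact G.faceVertex_mem _ _
        · rcases Sym2.eq_iff.1 h2 with ⟨h3, h4⟩ | ⟨h3, h4⟩ <;> rw [h4] <;>
            exact G.faceVertex_mem _ _
      · have h3 := holeCount_pos_iff.2 ⟨j, h2.symm⟩
        omega
    · cases ht
  obtain ⟨t', ht', -⟩ := hP.toComplex_isProjective.dual_conn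
    (fun c => ∃ t : G.faces, c = some t ∧ t.1 ⊆ K)
    (fun x y hxy => ⟨hclosed x y hxy, hclosed y x hxy.symm⟩) (some ⟨t, htF⟩) none
    ⟨_, rfl, htK⟩
  cases ht'

/-- The faces that survive a contraction are not identified with each other. -/
theorem image_mergeMap_injOn [NeZero s] (hP : G.IsProjectiveWithHole h)
    (hc : G.IsContractible v w) : Set.InjOn (fun t : Finset V => t.image (mergeMap hvw))
      (G.faces.filter fun t => ¬ (v ∈ t ∧ w ∈ t)) := by
  classical
  -- Two faces with the same image are `vab` and `wab`; then `vwa` and `vwb` are faces as well.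
  have hex : ∀ t ∈ G.faces, ∀ t' ∈ G.faces, ¬ (v ∈ t ∧ w ∈ t) → ¬ (v ∈ t' ∧ w ∈ t') →
      t.image (mergeMap hvw) = t'.image (mergeMap hvw) → v ∈ t → w ∉ t' → t = t' := by
    intro t ht t' ht' hn hn' heq hv hw'
    refine Finset.eq_of_subset_of_card_le ?_ (by
      rw [(G.isNClique_of_mem t ht).card_eq, (G.isNClique_of_mem t' ht').card_eq])
    intro a ha
    have haw : a ≠ w := by rintro rfl; exact hn ⟨hv, ha⟩
    have h1 : (⟨a, haw⟩ : {x // x ≠ w}) ∈ t.image (mergeMap hvw) :=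
      (mem_image_mergeMap hvw).2 (Or.inl ha)
    rw [heq, mem_image_mergeMap] at h1
    exact h1.resolve_right fun h => hw' h.2
  have hex2 : ∀ t ∈ G.faces, ∀ t' ∈ G.faces, ¬ (v ∈ t ∧ w ∈ t) → ¬ (v ∈ t' ∧ w ∈ t') →
      t.image (mergeMap hvw) = t'.image (mergeMap hvw) → v ∈ t → w ∈ t' → False := by
    intro t ht t' ht' hn hn' heq hv hw'
    have hcard := (G.isNClique_of_mem t ht).card_eq
    obtain ⟨a, b, hab, htab⟩ := Finset.card_eq_two.1
      (show (t.erase v).card = 2 by rw [Finset.card_erase_of_mem hv, hcard])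
    have htt : t = {v, a, b} := by rw [← htab, Finset.insert_erase hv]
    have hmem : ∀ z, z ∈ t.erase v → z ∈ t' ∧ z ≠ v ∧ z ≠ w ∧ G.graph.Adj v z ∧
        G.graph.Adj w z := by
      intro z hz
      obtain ⟨hzv, hzt⟩ := Finset.mem_erase.1 hz
      have hzw : z ≠ w := by rintro rfl; exact hn ⟨hv, hzt⟩
      have h1 : (⟨z, hzw⟩ : {x // x ≠ w}) ∈ t.image (mergeMap hvw) :=
        (mem_image_mergeMap hvw).2 (Or.inl hzt)
      rw [heq, mem_image_mergeMap] at h1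
      have hzt' := h1.resolve_right fun h => hzv h.1
      exact ⟨hzt', hzv, hzw, adj_of_mem_faces ht hv hzt hzv.symm,
        adj_of_mem_faces ht' hw' hzt' hzw.symm⟩
    obtain ⟨a1, a2, a3, a4, a5⟩ := hmem a (by rw [htab]; simp)
    obtain ⟨b1, b2, b3, b4, b5⟩ := hmem b (by rw [htab]; simp)
    have htt' : t' = {w, a, b} := by
      refine (Finset.eq_of_subset_of_card_le ?_ ?_).symm
      · intro z hz
        simp only [Finset.mem_insert, Finset.mem_singleton] at hz
        rcases hz with rfl | rfl | rfl <;> assumption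
      · rw [(G.isNClique_of_mem t' ht').card_eq,
          Finset.card_eq_three.2 ⟨w, a, b, a3.symm, b3.symm, hab, rfl⟩]
    have hfa := hc.mem_faces a4 a5
    have hfb := hc.mem_faces b4 b5
    refine hP.not_tetrahedron {v, w, a, b} ?_ ?_
    · rw [Finset.card_insert_of_notMem (by simp [hvw, a2.symm, b2.symm]),
        Finset.card_eq_three.2 ⟨w, a, b, a3.symm, b3.symm, hab, rfl⟩]
    · intro r hr hr3
      have hK4 : ({v, w, a, b} : Finset V).card = 4 := by
        rw [Finset.card_insert_of_notMem (by simp [hvw, a2.symm, b2.symm]),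
          Finset.card_eq_three.2 ⟨w, a, b, a3.symm, b3.symm, hab, rfl⟩]
      obtain ⟨z, hz⟩ := Finset.card_eq_one.1
        (show (({v, w, a, b} : Finset V) \ r).card = 1 by
          rw [Finset.card_sdiff_of_subset hr, hK4, hr3])
      have hr' : r = ({v, w, a, b} : Finset V).erase z := by
        rw [← Finset.sdiff_singleton_eq_erase, ← hz, Finset.sdiff_sdiff_eq_self hr]
      have hzK : z ∈ ({v, w, a, b} : Finset V) := by
        have : z ∈ ({v, w, a, b} : Finset V) \ r := by rw [hz]; simp
        exact (Finset.mem_sdiff.1 this).1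
      simp only [Finset.mem_insert, Finset.mem_singleton] at hzK
      have hgoal : ∀ r' ∈ G.faces, (∀ x ∈ r', x ∈ r) → r ∈ G.faces := by
        intro r' hr'F hsub
        rwa [← Finset.eq_of_subset_of_card_le hsub
          (by rw [hr3, (G.isNClique_of_mem r' hr'F).card_eq])]
      rcases hzK with rfl | rfl | rfl | rfl
      · refine hgoal t' ht' ?_
        rw [htt', hr']
        intro x hx
        simp only [Finset.mem_insert, Finset.mem_singleton, Finset.mem_erase] at hx ⊢
        rcases hx with rfl | rfl | rfl <;> simp [hvw.symm, *]
      · refine hgoal t ht ?_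
        rw [htt, hr']
        intro x hx
        simp only [Finset.mem_insert, Finset.mem_singleton, Finset.mem_erase] at hx ⊢
        rcases hx with rfl | rfl | rfl <;> simp [*]
      · refine hgoal _ hfb ?_
        rw [hr']
        intro x hx
        simp only [Finset.mem_insert, Finset.mem_singleton, Finset.mem_erase] at hx ⊢
        rcases hx with rfl | rfl | rfl <;> simp [a2.symm, a3.symm, hab.symm]
      · refine hgoal _ hfa ?_
        rw [hr']
        intro x hx
        simp only [Finset.mem_insert, Finset.mem_singleton, Finset.mem_erase] at hx ⊢
        rcases hx with rfl | rfl | rfl <;> simp [b2.symm, b3.symm, hab]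
  intro t ht t' ht' heq
  obtain ⟨htF, hn⟩ := Finset.mem_filter.1 (Finset.mem_coe.1 ht)
  obtain ⟨htF', hn'⟩ := Finset.mem_filter.1 (Finset.mem_coe.1 ht')
  by_cases hv : v ∈ t
  · by_cases hw' : w ∈ t'
    · exact (hex2 t htF t' htF' hn hn' heq hv hw').elim
    · exact hex t htF t' htF' hn hn' heq hv hw'
  · by_cases hv' : v ∈ t'
    · by_cases hw : w ∈ t
      · exact (hex2 t' htF' t htF hn' hn heq.symm hv' hw).elim
      · exact (hex t' htF' t htF hn' hn heq.symm hv' hw).symm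
    · have hmem : ∀ z, z ∈ t ↔ z ∈ t' := by
        intro z
        by_cases hzv' : z = v
        · subst hzv'; exact iff_of_false hv hv'
        have hzv : ∀ r : Finset V, v ∉ r → (z ∈ r ↔ mergeMap hvw z ∈ r.image (mergeMap hvw)) := by
          intro r hr
          refine ⟨Finset.mem_image_of_mem _, fun hz => ?_⟩
          obtain ⟨y, hy, hyz⟩ := Finset.mem_image.1 hz
          rcases mergeMap_eq_iff hvw hyz with rfl | ⟨rfl, -⟩ | ⟨-, hz⟩
          · exact hy
          · exact (hr hy).elim
          · exact (hzv' hz).elim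
        rw [hzv t hv, hzv t' hv']
        simp only at heq
        rw [heq]
      exact Finset.ext hmem

end

section

variable {G : FacedGraph V} {s : ℕ} {h : ZMod s → V} {v w : V} (hvw : v ≠ w)

theorem faceCount_contract [NeZero s] (hP : G.IsProjectiveWithHole h)
    (hc : G.IsContractible v w) (a b : {x : V // x ≠ w}) : (G.contract hvw).faceCount a b =
      (G.faces.filter fun t => ¬ (v ∈ t ∧ w ∈ t) ∧ (a.1 ∈ t ∨ (a.1 = v ∧ w ∈ t)) ∧
        (b.1 ∈ t ∨ (b.1 = v ∧ w ∈ t))).card := by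
  rw [faceCount, contract, Finset.filter_image, Finset.card_image_of_injOn, Finset.filter_filter]
  · simp only [mem_image_mergeMap]
  · exact (image_mergeMap_injOn hvw hP hc).mono (Finset.coe_subset.2 (Finset.filter_subset _ _))

theorem card_faces_contract [NeZero s] (hP : G.IsProjectiveWithHole h)
    (hc : G.IsContractible v w) : (G.contract hvw).faces.card + 2 = G.faces.card := by
  rw [contract, Finset.card_image_of_injOn (image_mergeMap_injOn hvw hP hc), ← hc.1.2, faceCount,
    add_comm]
  exact Finset.card_filter_add_card_filter_not _

theorem faceCount_add_holeCount_of_not_adj [NeZero s] (hP : G.IsProjectiveWithHole h) {u b : V}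
    (hub : u ≠ b) (hn : ¬ G.graph.Adj u b) : G.faceCount u b = 0 ∧ holeCount h u b = 0 := by
  constructor
  · rw [faceCount, Finset.card_eq_zero, Finset.filter_eq_empty_iff]
    intro t ht h
    exact hn (adj_of_mem_faces ht h.1 h.2 hub)
  · by_contra hpos
    obtain ⟨i, hi⟩ := holeCount_pos_iff.1 (Nat.pos_of_ne_zero hpos)
    have := hP.hole_adj i
    rw [← SimpleGraph.mem_edgeSet, hi] at this
    exact hn this

/-- A face on `v`, `w` and `b` is counted on both sides `vb` and `wb` before the contraction. -/
theorem faceCount_contract_left [NeZero s] (hP : G.IsProjectiveWithHole h)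
    (hc : G.IsContractible v w) {b : {x : V // x ≠ w}} (hb : b.1 ≠ v) :
    (G.contract hvw).faceCount ⟨v, hvw⟩ b + (if ({v, w, b.1} : Finset V) ∈ G.faces then 2 else 0)
      = G.faceCount v b.1 + G.faceCount w b.1 := by
  rw [faceCount_contract hvw hP hc]
  have h1 : (if ({v, w, b.1} : Finset V) ∈ G.faces then 2 else 0)
      = 2 * (G.faces.filter fun t => v ∈ t ∧ w ∈ t ∧ b.1 ∈ t).card := by
    have h2 : (G.faces.filter fun t => v ∈ t ∧ w ∈ t ∧ b.1 ∈ t)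
        = G.faces.filter fun t => t = {v, w, b.1} := by
      refine Finset.filter_congr fun t ht => ⟨?_, ?_⟩
      · rintro ⟨h1, h2, h3⟩
        obtain ⟨x, rfl⟩ := exists_third ht hvw h1 h2
        simp only [Finset.mem_insert, Finset.mem_singleton] at h3
        rcases h3 with h3 | h3 | h3
        · exact absurd h3 hb
        · exact absurd h3 b.2
        · rw [h3]
      · rintro rfl; simp
    rw [h2, Finset.filter_eq']
    split_ifs <;> simp
  rw [h1, faceCount, faceCount, Finset.card_filter, Finset.card_filter, Finset.card_filter,
    Finset.card_filter, Finset.mul_sum, ← Finset.sum_add_distrib, ← Finset.sum_add_distrib]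
  refine Finset.sum_congr rfl fun t _ => ?_
  by_cases h1 : v ∈ t <;> by_cases h2 : w ∈ t <;> by_cases h3 : b.1 ∈ t <;>
    simp [h1, h2, h3, hb]

theorem holeCount_contract_left [NeZero s] {b : {x : V // x ≠ w}} (hb : b.1 ≠ v) :
    holeCount (mergeMap hvw ∘ h) ⟨v, hvw⟩ b = holeCount h v b.1 + holeCount h w b.1 := by
  rw [holeCount, holeCount, holeCount, ← Set.ncard_union_eq]
  · congr 1
    ext i
    simp only [Function.comp, Set.mem_ofPred_eq, Set.mem_union, Sym2.eq_iff, mergeMap_eq_iff', hb,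
      and_false, or_false, and_true]
    tauto
  · rw [Set.disjoint_left]
    intro i h1 h2
    have h3 := h1.symm.trans h2
    rw [Sym2.congr_left] at h3
    exact hvw h3

theorem two_sides_contract_left [NeZero s] (hP : G.IsProjectiveWithHole h)
    (hc : G.IsContractible v w) {b : {x : V // x ≠ w}} (hb : b.1 ≠ v)
    (hadj : G.graph.Adj v b.1 ∨ G.graph.Adj w b.1) : (G.contract hvw).faceCount ⟨v, hvw⟩ b +
      holeCount (mergeMap hvw ∘ h) ⟨v, hvw⟩ b = 2 := by
  have h1 := faceCount_contract_left hvw hP hc hb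
  rw [holeCount_contract_left hvw hb]
  by_cases hv : G.graph.Adj v b.1 <;> by_cases hw : G.graph.Adj w b.1
  · rw [if_pos (hc.mem_faces hv hw)] at h1
    have h2 := hP.two_sides _ _ hv
    have h3 := hP.two_sides _ _ hw
    omega
  · rw [if_neg fun hf => hw (adj_of_mem_faces hf (by simp) (by simp) b.2.symm)] at h1
    have h2 := hP.two_sides _ _ hv
    have h3 := faceCount_add_holeCount_of_not_adj hP b.2.symm hw
    omega
  · rw [if_neg fun hf => hv (adj_of_mem_faces hf (by simp) (by simp) hb.symm)] at h1
    have h2 := hP.two_sides _ _ hw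
    have h3 := faceCount_add_holeCount_of_not_adj hP hb.symm hv
    omega
  · tauto

theorem two_sides_contract [NeZero s] (hP : G.IsProjectiveWithHole h)
    (hc : G.IsContractible v w) (a b : {x : V // x ≠ w}) (hab : (G.contract hvw).graph.Adj a b) :
    (G.contract hvw).faceCount a b + holeCount (mergeMap hvw ∘ h) a b = 2 := by
  obtain ⟨hne, p, q, hp, hq, hpq⟩ := (contract_adj hvw).1 hab
  rw [mergeMap_eq_iff'] at hp hq
  by_cases ha : a.1 = v
  · obtain rfl : a = ⟨v, hvw⟩ := Subtype.ext ha
    have hb : b.1 ≠ v := fun hb => hne (Subtype.ext hb.symm)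
    refine two_sides_contract_left hvw hP hc hb ?_
    rcases hq with rfl | ⟨-, hq⟩
    · rcases hp with rfl | ⟨rfl, -⟩
      · exact Or.inl hpq
      · exact Or.inr hpq
    · exact absurd hq hb
  · by_cases hb : b.1 = v
    · obtain rfl : b = ⟨v, hvw⟩ := Subtype.ext hb
      rw [faceCount_comm, holeCount_comm]
      refine two_sides_contract_left hvw hP hc ha ?_
      rcases hp with rfl | ⟨-, hp⟩
      · rcases hq with rfl | ⟨rfl, -⟩
        · exact Or.inl hpq.symm
        · exact Or.inr hpq.symm
      · exact absurd hp ha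
    · obtain rfl : p = a.1 := hp.resolve_right fun h => ha h.2
      obtain rfl : q = b.1 := hq.resolve_right fun h => hb h.2
      rw [← hP.two_sides _ _ hpq, faceCount_contract hvw hP hc, faceCount, holeCount, holeCount]
      congr 1
      · congr 1
        refine Finset.filter_congr fun t ht => ?_
        simp only [ha, hb, false_and, or_false, and_iff_right_iff_imp]
        rintro ⟨h1, h2⟩ ⟨h3, h4⟩
        obtain ⟨x, rfl⟩ := exists_third ht hvw h3 h4
        have ha2 := a.2
        have hb2 := b.2
        simp only [Finset.mem_insert, Finset.mem_singleton] at h1 h2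
        exact hne (Subtype.ext (by grind))
      · congr 1
        ext i
        simp only [Function.comp, Set.mem_ofPred_eq, Sym2.eq_iff, mergeMap_eq_iff', ha, hb,
          and_false, or_false]

/-- A criterion for the connectedness of a link: a property of the neighbours of `v` that passes to
the other side of each corner at `v` holds for all neighbours or for none. -/
theorem link_connected_of (hadj : ∀ i, G.graph.Adj (h i) (h (i + 1))) (hne : ∃ a, G.graph.Adj v a)
    (H : ∀ Q : V → Prop, (∀ a b, a ≠ b → ({v, a, b} : Finset V) ∈ G.faces → (Q a ↔ Q b)) →
      (∀ i, h (i + 1) = v → (Q (h i) ↔ Q (h (i + 2)))) →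
      ∀ a b, G.graph.Adj v a → G.graph.Adj v b → Q a → Q b) : (G.link h v).Connected := by
  have hpre : (G.link h v).Preconnected := by
    intro a b
    obtain ⟨hb, hr⟩ := H (fun u => ∃ hu : G.graph.Adj v u, (G.link h v).Reachable a ⟨u, hu⟩)
      (by
        intro c d hcd hf
        have hvc : G.graph.Adj v c :=
          adj_of_mem_faces hf (by simp) (by simp) (three_distinct_of_mem hf).1
        have hvd : G.graph.Adj v d :=
          adj_of_mem_faces hf (by simp) (by simp) (three_distinct_of_mem hf).2.1
        have hl : (G.link h v).Adj ⟨c, hvc⟩ ⟨d, hvd⟩ :=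
          (SimpleGraph.fromRel_adj _ _ _).2
            ⟨fun hh => hcd (congrArg Subtype.val hh), Or.inl (Or.inl hf)⟩
        exact ⟨fun ⟨_, hr⟩ => ⟨hvd, hr.trans hl.reachable⟩,
          fun ⟨_, hr⟩ => ⟨hvc, hr.trans hl.symm.reachable⟩⟩)
      (by
        intro i hi
        by_cases heq : h i = h (i + 2)
        · rw [heq]
        have hvc : G.graph.Adj v (h i) := by rw [← hi]; exact (hadj i).symm
        have hvd : G.graph.Adj v (h (i + 2)) := by
          have := hadj (i + 1)
          rwa [add_assoc, one_add_one_eq_two, hi] at this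
        have hl : (G.link h v).Adj ⟨_, hvc⟩ ⟨_, hvd⟩ :=
          (SimpleGraph.fromRel_adj _ _ _).2
            ⟨fun hh => heq (congrArg Subtype.val hh), Or.inl (Or.inr ⟨i, rfl, hi, rfl⟩)⟩
        exact ⟨fun ⟨_, hr⟩ => ⟨hvd, hr.trans hl.reachable⟩,
          fun ⟨_, hr⟩ => ⟨hvc, hr.trans hl.symm.reachable⟩⟩)
      a.1 b.1 a.2 b.2 ⟨a.2, SimpleGraph.Reachable.refl _⟩
    exact hr
  obtain ⟨a, ha⟩ := hne
  have : Nonempty (G.graph.neighborSet v) := ⟨⟨a, ha⟩⟩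
  exact ⟨hpre⟩

theorem faceVertex_set (t : G.faces) (i : Fin 3) : ({G.faceVertex t (i + 1), G.faceVertex t i,
    G.faceVertex t (i + 1 + 1)} : Finset V) = t.1 := by
  refine Finset.eq_of_subset_of_card_le ?_ ?_
  · intro z hz
    simp only [Finset.mem_insert, Finset.mem_singleton] at hz
    rcases hz with rfl | rfl | rfl <;> exact G.faceVertex_mem _ _
  · rw [(G.isNClique_of_mem t.1 t.2).card_eq, Finset.card_eq_three.2 ⟨_, _, _,
      (G.faceVertex_adj t i).ne', (G.faceVertex_adj t (i + 1)).ne,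
      fun hh => fin_three_succ_ne i (G.faceVertex_injective t hh).symm, rfl⟩]

/-- After the corners at the `FF` edge `vw` are left out, the two apexes `x` and `y` remain connected
in the link of `v`: in `sum_corners_eq_zero` for the edges to vertices other than `w` that satisfy
`Q`, only the corners of the two triangles at `vw` contribute, namely `1` for each apex that
satisfies `Q`. -/
theorem IsProjectiveWithHole.apex_imp [NeZero s] (hP : G.IsProjectiveWithHole h)
    (hF : G.IsFF v w) {x y : V} (hxy : x ≠ y) (hx : ({v, w, x} : Finset V) ∈ G.faces)
    (hy : ({v, w, y} : Finset V) ∈ G.faces)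
    (hF2 : ∀ t ∈ G.faces, v ∈ t → w ∈ t → t = {v, w, x} ∨ t = {v, w, y}) (Q : V → Prop)
    (hface : ∀ a b, a ≠ w → b ≠ w → a ≠ b → ({v, a, b} : Finset V) ∈ G.faces → (Q a ↔ Q b))
    (hhole : ∀ i, h (i + 1) = v → (Q (h i) ↔ Q (h (i + 2)))) (hQx : Q x) : Q y := by
  classical
  by_contra hQy
  have : Fintype G.graph.edgeSet := Fintype.ofFinite _
  let q' : V → ZMod 2 := fun u => if u ≠ w ∧ Q u then 1 else 0
  let q : G.graph.edgeSet → ZMod 2 := fun e => if ∃ u, e.1 = s(v, u) ∧ u ≠ w ∧ Q u then 1 else 0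
  have hq : ∀ (e : G.graph.edgeSet) (u : V), e.1 = s(v, u) → q e = q' u := by
    intro e u he
    simp only [q, q', he, Sym2.congr_right]
    congr 1
    simp
  have hval : ∀ z, G.sidePoint h (G.sideNext s z) = v → q ((G.toComplex hP.hole_adj).edge z) +
      q ((G.toComplex hP.hole_adj).edge ((G.toComplex hP.hole_adj).next z)) =
      q' (G.sidePoint h z) + q' (G.sidePoint h (G.sideNext s (G.sideNext s z))) := by
    intro z hz
    congr 1
    · exact hq _ _ (by rw [toComplex_edge, hz, Sym2.eq_swap])
    · exact hq _ _ (by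
        rw [toComplex_edge]
        change s(G.sidePoint h (G.sideNext s z), _) = _
        rw [hz]; rfl)
  have h2 : ∀ a : ZMod 2, a + a = 0 := by decide
  obtain ⟨i, hi1, hi2⟩ := exists_corner hx
  obtain ⟨j, hj1, hj2⟩ := exists_corner hy
  have hwx : w ≠ x := (three_distinct_of_mem hx).2.2
  have hwy : w ≠ y := (three_distinct_of_mem hy).2.2
  have hsum := hP.toComplex_isProjective.sum_corners_eq_zero v q
  have hne : (Sum.inl (⟨_, hx⟩, i) : (G.faces × Fin 3) ⊕ ZMod s) ≠ Sum.inl (⟨_, hy⟩, j) := by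
    intro heq
    have h3 : ({v, w, x} : Finset V) = {v, w, y} :=
      congrArg Subtype.val (Prod.ext_iff.1 (Sum.inl_injective heq)).1
    have h4 : x ∈ ({v, w, y} : Finset V) := by rw [← h3]; simp
    simp only [Finset.mem_insert, Finset.mem_singleton] at h4
    rcases h4 with h4 | h4 | h4
    · exact (three_distinct_of_mem hx).2.1 h4.symm
    · exact hwx h4.symm
    · exact hxy h4
  rw [← Finset.sum_subset (s₁ := {Sum.inl (⟨_, hx⟩, i), Sum.inl (⟨_, hy⟩, j)}),
    Finset.sum_pair hne, hval (Sum.inl (⟨_, hx⟩, i)) hi1, hval (Sum.inl (⟨_, hy⟩, j)) hj1] at hsum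
  · change q' (G.faceVertex ⟨_, hx⟩ i) + q' (G.faceVertex ⟨_, hx⟩ (i + 1 + 1)) +
      (q' (G.faceVertex ⟨_, hy⟩ j) + q' (G.faceVertex ⟨_, hy⟩ (j + 1 + 1))) = 0 at hsum
    have e1 : q' w = 0 := by simp [q']
    have e2 : q' x = 1 := by simp [q', hwx.symm, hQx]
    have e3 : q' y = 0 := by simp [q', hQy]
    rcases hi2 with ⟨g1, g2⟩ | ⟨g1, g2⟩ <;> rcases hj2 with ⟨g3, g4⟩ | ⟨g3, g4⟩ <;>
    · rw [g1, g2, g3, g4, e1, e2, e3] at hsum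
      exact absurd hsum (by decide)
  · intro z hz
    rw [Finset.mem_filter_univ, toComplex_tgt]
    simp only [Finset.mem_insert, Finset.mem_singleton] at hz
    rcases hz with rfl | rfl
    · exact hi1
    · exact hj1
  · intro z hz hz'
    rw [Finset.mem_filter_univ, toComplex_tgt] at hz
    rw [hval z hz]
    have hgoal : (G.sidePoint h z ≠ w ∧ G.sidePoint h (G.sideNext s (G.sideNext s z)) ≠ w ∧
        (Q (G.sidePoint h z) ↔ Q (G.sidePoint h (G.sideNext s (G.sideNext s z))))) →
        q' (G.sidePoint h z) + q' (G.sidePoint h (G.sideNext s (G.sideNext s z))) = 0 := by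
      rintro ⟨g1, g2, g3⟩
      simp only [q', ne_eq, g1, g2, not_false_eq_true, true_and, g3]
      exact h2 _
    apply hgoal
    rcases z with ⟨t, k⟩ | k
    · change G.faceVertex t (k + 1) = v at hz
      change G.faceVertex t k ≠ w ∧ G.faceVertex t (k + 1 + 1) ≠ w ∧
        (Q (G.faceVertex t k) ↔ Q (G.faceVertex t (k + 1 + 1)))
      have hw : w ∉ t.1 := by
        intro hw
        apply hz'
        simp only [Finset.mem_insert, Finset.mem_singleton]
        have hv : v ∈ t.1 := by rw [← hz]; exact G.faceVertex_mem _ _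
        rcases hF2 t.1 t.2 hv hw with ht | ht
        · left
          obtain rfl : t = ⟨_, hx⟩ := Subtype.ext ht
          have := add_right_cancel (G.faceVertex_injective _ (hz.trans hi1.symm))
          rw [this]
        · right
          obtain rfl : t = ⟨_, hy⟩ := Subtype.ext ht
          have := add_right_cancel (G.faceVertex_injective _ (hz.trans hj1.symm))
          rw [this]
      have g1 : G.faceVertex t k ≠ w := fun hh => hw (hh ▸ G.faceVertex_mem _ _)
      have g2 : G.faceVertex t (k + 1 + 1) ≠ w := fun hh => hw (hh ▸ G.faceVertex_mem _ _)
      refine ⟨g1, g2, hface _ _ g1 g2 ?_ ?_⟩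
      · exact fun hh => fin_three_succ_ne k (G.faceVertex_injective t hh).symm
      · rw [← hz, faceVertex_set]; exact t.2
    · change h (k + 1) = v at hz
      change h k ≠ w ∧ h (k + 1 + 1) ≠ w ∧ (Q (h k) ↔ Q (h (k + 1 + 1)))
      refine ⟨?_, ?_, ?_⟩
      · intro hh
        exact hF.sym2_ne hP k (by rw [hh, hz, Sym2.eq_swap])
      · intro hh
        exact hF.sym2_ne hP (k + 1) (by rw [hh, hz])
      · rw [add_assoc, one_add_one_eq_two]; exact hhole k hz

/-- All neighbours of `v` except `w` are connected with the apexes of the `FF` edge `vw` in the link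
of `v` without `w`. -/
theorem IsProjectiveWithHole.iff_apex [NeZero s] (hP : G.IsProjectiveWithHole h)
    (hF : G.IsFF v w) {x y : V}
    (hF2 : ∀ t ∈ G.faces, v ∈ t → w ∈ t → t = {v, w, x} ∨ t = {v, w, y}) (Q : V → Prop)
    (hface : ∀ a b, a ≠ w → b ≠ w → a ≠ b → ({v, a, b} : Finset V) ∈ G.faces → (Q a ↔ Q b))
    (hhole : ∀ i, h (i + 1) = v → (Q (h i) ↔ Q (h (i + 2)))) (hQ : Q x ↔ Q y) {a : V}
    (ha : G.graph.Adj v a) (haw : a ≠ w) : Q a ↔ Q x := by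
  classical
  have hthird : ∀ b, ({v, w, b} : Finset V) ∈ G.faces → (Q x ↔ Q b) := by
    intro b hb
    have hb' : b ≠ v ∧ b ≠ w := ⟨(three_distinct_of_mem hb).2.1.symm,
      (three_distinct_of_mem hb).2.2.symm⟩
    have hmem : b ∈ ({v, w, b} : Finset V) := by simp
    rcases hF2 _ hb (by simp) (by simp) with heq | heq <;>
    · rw [heq] at hmem
      simp only [Finset.mem_insert, Finset.mem_singleton, hb'.1, hb'.2, false_or] at hmem
      subst hmem
      first | rfl | exact hQ
  have hl := G.iff_of_link_connected (hP.link_connected v) (fun u => if u = w then Q x else Q u)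
    (by
      intro a b hab hf
      split_ifs with h1 h2 h2
      · rfl
      · subst h1; exact hthird b hf
      · subst h2
        rw [Finset.pair_comm] at hf
        exact (hthird a hf).symm
      · exact hface a b h1 h2 hab hf)
    (by
      intro i hi
      have g1 : h i ≠ w := fun hh => hF.sym2_ne hP i (by rw [hh, hi, Sym2.eq_swap])
      have g2 : h (i + 2) ≠ w := by
        intro hh
        refine hF.sym2_ne hP (i + 1) ?_
        rw [add_assoc, one_add_one_eq_two, hh, hi]
      simp only [g1, g2, if_false]
      exact hhole i hi) a w ha hF.1
  simpa [haw] using hl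

theorem isFF_comm : G.IsFF v w ↔ G.IsFF w v := by
  rw [IsFF, IsFF, faceCount_comm, G.graph.adj_comm]

theorem image_mem_contract_faces {p a b : V} (hf : ({p, a, b} : Finset V) ∈ G.faces)
    (hn : ¬ (v ∈ ({p, a, b} : Finset V) ∧ w ∈ ({p, a, b} : Finset V))) :
    ({mergeMap hvw p, mergeMap hvw a, mergeMap hvw b} : Finset {x : V // x ≠ w}) ∈
      (G.contract hvw).faces :=
  (mem_contract_faces hvw).2 ⟨_, hf, hn, by simp [Finset.image_insert]⟩

/-- At the merged vertex the two links, without the contracted edge, are joined at the two apexes. -/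
theorem link_contract_connected [NeZero s] (hP : G.IsProjectiveWithHole h)
    (hc : G.IsContractible v w) (hadj : ∀ i, (G.contract hvw).graph.Adj ((mergeMap hvw ∘ h) i)
      ((mergeMap hvw ∘ h) (i + 1))) (p : {x : V // x ≠ w}) :
    ((G.contract hvw).link (mergeMap hvw ∘ h) p).Connected := by
  obtain ⟨x, y, hxy, hx, hy, hF2⟩ := hc.1.exists_faces
  obtain ⟨hvw', hvx, hwx⟩ := three_distinct_of_mem hx
  obtain ⟨-, hvy, hwy⟩ := three_distinct_of_mem hy
  by_cases hp : p.1 = v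
  · obtain rfl : p = ⟨v, hvw⟩ := Subtype.ext hp
    refine link_connected_of hadj ⟨mergeMap hvw x, (contract_adj hvw).2 ⟨?_, v, x,
      mergeMap_left hvw, rfl, adj_of_mem_faces hx (by simp) (by simp) hvx⟩⟩ ?_
    · rw [mergeMap_of_ne hvw hwx.symm]
      exact fun hh => hvx (congrArg Subtype.val hh)
    · intro Q hface hhole a b ha hb hQa
      have hfv : ∀ a b, a ≠ w → b ≠ w → a ≠ b → ({v, a, b} : Finset V) ∈ G.faces →
          (Q (mergeMap hvw a) ↔ Q (mergeMap hvw b)) := by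
        intro a b ha hb hab hf
        refine hface _ _ ?_ ?_
        · rw [mergeMap_of_ne hvw ha, mergeMap_of_ne hvw hb]
          exact fun hh => hab (congrArg Subtype.val hh)
        · rw [← mergeMap_left hvw]
          exact image_mem_contract_faces hvw hf (by simp [hvw.symm, ha.symm, hb.symm])
      have hfw : ∀ a b, a ≠ v → b ≠ v → a ≠ b → ({w, a, b} : Finset V) ∈ G.faces →
          (Q (mergeMap hvw a) ↔ Q (mergeMap hvw b)) := by
        intro a b ha hb hab hf
        have haw := (three_distinct_of_mem hf).1
        have hbw := (three_distinct_of_mem hf).2.1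
        refine hface _ _ ?_ ?_
        · rw [mergeMap_of_ne hvw haw.symm, mergeMap_of_ne hvw hbw.symm]
          exact fun hh => hab (congrArg Subtype.val hh)
        · rw [← mergeMap_right hvw]
          exact image_mem_contract_faces hvw hf (by simp [hvw, ha.symm, hb.symm])
      have hhv : ∀ i, h (i + 1) = v → (Q (mergeMap hvw (h i)) ↔ Q (mergeMap hvw (h (i + 2)))) := by
        intro i hi
        exact hhole i (by rw [Function.comp, hi, mergeMap_left])
      have hhw : ∀ i, h (i + 1) = w → (Q (mergeMap hvw (h i)) ↔ Q (mergeMap hvw (h (i + 2)))) := by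
        intro i hi
        exact hhole i (by rw [Function.comp, hi, mergeMap_right])
      have hQxy : Q (mergeMap hvw x) ↔ Q (mergeMap hvw y) :=
        ⟨hP.apex_imp hc.1 hxy hx hy hF2 (fun u => Q (mergeMap hvw u)) hfv hhv,
          hP.apex_imp hc.1 hxy.symm hy hx (fun t ht h1 h2 => (hF2 t ht h1 h2).symm)
            (fun u => Q (mergeMap hvw u)) hfv hhv⟩
      have hnb : ∀ b, (G.contract hvw).graph.Adj ⟨v, hvw⟩ b → (Q b ↔ Q (mergeMap hvw x)) := by
        intro b hb
        obtain ⟨hne, r, q, hr, rfl, hrq⟩ := (contract_adj hvw).1 hb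
        have hqv : q ≠ v := by rintro rfl; exact hne (mergeMap_left hvw).symm
        have hqw : q ≠ w := by rintro rfl; exact hne (mergeMap_right hvw).symm
        rcases (mergeMap_eq_iff' hvw).1 hr with rfl | ⟨rfl, -⟩
        · exact hP.iff_apex hc.1 hF2 (fun u => Q (mergeMap hvw u)) hfv hhv hQxy hrq hqw
        · exact hP.iff_apex (isFF_comm.1 hc.1) (x := x) (y := y)
            (fun t ht h1 h2 => by
              rw [Finset.insert_comm r v, Finset.insert_comm r v]; exact hF2 t ht h2 h1)
            (fun u => Q (mergeMap hvw u)) hfw hhw hQxy hrq hqv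
      exact (hnb b hb).2 ((hnb a ha).1 hQa)
  · have hpm := mergeMap_coe hvw p
    refine link_connected_of hadj ?_ ?_
    · obtain ⟨u, hu⟩ := (hP.link_connected p.1).nonempty
      refine ⟨mergeMap hvw u, (contract_adj hvw).2 ⟨?_, p.1, u, hpm, rfl, hu⟩⟩
      intro hh
      rcases (mergeMap_eq_iff' hvw).1 hh.symm with rfl | ⟨-, h2⟩
      · exact G.graph.loopless.irrefl _ hu
      · exact hp h2
    · intro Q hface hhole a b ha hb hQa
      have hnb : ∀ b, (G.contract hvw).graph.Adj p b → ∃ u, mergeMap hvw u = b ∧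
          G.graph.Adj p.1 u := by
        intro b hb
        obtain ⟨-, r, q, hr, hq, hrq⟩ := (contract_adj hvw).1 hb
        obtain rfl := ((mergeMap_eq_iff' hvw).1 hr).resolve_right fun hh => hp hh.2
        exact ⟨q, hq, hrq⟩
      obtain ⟨a, rfl, ha'⟩ := hnb a ha
      obtain ⟨b, rfl, hb'⟩ := hnb b hb
      refine (G.iff_of_link_connected (hP.link_connected p.1) (fun u => Q (mergeMap hvw u))
        ?_ ?_ a b ha' hb').1 hQa
      · intro a b hab hf
        by_cases heq : mergeMap hvw a = mergeMap hvw b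
        · simp only [heq]
        · refine hface _ _ heq ?_
          have h1 := image_mem_contract_faces hvw hf (by
            have h1 : v ≠ p.1 := Ne.symm hp
            have h2 : w ≠ p.1 := p.2.symm
            simp only [Finset.mem_insert, Finset.mem_singleton, h1, h2, false_or]
            rintro ⟨rfl | rfl, rfl | rfl⟩
            · exact hvw rfl
            · exact heq (by rw [mergeMap_left, mergeMap_right])
            · exact heq (by rw [mergeMap_left, mergeMap_right])
            · exact hvw rfl)
          rwa [hpm] at h1
      · intro i hi
        exact hhole i (by rw [Function.comp, hi, hpm])

/-- The contraction of a contractible edge preserves the surface and the length of the hole. -/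
theorem IsProjectiveWithHole.contract [NeZero s] (hP : G.IsProjectiveWithHole h)
    (hc : G.IsContractible v w) : (G.contract hvw).IsProjectiveWithHole (mergeMap hvw ∘ h) := by
  classical
  have : Fintype G.graph.edgeSet := Fintype.ofFinite _
  have : Fintype (G.contract hvw).graph.edgeSet := Fintype.ofFinite _
  have hadj : ∀ i, (G.contract hvw).graph.Adj ((mergeMap hvw ∘ h) i)
      ((mergeMap hvw ∘ h) (i + 1)) := by
    intro i
    refine (contract_adj hvw).2 ⟨fun heq => ?_, h i, h (i + 1), rfl, rfl, hP.hole_adj i⟩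
    rcases mergeMap_eq_iff hvw heq with h1 | ⟨h1, h2⟩ | ⟨h1, h2⟩
    · exact (hP.hole_adj i).ne h1
    · exact hc.1.sym2_ne hP i (by rw [h1, h2])
    · exact hc.1.sym2_ne hP i (by rw [h1, h2, Sym2.eq_swap])
  refine ⟨hP.three_le, ?_, hadj, two_sides_contract hvw hP hc,
    link_contract_connected hvw hP hc hadj, ?_⟩
  · have : Nonempty {x : V // x ≠ w} := ⟨⟨v, hvw⟩⟩
    refine ⟨fun a b => ?_⟩
    have hw : ∀ x y, G.graph.Walk x y →
        (G.contract hvw).graph.Reachable (mergeMap hvw x) (mergeMap hvw y) := by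
      intro x y p
      induction p with
      | nil => exact SimpleGraph.Reachable.refl _
      | @cons x y z hxy _ ih =>
        by_cases heq : mergeMap hvw x = mergeMap hvw y
        · rw [heq]; exact ih
        · exact ((contract_adj hvw).2 ⟨heq, x, y, rfl, rfl, hxy⟩).reachable.trans ih
    obtain ⟨p⟩ := hP.connected.preconnected a.1 b.1
    have := hw _ _ p
    rwa [mergeMap_coe, mergeMap_coe] at this
  · have h1 := G.card_sides_of_two_sides hP.hole_adj hP.two_sides
    have h2 := (G.contract hvw).card_sides_of_two_sides hadj (two_sides_contract hvw hP hc)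
    have h3 := card_faces_contract hvw hP hc
    have h4 : Fintype.card {x : V // x ≠ w} + 1 = Fintype.card V := by
      rw [Fintype.card_subtype_compl, Fintype.card_subtype_eq]
      have : 0 < Fintype.card V := Fintype.card_pos_iff.2 ⟨v⟩
      omega
    have h5 := hP.euler
    rw [Set.ncard_eq_toFinset_card', Set.toFinset_card] at h5 ⊢
    omega

end

theorem IsCertificate.contract {G : FacedGraph V} {h : ZMod 6 → V} {v w : V} (hvw : v ≠ w)
    {κ : V → ZMod 3} (hκ : G.IsCertificate h κ) (heq : κ v = κ w) :
    (G.contract hvw).IsCertificate (mergeMap hvw ∘ h) (fun a => κ a.1) := by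
  have hm : ∀ x, κ (mergeMap hvw x).1 = κ x := by
    intro x
    by_cases hx : x = w
    · subst hx; rw [mergeMap_right]; exact heq
    · rw [mergeMap_of_ne hvw hx]
  constructor
  · intro t ht
    obtain ⟨t₀, ht₀, hn, rfl⟩ := (mem_contract_faces hvw).1 ht
    obtain ⟨a, ha, b, hb, hab, hκab⟩ := hκ.face t₀ ht₀
    refine ⟨_, Finset.mem_image_of_mem _ ha, _, Finset.mem_image_of_mem _ hb, fun hh => ?_, ?_⟩
    · rcases mergeMap_eq_iff hvw hh with h1 | ⟨rfl, rfl⟩ | ⟨rfl, rfl⟩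
      · exact hab h1
      · exact hn ⟨ha, hb⟩
      · exact hn ⟨hb, ha⟩
    · rw [hm, hm, hκab]
  · intro i
    simp only [Function.comp, hm]
    exact hκ.hole i

/-- In an irreducible graph no contractible edge has ends of the same colour. -/
theorem IsIrreducible.ne_of_isContractible {G : FacedGraph V} (hirr : G.IsIrreducible)
    {h : ZMod 6 → V} (hP : G.IsProjectiveWithHole h) {κ : V → ZMod 3} (hκ : G.IsCertificate h κ)
    {v w : V} (hc : G.IsContractible v w) : κ v ≠ κ w := fun heq =>
  hirr v w hc.1.1.ne hc ⟨⟨6, _, hP.contract hc.1.1.ne hc⟩,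
    (hP.contract hc.1.1.ne hc).isTight36_of_isCertificate (hκ.contract hc.1.1.ne heq)⟩

/-! ### Separating 3-cycles -/

section

variable {G : FacedGraph V} [Fintype G.graph.edgeSet]

/-- The edges with both ends in `T`. -/
def edgesIn (G : FacedGraph V) [Fintype G.graph.edgeSet] (T : Finset V) :
    Finset G.graph.edgeSet := Finset.univ.filter fun e => e.1.toFinset ⊆ T

theorem mk_mem_edgesIn {T : Finset V} {u v : V} (huv : s(u, v) ∈ G.graph.edgeSet) :
    (⟨s(u, v), huv⟩ : G.graph.edgeSet) ∈ G.edgesIn T ↔ u ∈ T ∧ v ∈ T := by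
  simp [edgesIn, Sym2.toFinset_mk_eq, Finset.insert_subset_iff]

theorem card_edgesIn {T : Finset V} (hT : G.graph.IsNClique 3 T) : (G.edgesIn T).card = 3 := by
  obtain ⟨a, b, c, hab, hac, hbc, rfl⟩ := SimpleGraph.is3Clique_iff.1 hT
  rw [Finset.card_eq_three]
  have h1 := hab.ne
  have h2 := hac.ne
  have h3 := hbc.ne
  refine ⟨⟨s(a, b), hab⟩, ⟨s(a, c), hac⟩, ⟨s(b, c), hbc⟩, ?_, ?_, ?_, ?_⟩
  · simp only [ne_eq, Subtype.ext_iff, Sym2.eq_iff]; tauto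
  · simp only [ne_eq, Subtype.ext_iff, Sym2.eq_iff]; tauto
  · simp only [ne_eq, Subtype.ext_iff, Sym2.eq_iff]; tauto
  · ext ⟨e, he⟩
    induction e using Sym2.ind with
    | _ p q =>
      have hpq : p ≠ q := G.graph.ne_of_adj he
      rw [mk_mem_edgesIn]
      simp only [Finset.mem_insert, Finset.mem_singleton, Subtype.ext_iff, Sym2.eq_iff]
      constructor
      · rintro ⟨rfl | rfl | rfl, rfl | rfl | rfl⟩ <;> simp_all
      · rintro ((⟨rfl, rfl⟩ | ⟨rfl, rfl⟩) | (⟨rfl, rfl⟩ | ⟨rfl, rfl⟩) |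
          (⟨rfl, rfl⟩ | ⟨rfl, rfl⟩)) <;> simp

variable {h : ZMod 6 → V} (hadj : ∀ i, G.graph.Adj (h i) (h (i + 1)))

open Classical in
/-- The cells that are separated from the hole by the 3-cycle `T`. -/
noncomputable def inner (T : Finset V) : Finset (Option G.faces) :=
  Finset.univ.filter fun c => ¬ ((G.toComplex hadj).regionGraph (G.edgesIn T)).Reachable none c

theorem mem_inner {T : Finset V} {c : Option G.faces} : c ∈ inner hadj T ↔
    ¬ ((G.toComplex hadj).regionGraph (G.edgesIn T)).Reachable none c := by
  simp [inner]

theorem none_notMem_inner {T : Finset V} : none ∉ inner hadj T := by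
  rw [mem_inner, not_not]

theorem cell_mem_inner {T : Finset V} {x y : (G.faces × Fin 3) ⊕ ZMod 6}
    (hxy : (G.toComplex hadj).edge x = (G.toComplex hadj).edge y)
    (hT : (G.toComplex hadj).edge x ∉ G.edgesIn T)
    (hx : (G.toComplex hadj).cell x ∈ inner hadj T) :
    (G.toComplex hadj).cell y ∈ inner hadj T := by
  rw [mem_inner] at hx ⊢
  exact fun hr => hx (hr.trans ((G.toComplex hadj).regionGraph_reachable hxy hT).symm)

/-- All cells at a vertex outside of `T` lie on the same side of `T`. -/
theorem IsProjectiveWithHole.cell_mem_inner_of_notMem (hP : G.IsProjectiveWithHole h)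
    {T : Finset V} {u : V} (hu : u ∉ T) {x y : (G.faces × Fin 3) ⊕ ZMod 6}
    (hux : u ∈ ((G.toComplex hP.hole_adj).edge x).1)
    (huy : u ∈ ((G.toComplex hP.hole_adj).edge y).1)
    (hx : (G.toComplex hP.hole_adj).cell x ∈ inner hP.hole_adj T) :
    (G.toComplex hP.hole_adj).cell y ∈ inner hP.hole_adj T := by
  have hoff : ∀ e : G.graph.edgeSet, u ∈ e.1 → e ∉ G.edgesIn T := by
    intro e he heT
    exact hu ((Finset.mem_filter.1 heT).2 (Sym2.mem_toFinset.2 he))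
  obtain ⟨z, hz, hzin⟩ := hP.toComplex_isProjective.link u
    (fun e => ∃ x, (G.toComplex hP.hole_adj).edge x = e ∧
      (G.toComplex hP.hole_adj).cell x ∈ inner hP.hole_adj T)
    (by
      intro z hz
      have h1 : u ∈ ((G.toComplex hP.hole_adj).edge z).1 := by
        rw [toComplex_edge, ← hz, toComplex_tgt]
        exact Sym2.mem_mk_right _ _
      have h2 : u ∈ ((G.toComplex hP.hole_adj).edge ((G.toComplex hP.hole_adj).next z)).1 := by
        rw [toComplex_edge, ← hz, toComplex_tgt]
        exact Sym2.mem_mk_left _ _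
      have hcell := hP.toComplex_isProjective.cell_next z
      constructor
      · rintro ⟨x, hx1, hx2⟩
        refine ⟨_, rfl, ?_⟩
        rw [hcell]
        exact cell_mem_inner _ hx1 (by rw [hx1]; exact hoff _ h1) hx2
      · rintro ⟨x, hx1, hx2⟩
        refine ⟨_, rfl, ?_⟩
        rw [← hcell]
        exact cell_mem_inner _ hx1 (by rw [hx1]; exact hoff _ h2) hx2)
    _ _ ((toComplex_end_iff _ _ _ u).2 hux) ((toComplex_end_iff _ _ _ u).2 huy) ⟨x, rfl, hx⟩
  exact cell_mem_inner _ hz (by rw [hz]; exact hoff _ huy) hzin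

/-- A 3-cycle that has two vertices of the same colour separates: each of its edges has a side
towards the hole and an inner side. -/
theorem IsProjectiveWithHole.exists_sides (hP : G.IsProjectiveWithHole h) {κ : V → ZMod 3}
    (hκ : G.IsCertificate h κ) {T : Finset V} (hT : G.graph.IsNClique 3 T)
    (hmono : ∃ u ∈ T, ∃ v ∈ T, u ≠ v ∧ κ u = κ v) {e : G.graph.edgeSet} (he : e ∈ G.edgesIn T) :
    ∃ x y, (G.toComplex hP.hole_adj).edge x = e ∧ (G.toComplex hP.hole_adj).edge y = e ∧
      (G.toComplex hP.hole_adj).cell x ∉ inner hP.hole_adj T ∧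
      (G.toComplex hP.hole_adj).cell y ∈ inner hP.hole_adj T := by
  obtain ⟨u, hu, v, hv, huv, huv'⟩ := hmono
  have hadj : G.graph.Adj u v := hT.isClique hu hv huv
  obtain ⟨x, y, h1, h2, h3, h4⟩ :=
    hP.toComplex_isProjective.exists_sides_of_card_eq_three hP.toComplex_isHoled
    (colourForm hP.hole_adj κ) (abs_colourForm_le _ κ) (hκ.cobd_colourForm _) T hT.card_eq
    (G.edgesIn T) (by
      intro e he
      have hsub := (Finset.mem_filter.1 he).2
      exact ⟨hsub (Sym2.mem_toFinset.2 ((toComplex_end_iff _ _ _ _).1 (Or.inl rfl))),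
        hsub (Sym2.mem_toFinset.2 ((toComplex_end_iff _ _ _ _).1 (Or.inr rfl)))⟩)
    (card_edgesIn hT) ((mk_mem_edgesIn hadj).2 ⟨hu, hv⟩) (colourForm_eq_zero _ hadj huv') e he
  exact ⟨x, y, h1, h2, by rwa [mem_inner, not_not], by rwa [mem_inner]⟩

end

section

variable {G : FacedGraph V} {h : ZMod 6 → V} {κ : V → ZMod 3}

/-- An edge with ends of the same colour is an `FF` edge, as the hole does not run along it. -/
theorem IsCertificate.isFF (hκ : G.IsCertificate h κ) (hP : G.IsProjectiveWithHole h) {u v : V}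
    (huv : G.graph.Adj u v) (heq : κ u = κ v) : G.IsFF u v := by
  refine ⟨huv, ?_⟩
  have h2 := hP.two_sides u v huv
  have h0 : holeCount h u v = 0 := by
    by_contra hpos
    obtain ⟨i, hi⟩ := holeCount_pos_iff.1 (Nat.pos_of_ne_zero hpos)
    have h1 := hκ.hole i
    have hne : ∀ a : ZMod 3, a ≠ a + 1 := by decide
    rcases Sym2.eq_iff.1 hi with ⟨h3, h4⟩ | ⟨h3, h4⟩
    · rw [h3, h4, heq] at h1; exact hne _ h1
    · rw [h3, h4, heq] at h1; exact hne _ h1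
  omega

/-- In an irreducible graph, an edge with ends of the same colour lies on a nonfacial 3-cycle. -/
theorem IsIrreducible.exists_nonfacial (hirr : G.IsIrreducible) (hP : G.IsProjectiveWithHole h)
    (hκ : G.IsCertificate h κ) {u v : V} (huv : G.graph.Adj u v) (heq : κ u = κ v) :
    ∃ x, G.graph.IsNClique 3 {u, v, x} ∧ ({u, v, x} : Finset V) ∉ G.faces := by
  by_contra! hcon
  refine hirr.ne_of_isContractible hP hκ ⟨hκ.isFF hP huv heq, ?_⟩ heq
  rintro ⟨-, x, hx1, hx2, hx3⟩
  exact hx3 (hcon x (SimpleGraph.is3Clique_triple_iff.2 ⟨huv, hx1, hx2⟩))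

/-- A vertex `u` of degree three with three facial triangles may be given the colour of its
neighbours, if these have a common colour; then its edges become contractible. -/
theorem IsIrreducible.not_degree_three (hirr : G.IsIrreducible) (hP : G.IsProjectiveWithHole h)
    (hκ : G.IsCertificate h κ) {u a b c : V} (hab : a ≠ b) (hac : a ≠ c) (hbc : b ≠ c)
    (h1 : ({u, a, b} : Finset V) ∈ G.faces) (h2 : ({u, a, c} : Finset V) ∈ G.faces)
    (h3 : ({u, b, c} : Finset V) ∈ G.faces) (hκab : κ a = κ b) (hκac : κ a = κ c) : False := by
  have hub : u ≠ b := (three_distinct_of_mem h1).2.1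
  have hua : u ≠ a := (three_distinct_of_mem h1).1
  have huc : u ≠ c := (three_distinct_of_mem h2).2.1
  have hadja : G.graph.Adj u a := adj_of_mem_faces h1 (by simp) (by simp) hua
  have hadjb : G.graph.Adj u b := adj_of_mem_faces h1 (by simp) (by simp) hub
  have hadjc : G.graph.Adj u c := adj_of_mem_faces h2 (by simp) (by simp) huc
  -- The edge `up` has exactly the two facial triangles `upq` and `upr`.
  have hkey : ∀ p q r, p ≠ q → p ≠ r → q ≠ r → G.graph.Adj u p → ({u, p, q} : Finset V) ∈ G.faces →
      ({u, p, r} : Finset V) ∈ G.faces → G.IsFF u p ∧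
      ∀ z, ({u, p, z} : Finset V) ∈ G.faces → z = q ∨ z = r := by
    intro p q r hpq hpr hqr hadj hq hr
    have hsub : ({{u, p, q}, {u, p, r}} : Finset (Finset V)) ⊆
        G.faces.filter fun t => u ∈ t ∧ p ∈ t := by
      intro t ht
      simp only [Finset.mem_insert, Finset.mem_singleton] at ht
      rcases ht with rfl | rfl
      · exact Finset.mem_filter.2 ⟨hq, by simp⟩
      · exact Finset.mem_filter.2 ⟨hr, by simp⟩
    have htwo : ({{u, p, q}, {u, p, r}} : Finset (Finset V)).card = 2 := by
      refine Finset.card_pair fun heq => ?_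
      have : q ∈ ({u, p, r} : Finset V) := by rw [← heq]; simp
      simp only [Finset.mem_insert, Finset.mem_singleton] at this
      have := (three_distinct_of_mem hq).2.1
      grind
    have hle := Finset.card_le_card hsub
    rw [htwo] at hle
    change 2 ≤ G.faceCount u p at hle
    have hsum := hP.two_sides u p hadj
    have heq := Finset.eq_of_subset_of_card_le hsub
      (by rw [htwo]; change G.faceCount u p ≤ 2; omega)
    refine ⟨⟨hadj, by omega⟩, fun z hz => ?_⟩
    have hmem : ({u, p, z} : Finset V) ∈ G.faces.filter fun t => u ∈ t ∧ p ∈ t :=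
      Finset.mem_filter.2 ⟨hz, by simp⟩
    rw [← heq] at hmem
    have hz' : z ∈ ({u, p, z} : Finset V) := by simp
    have hz1 := (three_distinct_of_mem hz).2.1
    have hz2 := (three_distinct_of_mem hz).2.2
    simp only [Finset.mem_insert, Finset.mem_singleton] at hmem
    rcases hmem with hmem | hmem <;>
    · rw [hmem] at hz'
      simp only [Finset.mem_insert, Finset.mem_singleton, hz1.symm, hz2.symm, false_or] at hz'
      tauto
  obtain ⟨ha1, ha2⟩ := hkey a b c hab hac hbc hadja h1 h2
  obtain ⟨hb1, hb2⟩ := hkey b a c hab.symm hbc hac hadjb (by rwa [Finset.pair_comm b a]) h3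
  obtain ⟨hc1, hc2⟩ := hkey c a b hac.symm hbc.symm hab hadjc (by rwa [Finset.pair_comm c a])
    (by rwa [Finset.pair_comm c b])
  have hhole0 : ∀ i, h (i + 1) = u → ¬ (h i = a ∨ h i = b ∨ h i = c) ∧
      ¬ (h (i + 2) = a ∨ h (i + 2) = b ∨ h (i + 2) = c) := by
    intro i hi
    have g1 : ∀ p, G.IsFF u p → h i ≠ p := fun p hp hh =>
      hp.sym2_ne hP i (by rw [hh, hi, Sym2.eq_swap])
    have g2 : ∀ p, G.IsFF u p → h (i + 2) ≠ p := fun p hp hh =>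
      hp.sym2_ne hP (i + 1) (by rw [add_assoc, one_add_one_eq_two, hh, hi])
    exact ⟨by simp [g1 a ha1, g1 b hb1, g1 c hc1], by simp [g2 a ha1, g2 b hb1, g2 c hc1]⟩
  have himp : ∀ p q, (p = a ∨ p = b ∨ p = c) → ({u, p, q} : Finset V) ∈ G.faces →
      (q = a ∨ q = b ∨ q = c) := by
    rintro p q (rfl | rfl | rfl) hf
    · rcases ha2 q hf with rfl | rfl <;> simp
    · rcases hb2 q hf with rfl | rfl <;> simp
    · rcases hc2 q hf with rfl | rfl <;> simp
  have hnb : ∀ z, G.graph.Adj u z → z = a ∨ z = b ∨ z = c := by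
    intro z hz
    refine (G.iff_of_link_connected (hP.link_connected u) (fun z => z = a ∨ z = b ∨ z = c)
      ?_ ?_ a z hadja hz).1 (Or.inl rfl)
    · intro p q _ hf
      exact ⟨fun hp => himp p q hp hf, fun hq => himp q p hq (by rwa [Finset.pair_comm q p])⟩
    · intro i hi
      exact iff_of_false (hhole0 i hi).1 (hhole0 i hi).2
  have hcert : G.IsCertificate h (Function.update κ u (κ a)) := by
    constructor
    · intro t ht
      by_cases hut : u ∈ t
      · obtain ⟨p, hp, hpu⟩ : ∃ p ∈ t, p ≠ u :=
          Finset.exists_mem_ne (by rw [(G.isNClique_of_mem t ht).card_eq]; omega) u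
        refine ⟨u, hut, p, hp, hpu.symm, ?_⟩
        rw [Function.update_self, Function.update_of_ne hpu]
        rcases hnb p (adj_of_mem_faces ht hut hp hpu.symm) with rfl | rfl | rfl
        · rfl
        · exact hκab
        · exact hκac
      · obtain ⟨p, hp, q, hq, hpq, hκpq⟩ := hκ.face t ht
        refine ⟨p, hp, q, hq, hpq, ?_⟩
        rwa [Function.update_of_ne (ne_of_mem_of_not_mem hp hut),
          Function.update_of_ne (ne_of_mem_of_not_mem hq hut)]
    · have hne : ∀ i, h i ≠ u := by
        intro i hi
        have h4 := hP.hole_adj (i - 1)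
        have h5 := (hhole0 (i - 1) (by rw [sub_add_cancel, hi])).1
        rw [sub_add_cancel, hi] at h4
        exact h5 (hnb _ h4.symm)
      intro i
      rw [Function.update_of_ne (hne _), Function.update_of_ne (hne _)]
      exact hκ.hole i
  refine hirr.ne_of_isContractible hP hcert (v := u) (w := a) ⟨ha1, ?_⟩ ?_
  · rintro ⟨-, x, hx1, hx2, hx3⟩
    rcases hnb x hx1 with rfl | rfl | rfl
    · exact G.graph.loopless.irrefl _ hx2
    · exact hx3 h1
    · exact hx3 h2
  · rw [Function.update_self, Function.update_of_ne hua.symm]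

/-- An irreducible graph has no facial 3-cycles. -/
theorem IsIrreducible.faces_eq_empty (hirr : G.IsIrreducible) (hP : G.IsProjectiveWithHole h)
    (hκ : G.IsCertificate h κ) : G.faces = ∅ := by
  classical
  have : Fintype G.graph.edgeSet := Fintype.ofFinite _
  by_contra hne
  let 𝒯 : Finset (Finset V) := Finset.univ.filter fun T =>
    (G.graph.IsNClique 3 T ∧ T ∉ G.faces) ∧ ∃ u ∈ T, ∃ v ∈ T, u ≠ v ∧ κ u = κ v
  have hnf : ∀ u v, G.graph.Adj u v → κ u = κ v → ∃ x, ({u, v, x} : Finset V) ∈ 𝒯 := by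
    intro u v huv heq
    obtain ⟨x, hx⟩ := hirr.exists_nonfacial hP hκ huv heq
    exact ⟨x, Finset.mem_filter.2 ⟨Finset.mem_univ _, hx, u, by simp, v, by simp, huv.ne, heq⟩⟩
  have h𝒯 : 𝒯.Nonempty := by
    obtain ⟨t, ht⟩ := Finset.nonempty_iff_ne_empty.2 hne
    obtain ⟨u, hu, v, hv, huv, heq⟩ := hκ.face t ht
    obtain ⟨x, hx⟩ := hnf u v (adj_of_mem_faces ht hu hv huv) heq
    exact ⟨_, hx⟩
  obtain ⟨T, hT, hmin⟩ := 𝒯.exists_min_image (fun T => (inner hP.hole_adj T).card) h𝒯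
  obtain ⟨⟨hT3, hTF⟩, hTm⟩ := (Finset.mem_filter.1 hT).2
  -- An edge with ends of the same colour and a side within `T` is an edge of `T`: otherwise a
  -- nonfacial 3-cycle through it would have fewer cells on its inner side.
  have hmono : ∀ x, (G.toComplex hP.hole_adj).cell x ∈ inner hP.hole_adj T →
      ∀ u v, ((G.toComplex hP.hole_adj).edge x).1 = s(u, v) → κ u = κ v → u ∈ T ∧ v ∈ T := by
    intro x hx u v he heq
    by_contra hnT
    have huv : G.graph.Adj u v := by
      have := ((G.toComplex hP.hole_adj).edge x).2
      rwa [he] at this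
    obtain ⟨z, hz⟩ := hnf u v huv heq
    obtain ⟨⟨hT3', hTF'⟩, hTm'⟩ := (Finset.mem_filter.1 hz).2
    have hxe : (G.toComplex hP.hole_adj).edge x = ⟨s(u, v), huv⟩ := Subtype.ext he
    have hxT : (G.toComplex hP.hole_adj).edge x ∉ G.edgesIn T := by
      rw [hxe]; exact fun hm => hnT ((mk_mem_edgesIn _).1 hm)
    have huz : G.graph.Adj u z := (SimpleGraph.is3Clique_triple_iff.1 hT3').2.1
    have hvz : G.graph.Adj v z := (SimpleGraph.is3Clique_triple_iff.1 hT3').2.2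
    -- the sides at an edge of the new 3-cycle which is not an edge of `T`
    have hin : ∀ y, (G.toComplex hP.hole_adj).edge y ∈ G.edgesIn {u, v, z} →
        (G.toComplex hP.hole_adj).edge y ∉ G.edgesIn T →
        (G.toComplex hP.hole_adj).cell y ∈ inner hP.hole_adj T := by
      have hlink : ∀ p, p ∉ T → ∀ y y', p ∈ ((G.toComplex hP.hole_adj).edge y).1 →
          p ∈ ((G.toComplex hP.hole_adj).edge y').1 →
          (G.toComplex hP.hole_adj).cell y ∈ inner hP.hole_adj T →
          (G.toComplex hP.hole_adj).cell y' ∈ inner hP.hole_adj T :=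
        fun p hp y y' h1 h2 => hP.cell_mem_inner_of_notMem hp h1 h2
      have hux : u ∈ ((G.toComplex hP.hole_adj).edge x).1 := by rw [he]; simp
      have hvx : v ∈ ((G.toComplex hP.hole_adj).edge x).1 := by rw [he]; simp
      -- if `z` is not in `T`, the sides at `z` are inner, by way of the edge `uz` or `vz`
      have hzin : z ∉ T → ∀ y, z ∈ ((G.toComplex hP.hole_adj).edge y).1 →
          (G.toComplex hP.hole_adj).cell y ∈ inner hP.hole_adj T := by
        intro hzT y hy
        by_cases huT : u ∈ T
        · have hvT : v ∉ T := fun hvT => hnT ⟨huT, hvT⟩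
          obtain ⟨y', hy'⟩ := hP.toComplex_isProjective.exists_side ⟨s(v, z), hvz⟩
          refine hlink z hzT y' y (by rw [hy']; simp) hy ?_
          exact hlink v hvT x y' hvx (by rw [hy']; simp) hx
        · obtain ⟨y', hy'⟩ := hP.toComplex_isProjective.exists_side ⟨s(u, z), huz⟩
          refine hlink z hzT y' y (by rw [hy']; simp) hy ?_
          exact hlink u huT x y' hux (by rw [hy']; simp) hx
      intro y hy hyT
      have hex : ∃ p ∈ ((G.toComplex hP.hole_adj).edge y).1, p ∉ T := by
        by_contra! hall
        exact hyT (Finset.mem_filter.2 ⟨Finset.mem_univ _, fun p hp =>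
          hall p (Sym2.mem_toFinset.1 hp)⟩)
      obtain ⟨p, hp, hpT⟩ := hex
      have hp' := (Finset.mem_filter.1 hy).2 (Sym2.mem_toFinset.2 hp)
      simp only [Finset.mem_insert, Finset.mem_singleton] at hp'
      rcases hp' with rfl | rfl | rfl
      · exact hlink p hpT x y hux hp hx
      · exact hlink p hpT x y hvx hp hx
      · exact hzin hpT y hp
    -- Hence a walk of cells that starts in the hole and does not cross `T` does not cross the new
    -- 3-cycle either.
    have hsub : inner hP.hole_adj {u, v, z} ⊆ inner hP.hole_adj T := by
      intro c hc
      rw [mem_inner] at hc ⊢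
      intro hr
      apply hc
      have hwalk : ∀ c c', ((G.toComplex hP.hole_adj).regionGraph (G.edgesIn T)).Walk c c' →
          c ∉ inner hP.hole_adj T →
          ((G.toComplex hP.hole_adj).regionGraph (G.edgesIn {u, v, z})).Reachable c c' := by
        intro c c' p
        induction p with
        | nil => exact fun _ => SimpleGraph.Reachable.refl _
        | @cons c₁ c₂ c₃ hadj _ ih =>
          intro hc₁
          have hstep : c₂ ∉ inner hP.hole_adj T := by
            rw [mem_inner, not_not] at hc₁ ⊢
            exact hc₁.trans hadj.reachable
          refine SimpleGraph.Reachable.trans ?_ (ih hstep)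
          rcases ((SimpleGraph.fromRel_adj _ _ _).1 hadj).2 with
            ⟨s, t, hst, hB, rfl, rfl⟩ | ⟨s, t, hst, hB, rfl, rfl⟩
          · exact PolyComplex.regionGraph_reachable _ hst fun hB' => hc₁ (hin s hB' hB)
          · exact (PolyComplex.regionGraph_reachable _ hst
              fun hB' => hstep (hin s hB' hB)).symm
      obtain ⟨p⟩ := hr
      exact hwalk _ _ p (none_notMem_inner _)
    obtain ⟨y, -, hy, -, hy', -⟩ := hP.exists_sides hκ hT3' hTm'
      (e := ⟨s(u, v), huv⟩) ((mk_mem_edgesIn _).2 ⟨by simp, by simp⟩)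
    have hyT := cell_mem_inner hP.hole_adj (hxe.trans hy.symm) hxT hx
    exact absurd (hmin _ hz) (not_le.2 (Finset.card_lt_card
      ((Finset.ssubset_iff_of_subset hsub).2 ⟨_, hyT, hy'⟩)))
  have hface : ∀ t (ht : t ∈ G.faces), some ⟨t, ht⟩ ∈ inner hP.hole_adj T →
      ∃ u ∈ t, ∃ v ∈ t, u ≠ v ∧ u ∈ T ∧ v ∈ T ∧ κ u = κ v := by
    intro t ht htin
    obtain ⟨u, hu, v, hv, huv, heq⟩ := hκ.face t ht
    obtain ⟨i, hi⟩ := G.exists_faceVertex_side ⟨t, ht⟩ huv hu hv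
    exact ⟨u, hu, v, hv, huv, (hmono (Sum.inl (⟨t, ht⟩, i)) htin u v hi heq).1,
      (hmono (Sum.inl (⟨t, ht⟩, i)) htin u v hi heq).2, heq⟩
  -- An inner face `upq` with `u` outside of `T` has an inner neighbour `upr` with `r` in `T`.
  have hnext : ∀ p q u, p ∈ T → q ∈ T → u ∉ T → ∀ hf : ({u, p, q} : Finset V) ∈ G.faces,
      some ⟨_, hf⟩ ∈ inner hP.hole_adj T → ∃ r ∈ T, r ≠ q ∧ r ≠ p ∧
      ({u, p, r} : Finset V) ∈ G.faces ∧ κ p = κ r := by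
    intro p q u hp hq hu hf hin
    obtain ⟨hup, huq, hpq⟩ := three_distinct_of_mem hf
    have hadj : G.graph.Adj u p := adj_of_mem_faces hf (by simp) (by simp) hup
    obtain ⟨i, hi⟩ := G.exists_faceVertex_side ⟨_, hf⟩ hup (by simp) (by simp)
    have hside : ∀ y, u ∈ ((G.toComplex hP.hole_adj).edge y).1 →
        (G.toComplex hP.hole_adj).cell y ∈ inner hP.hole_adj T := fun y hy =>
      hP.cell_mem_inner_of_notMem hu (x := Sum.inl (⟨_, hf⟩, i))
        (by
          change u ∈ s(G.faceVertex ⟨_, hf⟩ i, G.faceVertex ⟨_, hf⟩ (i + 1))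
          rw [hi]; simp) hy hin
    have hFF : G.IsFF u p := by
      refine ⟨hadj, ?_⟩
      have h2 := hP.two_sides u p hadj
      have h0 : holeCount h u p = 0 := by
        by_contra hpos
        obtain ⟨j, hj⟩ := holeCount_pos_iff.1 (Nat.pos_of_ne_zero hpos)
        exact none_notMem_inner hP.hole_adj (hside (Sum.inr j)
          (by change u ∈ s(h j, h (j + 1)); rw [hj]; simp))
      omega
    obtain ⟨x, y, hxy, hx, hy, hF2⟩ := hFF.exists_faces
    obtain ⟨r, hr, hrq⟩ : ∃ r, ({u, p, r} : Finset V) ∈ G.faces ∧ r ≠ q := by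
      by_cases hxq : x = q
      · exact ⟨y, hy, fun hyq => hxy (hxq.trans hyq.symm)⟩
      · exact ⟨x, hx, hxq⟩
    obtain ⟨j, hj⟩ := G.exists_faceVertex_side ⟨_, hr⟩ hup (by simp) (by simp)
    have hrin : some ⟨_, hr⟩ ∈ inner hP.hole_adj T := hside (Sum.inl (⟨_, hr⟩, j))
      (by
        change u ∈ s(G.faceVertex ⟨_, hr⟩ j, G.faceVertex ⟨_, hr⟩ (j + 1))
        rw [hj]; simp)
    obtain ⟨a, ha, b, hb, hab, haT, hbT, heq⟩ := hface _ hr hrin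
    have hrp := (three_distinct_of_mem hr).2.2
    have hau : a ≠ u := fun hh => hu (hh ▸ haT)
    have hbu : b ≠ u := fun hh => hu (hh ▸ hbT)
    simp only [Finset.mem_insert, Finset.mem_singleton, hau, hbu, false_or] at ha hb
    rcases ha with rfl | rfl <;> rcases hb with rfl | rfl
    · exact absurd rfl hab
    · exact ⟨b, hbT, hrq, hrp.symm, hr, heq⟩
    · exact ⟨a, haT, hrq, hrp.symm, hr, heq.symm⟩
    · exact absurd rfl hab
  -- some face within `T`
  obtain ⟨a₀, ha₀, b₀, hb₀, hab₀, -⟩ := hTm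
  obtain ⟨-, y, -, -, -, hyin⟩ := hP.exists_sides hκ hT3 (Finset.mem_filter.1 hT).2.2
    (e := ⟨s(a₀, b₀), hT3.isClique ha₀ hb₀ hab₀⟩) ((mk_mem_edgesIn _).2 ⟨ha₀, hb₀⟩)
  obtain ⟨⟨t, ht⟩, hty⟩ := Option.ne_none_iff_exists'.1
    (fun hh => none_notMem_inner hP.hole_adj (hh ▸ hyin) :
      (G.toComplex hP.hole_adj).cell y ≠ none)
  rw [hty] at hyin
  obtain ⟨p, hp, q, hq, hpq, hpT, hqT, heq⟩ := hface t ht hyin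
  obtain ⟨u, htu⟩ := exists_third ht hpq hp hq
  have htu' : t = {u, p, q} := by rw [htu]; ext z; simp; tauto
  subst htu'
  -- otherwise the face would be `T`
  have huT : u ∉ T := by
    intro huT
    apply hTF
    have hsub : ({u, p, q} : Finset V) ⊆ T := by
      intro z hz
      simp only [Finset.mem_insert, Finset.mem_singleton] at hz
      rcases hz with rfl | rfl | rfl <;> assumption
    rwa [← Finset.eq_of_subset_of_card_le hsub
      (by rw [hT3.card_eq, (G.isNClique_of_mem _ ht).card_eq])]
  obtain ⟨r, hrT, hrq, hrp, hr, hκr⟩ := hnext p q u hpT hqT huT ht hyin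
  have ht2 : ({u, q, p} : Finset V) ∈ G.faces := by rwa [Finset.pair_comm q p]
  obtain ⟨r', hrT', hrp', hrq', hr', -⟩ := hnext q p u hqT hpT huT ht2
    (by convert hyin using 3; rw [Finset.pair_comm q p])
  have hTeq : ({p, q, r} : Finset V) = T := by
    refine Finset.eq_of_subset_of_card_le ?_ ?_
    · intro z hz
      simp only [Finset.mem_insert, Finset.mem_singleton] at hz
      rcases hz with rfl | rfl | rfl <;> assumption
    · rw [hT3.card_eq, Finset.card_eq_three.2 ⟨p, q, r, hpq, hrp.symm, hrq.symm, rfl⟩]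
  have hrr : r' = r := by
    rw [← hTeq] at hrT'
    simp only [Finset.mem_insert, Finset.mem_singleton] at hrT'
    tauto
  subst hrr
  exact hirr.not_degree_three hP hκ hpq hrp.symm hrq.symm ht hr hr' heq hκr

end

end FacedGraph

theorem proposition5p1 {V : Type*} [Fintype V] [DecidableEq V] (G : FacedGraph V)
    (hG : G.MemP1) (hirr : G.IsIrreducible) : G.IsUncontractible := by
  obtain ⟨⟨s, h, hP⟩, ht⟩ := hG
  have : NeZero s := ⟨by have := hP.three_le; omega⟩
  have hs : s = 6 := by
    have : Fintype G.graph.edgeSet := Fintype.ofFinite _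
    exact hP.length_eq_iff.1 ht.2
  subst hs
  obtain ⟨κ, hκ⟩ := hP.exists_isCertificate ht
  intro u v hFF
  have h2 := hFF.2
  rw [FacedGraph.faceCount, hirr.faces_eq_empty hP hκ] at h2
  simp at h2
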